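/- **Setting.** Let $\mathbf e_1=(\tfrac{\sqrt3}{2},\tfrac12)$, $\mathbf e_2=(\tfrac{\sqrt3}{2},-\tfrac12)$, $\mathbf e_3=\mathbf e_1-\mathbf e_2=(0,1)$, and let $\mathbf T=\mathbb Z\mathbf e_1+\mathbb Z\mathbf e_2\subset\mathbb R^2$ be the triangular lattice, each site of which has the six neighbours reached by the steps $\pm\mathbf e_1,\pm\mathbf e_2,\pm\mathbf e_3$. For $x=a\mathbf e_1+b\mathbf e_2$ write $x(1)=a$, $x(2)=b$. For $K\subseteq\mathbf T$, the *prudent walk with past $K$* is the process $(X_n)_{n\ge0}$ on $\mathbf T$ with $X_0=0$ which, given $X_0,\dots,X_n$, chooses $X_{n+1}-X_n$ uniformly among the steps $d\in\{\pm\mathbf e_1,\pm\mathbf e_2,\pm\mathbf e_3\}$ for which the ray $\{X_n+jd: j\ge1\}$ contains no site of $K\cup\{X_0,\dots,X_n\}$. The *prudent walk* $\gamma$ is the prudent walk with past $\emptyset$. The *corners process* $\hat\gamma$ is the prudent walk with past $\{x\in\mathbf T: x(1)\le0,\ x(2)\le0\}$, that is, started at the corner of an infinite box all of whose sites count as visited.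 For a path $\gamma$ let $W_t=1+\max_{s\le t}\gamma_s(1)-\min_{s\le t}\gamma_s(1)$ and $H_t=1+\max_{s\le t}\gamma_s(2)-\min_{s\le t}\gamma_s(2)$ be the width and height of its box, so $W_0=H_0=1$. Let $T_0=0$, $U_0=\inf\{t>0:H_t>1\}-1$ and, for $k\ge0$, $$T_{k+1}=\inf\{t>U_k+1: W_t>W_{t-1}\}-1,\qquad U_{k+1}=\inf\{t>T_{k+1}+1: H_t>H_{t-1}\}-1 ,$$ with $\inf\emptyset=\infty$. The vertical excursions are the pieces of the path over $(T_k,U_k]$ and the horizontal ones those over $(U_k,T_{k+1}]$. Let $\mathcal Q_1$ be the event that the walker $\gamma$ settles in the first quadrant $\{x\in\mathbf T:x(1)\ge0,\ x(2)\ge0\}$: for all sufficiently large $k$ the times $U_k$ and $T_{k+1}$ are finite, and the last steps $\gamma_{U_k}$ and $\gamma_{T_{k+1}}$ of the excursions lie in the first quadrant. **Theorem.** There is a coupling of the prudent walk $\gamma$ with the corners process $\hat\gamma$, i.e. a probability space $(\Omega,\mathcal F,\mathbf P)$ carrying both processes, such that $\mathbf P(\mathcal Q_1)>0$; $$\sup_{t\ge0}\|\hat\gamma_t-\gamma_t\|_2<\infty\quad\text{almost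 surely on }\mathcal Q_1;$$ and, for every $\epsilon>0$, $$\lim_{t\to\infty}\mathbf P\Big(\sup_{0\le s\le t}\Big\|\frac1t\big(\hat\gamma_s-\gamma_s\big)\Big\|_2\ge\epsilon\ \Big|\ \mathcal Q_1\Big)=0 ,$$ where $s,t$ range over the integer times of the walks and $\|\cdot\|_2$ is the Euclidean norm. -/

import Mathlib

open MeasureTheory Filter Topology
open scoped ENNReal

namespace TriPrudent

/-- Sites of the triangular lattice `T`: the pair `(a, b)` stands for the point `a • e₁ + b • e₂`. -/
abbrev Site : Type := ℤ × ℤ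

/-- The basis vector `e₁ = (√3/2, 1/2)`. -/
noncomputable def e₁ : EuclideanSpace ℝ (Fin 2) := !₂[√3 / 2, 1 / 2]

/-- The basis vector `e₂ = (√3/2, -1/2)`. -/
noncomputable def e₂ : EuclideanSpace ℝ (Fin 2) := !₂[√3 / 2, -(1 / 2)]

/-- The point of the Euclidean plane that a site stands for. -/
noncomputable def pos (x : Site) : EuclideanSpace ℝ (Fin 2) :=
  (x.1 : ℝ) • e₁ + (x.2 : ℝ) • e₂

/-- The six unit steps `±e₁`, `±e₂`, `±e₃` of the triangular lattice, where
`e₃ = e₁ - e₂ = (0, 1)`. -/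
def steps : Finset Site :=
  {(1, 0), (-1, 0), (0, 1), (0, -1), (1, -1), (-1, 1)}

/-- The steps from `y` that are prudent with respect to the set `V` of visited sites:
the whole lattice ray that starts at `y` in the direction of the step avoids `V`. -/
noncomputable def allowed (V : Set Site) (y : Site) : Finset Site :=
  open Classical in steps.filter fun d => ∀ n : ℕ, 1 ≤ n → y + n • d ∉ V

/-- The probability of the step `d` from `y`: uniform among the prudent steps. -/
noncomputable def stepProb (V : Set Site) (y d : Site) : ℝ≥0∞ :=
  open Classical in if d ∈ allowed V y then ((allowed V y).card : ℝ≥0∞)⁻¹ else 0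

/-- `X` is a prudent walk from the origin under `P`, where the sites of `K` count as visited
from the start: given the path up to time `n`, the next step is uniform among
the steps which do not point towards `K` or towards a site already visited by the path. -/
def IsPrudentWalkPast (K : Set Site) {Ω : Type*} [MeasurableSpace Ω] (P : Measure Ω)
    (X : ℕ → Ω → Site) : Prop :=
  (∀ n, Measurable (X n)) ∧ (∀ᵐ ω ∂P, X 0 ω = 0) ∧
    ∀ (n : ℕ) (x : ℕ → Site),
      P {ω | ∀ i ≤ n + 1, X i ω = x i} =
        P {ω | ∀ i ≤ n, X i ω = x i} *
          stepProb (K ∪ {y | ∃ i ≤ n, x i = y}) (x n) (x (n + 1) - x n)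

/-- The (kinetic) prudent walk on the triangular lattice, started at the origin. -/
def IsPrudentWalk {Ω : Type*} [MeasurableSpace Ω] (P : Measure Ω) (γ : ℕ → Ω → Site) : Prop :=
  IsPrudentWalkPast ∅ P γ

/-- The infinite box whose corner is the origin and whose two sides are half-lines
in the directions `-e₁` and `-e₂`. -/
def cornerBox : Set Site := {x | x.1 ≤ 0 ∧ x.2 ≤ 0}

/-- The corners process of the first quadrant: the prudent walk which starts at the corner
of the infinite box, all of whose sites count as visited. Both sides of its box are infinite,
so its excursions along them are never truncated at a far corner. -/
def IsCornersProcess {Ω : Type*} [MeasurableSpace Ω] (P : Measure Ω) (γ : ℕ → Ω → Site) : Prop :=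
  IsPrudentWalkPast cornerBox P γ

/-- `1 + max_{s ≤ t} f s - min_{s ≤ t} f s`, the number of lattice lines met by a box side. -/
def extent (f : ℕ → ℤ) (t : ℕ) : ℤ :=
  1 + (Finset.range (t + 1)).sup' Finset.nonempty_range_add_one f
    - (Finset.range (t + 1)).inf' Finset.nonempty_range_add_one f

/-- The width at time `t` of the box of a path, i.e. of the smallest lattice parallelogram
with sides parallel to `e₁` and `e₂` that contains the path up to time `t`;
it is `1` at time `0`. -/
def width (x : ℕ → Site) (t : ℕ) : ℤ := extent (fun s => (x s).1) t

/-- The height at time `t` of the box of a path; it is `1` at time `0`. -/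
def height (x : ℕ → Site) (t : ℕ) : ℤ := extent (fun s => (x s).2) t

/-- `inf {t > τ : f t > f (t - 1)}`, which is `⊤` if there is no such `t`. -/
noncomputable def nextGrowth (f : ℕ → ℤ) (τ : ℕ∞) : ℕ∞ :=
  ⨅ (t : ℕ) (_ : τ < (t : ℕ∞) ∧ f (t - 1) < f t), (t : ℕ∞)

/-- The time at which the width grows just after the `k`-th horizontal excursion. With
`T_k + 1 = growthT x k` for `k ≥ 1` and `U_k + 1 = nextGrowth (height x) (growthT x k)`,
each of these times is the first growth of the width (height) which is strictly later than
the preceding growth of the height (width), so that a single step `±e₃`, in which width and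
height can grow together, counts for one of them only. -/
noncomputable def growthT (x : ℕ → Site) : ℕ → ℕ∞
  | 0 => 0
  | k + 1 => nextGrowth (width x) (nextGrowth (height x) (growthT x k))

/-- The times `T_0 = 0`, `T_{k+1} = inf {t > U_k + 1 : W_t > W_{t-1}} - 1`. The height grows at
time `U_k + 1`; if the width does not, the condition `t > U_k + 1` can be replaced
by `t > U_k`. -/
noncomputable def timeT (x : ℕ → Site) (k : ℕ) : ℕ∞ := growthT x k - 1

/-- The times `U_0 = inf {t > 0 : H_t > 1} - 1`,
`U_{k+1} = inf {t > T_{k+1} + 1 : H_t > H_{t-1}} - 1`. -/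
noncomputable def timeU (x : ℕ → Site) (k : ℕ) : ℕ∞ := nextGrowth (height x) (growthT x k) - 1

/-- The first quadrant of the lattice with respect to the basis `e₁, e₂`. -/
def firstQuadrant : Set Site := {x | 0 ≤ x.1 ∧ 0 ≤ x.2}

/-- The event `Q₁` that the walk settles in the first quadrant: from some excursion on,
every vertical excursion (over `(T_k, U_k]`) and every horizontal excursion
(over `(U_k, T_{k+1}]`) ends, and its last step is in the first quadrant. -/
def settlesQ₁ {Ω : Type*} (γ : ℕ → Ω → Site) : Set Ω :=
  {ω | ∃ K : ℕ, ∀ k ≥ K, ∃ u t : ℕ,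
    timeU (fun s => γ s ω) k = (u : ℕ∞) ∧ timeT (fun s => γ s ω) (k + 1) = (t : ℕ∞) ∧
      γ u ω ∈ firstQuadrant ∧ γ t ω ∈ firstQuadrant}

/-- `sup_{0 ≤ s ≤ t} ‖(1/t) (γhat_s - γ_s)‖₂`. -/
noncomputable def scaledSupDist {Ω : Type*} (γhat γ : ℕ → Ω → Site) (t : ℕ) (ω : Ω) : ℝ :=
  (Finset.range (t + 1)).sup' Finset.nonempty_range_add_one
    fun s => ‖(1 / (t : ℝ)) • (pos (γhat s ω) - pos (γ s ω))‖

end TriPrudent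

/-! Look at a prudent walk from the sides a ≤ A, b ≤ B, a + b ≤ C of its hull. As long as it keeps
within the range of coordinates already visited on the far sides, the distances to these three sides
and the set of prudent directions form a Markov chain (`WS`, `IsW.next`). The chain is the same for
a finite box and for the infinite corner box. At the state `fresh` the walker sits at a corner of
its hull and the past is irrelevant for the future of the chain.

This gives the coupling. One sequence of random numbers drives both processes, and whenever the walk
is at `fresh` while the corners process is not, the walk waits. Waiting is decided by the past
alone, so it does not change the law (`IsDelayed.isPrudentWalkPast`). A walk that settles is
confined to a translate of the quadrant (`Prudent.confined_of_settles`): a drop behind the box would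
trap it there until the end of an excursion. A confined walk is eventually described by the chain
and almost surely visits `fresh` again (`ae_exists_fresh`). From such a visit, made jointly with the
corners process, both make equal steps with a fixed time lag (`exists_parallel`). Their distance is
thus bounded, and the convergence in conditional probability follows from almost sure convergence.

Recurrence of `fresh` rests on a Lyapunov function. The function `height` is a martingale of bounded
increments, comparable to the distance from the corner along the outer sides. A power 2/7 of 2
`height`² plus a correction is superharmonic far from the corner; a bounded strictly superharmonic
function repairs the rest (`exists_superharmonic`, `tendsto_notHit`).

Settling has positive probability because the box grows faster than excursions can outrun it.
Between two visits to `fresh`, reaching `height` m costs a probability of order at most m^(-4/7), by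
the same Lyapunov function. The box side grows by g with a probability at least of order g^(-1/2)
(`exists_le_reach`). As 4/7 > 1/2, the sum A^(-1/28) + B^(-1/28) for large box sides A, B bounds the
probability of ever leaving the quadrant (`exists_exitBlocks_fresh_le`). From a large enough box
this is at most 1/2, and a prudent path to the corner of such a box has positive probability. -/

namespace TriPrudent

/-! ### The Markov chain of states seen from the hull -/

/-- The six directions of the lattice: `E, W = ±e₁`, `N, S = ±e₂`, `D, A = ±e₃`. -/
inductive Dir
  | E | W | N | S | D | A
  deriving DecidableEq

instance : Fintype Dir := ⟨{.E, .W, .N, .S, .D, .A}, fun d => by cases d <;> decide⟩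

/-- State of the walk seen from its hull `{a ≤ A, b ≤ B, a + b ≤ C}`: the distances of the walker
to the three sides of the hull and the set of the prudent directions. -/
structure WS where
  dA : ℕ
  dB : ℕ
  dC : ℕ
  F : Finset Dir
  deriving DecidableEq

namespace WS

open Dir

/-- The state after a step in a prudent direction. -/
def next (w : WS) : Dir → WS
  | E => ⟨w.dA - 1, w.dB, w.dC - 1, {E, N} ∪ (if w.dA = 0 then {S} else ∅) ∪
      (if w.dB = 0 ∨ w.dC = 0 then {A} else ∅) ∪ (if w.dA = 0 ∨ w.dC = 0 then {D} else ∅)⟩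
  | N => ⟨w.dA, w.dB - 1, w.dC - 1, {E, N} ∪ (if w.dB = 0 then {W} else ∅) ∪
      (if w.dB = 0 ∨ w.dC = 0 then {A} else ∅) ∪ (if w.dA = 0 ∨ w.dC = 0 then {D} else ∅)⟩
  | W => ⟨w.dA + 1, w.dB, w.dC + 1, {W, N, A}⟩
  | S => ⟨w.dA, w.dB + 1, w.dC + 1, {S, E, D}⟩
  | D => ⟨w.dA - 1, w.dB + 1, w.dC, {E, N, D} ∪ (if w.dA = 0 then {S} else ∅)⟩
  | A => ⟨w.dA + 1, w.dB - 1, w.dC, {E, N, A} ∪ (if w.dB = 0 then {W} else ∅)⟩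

/-- The states that the walk can be in. -/
inductive Good : WS → Prop
  | tip : Good ⟨0, 0, 0, {E, N, D, A}⟩
  | tipW : Good ⟨0, 0, 0, {E, W, N, D, A}⟩
  | tipS : Good ⟨0, 0, 0, {E, N, S, D, A}⟩
  | topCorner (a : ℕ) : Good ⟨a + 1, 0, 0, {E, N, A}⟩
  | topCornerD (a : ℕ) : Good ⟨a + 1, 0, 0, {E, N, D, A}⟩
  | topCornerW (a : ℕ) : Good ⟨a + 1, 0, 0, {E, W, N, A}⟩
  | topCornerWD (a : ℕ) : Good ⟨a + 1, 0, 0, {E, W, N, D, A}⟩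
  | rightCorner (b : ℕ) : Good ⟨0, b + 1, 0, {E, N, D}⟩
  | rightCornerA (b : ℕ) : Good ⟨0, b + 1, 0, {E, N, D, A}⟩
  | rightCornerS (b : ℕ) : Good ⟨0, b + 1, 0, {E, N, S, D}⟩
  | rightCornerSA (b : ℕ) : Good ⟨0, b + 1, 0, {E, N, S, D, A}⟩
  | diag (a b : ℕ) : Good ⟨a + 1, b + 1, 0, {E, N, D, A}⟩
  | diagA (a b : ℕ) : Good ⟨a + 1, b + 1, 0, {E, N, A}⟩
  | diagD (a b : ℕ) : Good ⟨a + 1, b + 1, 0, {E, N, D}⟩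
  | top (l d : ℕ) : Good ⟨l + d + 2, 0, d + 1, {E, W, N, A}⟩
  | topE (l d : ℕ) : Good ⟨l + d + 2, 0, d + 1, {E, N, A}⟩
  | topW (l d : ℕ) : Good ⟨l + d + 1, 0, d + 1, {W, N, A}⟩
  | right (l d : ℕ) : Good ⟨0, l + d + 2, d + 1, {E, N, S, D}⟩
  | rightN (l d : ℕ) : Good ⟨0, l + d + 2, d + 1, {E, N, D}⟩
  | rightS (l d : ℕ) : Good ⟨0, l + d + 1, d + 1, {E, S, D}⟩

/-- The state of a walker at a corner of the infinite box. -/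
def fresh : WS := ⟨0, 0, 0, {E, N, D, A}⟩

/-- A linear coordinate along the boundary of the hull, corrected such that it is a martingale. -/
def height (w : WS) : ℤ :=
  if w.dC = 0 then
    if w.dB = 0 then
      if w.dA = 0 then (if W ∈ w.F then 1 else 0) - (if S ∈ w.F then 1 else 0)
      else w.dA + 1 + (if W ∈ w.F then 1 else 0) - (if D ∈ w.F then 1 else 0)
    else if w.dA = 0 then
      -(w.dB + 1 + (if S ∈ w.F then 1 else 0) - (if A ∈ w.F then 1 else 0))
    else w.dA - w.dB + (if A ∈ w.F then 1 else 0) - (if D ∈ w.F then 1 else 0)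
  else if w.dB = 0 then
    w.dA + w.dC + 2 + (if E ∈ w.F then 0 else 1) - (if W ∈ w.F then 0 else 1)
  else -(w.dB + w.dC + 2 + (if N ∈ w.F then 0 else 1) - (if S ∈ w.F then 0 else 1))

/-- A correction to the square of `height`. -/
def corr (w : WS) : ℤ :=
  if w.dC = 0 then
    if w.dB = 0 then
      if w.dA = 0 then 0
      else 15 * w.dA + (if W ∈ w.F then (if D ∈ w.F then 0 else 6)
        else (if D ∈ w.F then -5 else -1))
    else if w.dA = 0 then
      15 * w.dB + (if S ∈ w.F then (if A ∈ w.F then 0 else 6)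
        else (if A ∈ w.F then -5 else -1))
    else 15 * (w.dA + w.dB) - 6 + (if A ∈ w.F ∧ D ∈ w.F then 6 else 0)
  else if w.dB = 0 then
    15 * w.dA + 4 * w.dC + 6 + (if E ∈ w.F then 0 else 12) - (if W ∈ w.F then 0 else 7)
  else 15 * w.dB + 4 * w.dC + 6 + (if N ∈ w.F then 0 else 12) - (if S ∈ w.F then 0 else 7)

set_option maxHeartbeats 1000000 in
-- The linear part is the distance along the boundary, positive on the top side and negative on the
-- right side. The indicators of prudent directions in `height` cancel the drift that blocked
-- directions cause. The case splits on small distances are needed where a step changes the branch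
-- of `height`.
theorem sum_height_next {w : WS} (hw : Good w) :
    ∑ d ∈ w.F, (height (w.next d) - height w) = 0 := by
  cases hw with
  | tip => decide
  | tipW => decide
  | tipS => decide
  | topCorner a => rcases a with _ | a <;> simp [next, height] <;> ring
  | topCornerD a => rcases a with _ | a <;> simp [next, height] <;> ring
  | topCornerW a => rcases a with _ | a <;> simp [next, height] <;> ring
  | topCornerWD a => rcases a with _ | a <;> simp [next, height] <;> ring
  | rightCorner a => rcases a with _ | a <;> simp [next, height] <;> ring
  | rightCornerA a => rcases a with _ | a <;> simp [next, height] <;> ring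
  | rightCornerS a => rcases a with _ | a <;> simp [next, height] <;> ring
  | rightCornerSA a => rcases a with _ | a <;> simp [next, height] <;> ring
  | diag a b => rcases a with _ | a <;> rcases b with _ | b <;> simp [next, height] <;> ring
  | diagA a b => rcases a with _ | a <;> rcases b with _ | b <;> simp [next, height] <;> ring
  | diagD a b => rcases a with _ | a <;> rcases b with _ | b <;> simp [next, height] <;> ring
  | top l d => rcases d with _ | d <;> simp [next, height] <;> ring
  | topE l d => rcases d with _ | d <;> simp [next, height] <;> ring
  | topW l d => rcases d with _ | d <;> simp [next, height] <;> ring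
  | right l d => rcases d with _ | d <;> simp [next, height] <;> ring
  | rightN l d => rcases d with _ | d <;> simp [next, height] <;> ring
  | rightS l d => rcases d with _ | d <;> simp [next, height] <;> ring

theorem Good.of_tip {F : Finset Dir}
    (h : F = {E, N, D, A} ∨ F = {E, W, N, D, A} ∨ F = {E, N, S, D, A}) : Good ⟨0, 0, 0, F⟩ := by
  rcases h with rfl | rfl | rfl
  exacts [.tip, .tipW, .tipS]

theorem Good.of_topCorner {a : ℕ} {F : Finset Dir} (ha : a ≠ 0)
    (h : F = {E, N, A} ∨ F = {E, N, D, A} ∨ F = {E, W, N, A} ∨ F = {E, W, N, D, A}) :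
    Good ⟨a, 0, 0, F⟩ := by
  obtain ⟨a, rfl⟩ := Nat.exists_eq_succ_of_ne_zero ha
  rcases h with rfl | rfl | rfl | rfl
  exacts [.topCorner a, .topCornerD a, .topCornerW a, .topCornerWD a]

theorem Good.of_rightCorner {b : ℕ} {F : Finset Dir} (hb : b ≠ 0)
    (h : F = {E, N, D} ∨ F = {E, N, D, A} ∨ F = {E, N, S, D} ∨ F = {E, N, S, D, A}) :
    Good ⟨0, b, 0, F⟩ := by
  obtain ⟨b, rfl⟩ := Nat.exists_eq_succ_of_ne_zero hb
  rcases h with rfl | rfl | rfl | rfl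
  exacts [.rightCorner b, .rightCornerA b, .rightCornerS b, .rightCornerSA b]

theorem Good.of_diag {a b : ℕ} {F : Finset Dir} (ha : a ≠ 0) (hb : b ≠ 0)
    (h : F = {E, N, D, A} ∨ F = {E, N, A} ∨ F = {E, N, D}) : Good ⟨a, b, 0, F⟩ := by
  obtain ⟨a, rfl⟩ := Nat.exists_eq_succ_of_ne_zero ha
  obtain ⟨b, rfl⟩ := Nat.exists_eq_succ_of_ne_zero hb
  rcases h with rfl | rfl | rfl
  exacts [.diag a b, .diagA a b, .diagD a b]

theorem Good.of_top {a c : ℕ} {F : Finset Dir} (hc : c ≠ 0) (ha : c < a)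
    (h : F = {E, W, N, A} ∨ F = {E, N, A}) : Good ⟨a, 0, c, F⟩ := by
  obtain ⟨c, rfl⟩ := Nat.exists_eq_succ_of_ne_zero hc
  obtain ⟨l, rfl⟩ : ∃ l, a = l + c + 2 := ⟨a - c - 2, by omega⟩
  rcases h with rfl | rfl
  exacts [.top l c, .topE l c]

theorem Good.of_topW {a c : ℕ} {F : Finset Dir} (hc : c ≠ 0) (ha : c ≤ a)
    (h : F = {W, N, A}) : Good ⟨a, 0, c, F⟩ := by
  obtain ⟨c, rfl⟩ := Nat.exists_eq_succ_of_ne_zero hc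
  obtain ⟨l, rfl⟩ : ∃ l, a = l + c + 1 := ⟨a - c - 1, by omega⟩
  rcases h with rfl
  exact .topW l c

theorem Good.of_right {b c : ℕ} {F : Finset Dir} (hc : c ≠ 0) (hb : c < b)
    (h : F = {E, N, S, D} ∨ F = {E, N, D}) : Good ⟨0, b, c, F⟩ := by
  obtain ⟨c, rfl⟩ := Nat.exists_eq_succ_of_ne_zero hc
  obtain ⟨l, rfl⟩ : ∃ l, b = l + c + 2 := ⟨b - c - 2, by omega⟩
  rcases h with rfl | rfl
  exacts [.right l c, .rightN l c]

theorem Good.of_rightS {b c : ℕ} {F : Finset Dir} (hc : c ≠ 0) (hb : c ≤ b)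
    (h : F = {E, S, D}) : Good ⟨0, b, c, F⟩ := by
  obtain ⟨c, rfl⟩ := Nat.exists_eq_succ_of_ne_zero hc
  obtain ⟨l, rfl⟩ : ∃ l, b = l + c + 1 := ⟨b - c - 1, by omega⟩
  rcases h with rfl
  exact .rightS l c

set_option maxHeartbeats 2000000 in
theorem Good.next {w : WS} (hw : Good w) {d : Dir} (hd : d ∈ w.F) : Good (w.next d) := by
  cases hw with
  | tip | tipW | tipS =>
    revert hd
    cases d <;> intro hd <;> first
      | (refine absurd hd ?_; simp; done)
      | (refine Good.of_tip ?_; decide)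
      | (refine Good.of_topCorner ?_ ?_ <;> [decide; decide])
      | (refine Good.of_rightCorner ?_ ?_ <;> [decide; decide])
      | (refine Good.of_topW ?_ ?_ ?_ <;> [decide; decide; decide])
      | (refine Good.of_rightS ?_ ?_ ?_ <;> [decide; decide; decide])
  | topCorner a | topCornerD a | topCornerW a | topCornerWD a
  | rightCorner a | rightCornerA a | rightCornerS a | rightCornerSA a =>
    revert hd
    rcases a with _ | a <;> cases d <;> intro hd <;> first
      | (refine absurd hd ?_; simp; done)
      | (refine Good.of_tip ?_; decide)
      | (simp only [WS.next, Nat.add_sub_cancel, Nat.succ_ne_zero, reduceIte, true_or, or_true,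
          or_self, Nat.zero_add, Nat.zero_sub]
         first
          | (refine Good.of_topCorner ?_ ?_ <;> [simp; decide])
          | (refine Good.of_rightCorner ?_ ?_ <;> [simp; decide])
          | (refine Good.of_diag ?_ ?_ ?_ <;> [simp; simp; decide])
          | (refine Good.of_topW ?_ ?_ ?_ <;> [simp; simp; decide])
          | (refine Good.of_rightS ?_ ?_ ?_ <;> [simp; simp; decide]))
  | diag a b | diagA a b | diagD a b =>
    revert hd
    rcases a with _ | a <;> rcases b with _ | b <;> cases d <;> intro hd <;> first
      | (refine absurd hd ?_; simp; done)
      | (simp only [WS.next, Nat.add_sub_cancel, Nat.succ_ne_zero, reduceIte, true_or, or_true,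
          or_self, Nat.zero_add, Nat.zero_sub]
         first
          | (refine Good.of_topCorner ?_ ?_ <;> [simp; decide])
          | (refine Good.of_rightCorner ?_ ?_ <;> [simp; decide])
          | (refine Good.of_diag ?_ ?_ ?_ <;> [simp; simp; decide]))
  | top l c | topE l c | topW l c | right l c | rightN l c | rightS l c =>
    revert hd
    rcases c with _ | c <;> cases d <;> intro hd <;> first
      | (refine absurd hd ?_; simp; done)
      | (simp only [WS.next, Nat.add_sub_cancel, Nat.succ_ne_zero, reduceIte, true_or, or_true,
          or_self, Nat.zero_add, Nat.zero_sub]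
         first
          | (refine Good.of_topCorner ?_ ?_ <;> [simp; decide])
          | (refine Good.of_rightCorner ?_ ?_ <;> [simp; decide])
          | (refine Good.of_top ?_ ?_ ?_ <;> [simp; omega; decide])
          | (refine Good.of_right ?_ ?_ ?_ <;> [simp; omega; decide])
          | (refine Good.of_topW ?_ ?_ ?_ <;> [simp; omega; decide])
          | (refine Good.of_rightS ?_ ?_ ?_ <;> [simp; omega; decide]))

end WS
end TriPrudent

/-! ### Drift inequalities and bounds for `height` and `corr` -/

namespace TriPrudent
namespace WS
open Dir

set_option maxHeartbeats 2000000 in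
-- This is the second-order condition for (2 M² + Z + 1)^(2/7), M = `height`, Z = `corr`, to be
-- superharmonic when M² dominates. With increments m and z, the expansion times 49 is 14 (2 m² + z)
-- - 40 m² = 14 z - 12 m² after averaging; half of it must be negative. The term with the
-- cardinality is slack for the errors.
theorem near_ineq {w : WS} (hw : Good w) (hL : 2 ≤ w.dA + w.dB) (h : w.dA = 0 ∨ w.dB = 0) :
    7 * ∑ d ∈ w.F, (corr (w.next d) - corr w) + 2 * (w.F.card : ℤ) ≤
      6 * ∑ d ∈ w.F, (height (w.next d) - height w) ^ 2 := by
  cases hw with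
  | tip | tipW | tipS => simp at hL
  | topCorner a | topCornerD a | topCornerW a | topCornerWD a
  | rightCorner a | rightCornerA a | rightCornerS a | rightCornerSA a =>
    rcases a with _ | a
    · simp at hL
    · simp [next, height, corr]
      ring_nf
      omega
  | diag a b | diagA a b | diagD a b => simp at h
  | top l d | topE l d | topW l d | right l d | rightN l d | rightS l d =>
    rcases d with _ | d
    · simp [next, height, corr]
      ring_nf
      omega
    · simp [next, height, corr]
      ring_nf
      omega

set_option maxHeartbeats 2000000 in
-- Strictly inside the diagonal side `height` can vanish far from the corner, so the concavity of
-- the power cannot be used. The correction `corr` must here compensate the full growth 2 m² of the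
-- quadratic term, which is the factor -14.
theorem far_ineq {w : WS} (hw : Good w) (hL : 3 ≤ w.dA + w.dB) (h : w.dA ≠ 0 ∧ w.dB ≠ 0) :
    7 * ∑ d ∈ w.F, (corr (w.next d) - corr w) + 2 * (w.F.card : ℤ) ≤
      -14 * ∑ d ∈ w.F, (height (w.next d) - height w) ^ 2 := by
  cases hw with
  | diag a b | diagA a b | diagD a b =>
    rcases a with _ | a <;> rcases b with _ | b
    · simp at hL
    all_goals
      simp [next, height, corr]
      ring_nf
      omega
  | _ => simp at h

set_option maxHeartbeats 2000000 in
theorem abs_height_next_sub_le {w : WS} (hw : Good w) {d : Dir} (hd : d ∈ w.F) :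
    |height (w.next d) - height w| ≤ 4 := by
  rw [abs_le]
  revert d
  cases hw with
  | tip | tipW | tipS => decide
  | topCorner a | topCornerD a | topCornerW a | topCornerWD a
  | rightCorner a | rightCornerA a | rightCornerS a | rightCornerSA a =>
    rcases a with _ | a <;> simp [next, height] <;> omega
  | diag a b | diagA a b | diagD a b =>
    rcases a with _ | a <;> rcases b with _ | b <;> simp [next, height] <;> omega
  | top l d | topE l d | topW l d | right l d | rightN l d | rightS l d =>
    rcases d with _ | d <;> simp [next, height] <;> omega

set_option maxHeartbeats 2000000 in
theorem abs_corr_next_sub_le {w : WS} (hw : Good w) {d : Dir} (hd : d ∈ w.F) :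
    |corr (w.next d) - corr w| ≤ 60 := by
  rw [abs_le]
  revert d
  cases hw with
  | tip | tipW | tipS => decide
  | topCorner a | topCornerD a | topCornerW a | topCornerWD a
  | rightCorner a | rightCornerA a | rightCornerS a | rightCornerSA a =>
    rcases a with _ | a <;> simp [next, corr] <;> omega
  | diag a b | diagA a b | diagD a b =>
    rcases a with _ | a <;> rcases b with _ | b <;> simp [next, corr] <;> omega
  | top l d | topE l d | topW l d | right l d | rightN l d | rightS l d =>
    rcases d with _ | d <;> simp [next, corr] <;> omega

theorem corr_nonneg {w : WS} (hw : Good w) : 0 ≤ corr w := by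
  cases hw with
  | tip | tipW | tipS => simp [corr]
  | _ => simp [corr] <;> omega

theorem corr_le {w : WS} (hw : Good w) : |corr w| ≤ 30 * (w.dA + w.dB + 1) := by
  rw [abs_le]
  cases hw with
  | tip | tipW | tipS => simp [corr]
  | _ => simp [corr] <;> omega

theorem le_corr_of_diag {w : WS} (hw : Good w) (h : w.dA ≠ 0 ∧ w.dB ≠ 0) :
    (w.dA + w.dB : ℤ) ≤ corr w := by
  cases hw with
  | diag a b | diagA a b | diagD a b => simp [corr] <;> omega
  | _ => simp at h

theorem le_abs_height {w : WS} (hw : Good w) (h : w.dA = 0 ∨ w.dB = 0) :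
    (w.dA + w.dB : ℤ) ≤ |height w| := by
  rw [le_abs]
  cases hw with
  | tip | tipW | tipS => simp [height]
  | diag a b | diagA a b | diagD a b => simp at h
  | _ => simp [height] <;> omega

theorem dC_le {w : WS} (hw : Good w) : w.dC ≤ w.dA + w.dB := by
  cases hw <;> simp <;> omega

theorem E_or_N_mem {w : WS} (hw : Good w) : E ∈ w.F ∨ N ∈ w.F := by
  cases hw <;> simp

theorem card_pos {w : WS} (hw : Good w) : 0 < w.F.card := by
  obtain h | h := E_or_N_mem hw <;> exact Finset.card_pos.2 ⟨_, h⟩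

theorem card_le (w : WS) : w.F.card ≤ 6 := by
  exact (Finset.card_le_univ w.F).trans (by decide)

/-- The length of a path to the state `fresh`. -/
def rank (w : WS) : ℕ :=
  w.dA + w.dB + (if w.dA = 0 ∧ w.dB = 0 ∧ (W ∈ w.F ∨ S ∈ w.F) then 2 else 0) +
    (if E ∈ w.F ∧ N ∈ w.F then 0 else 1)

theorem rank_le (w : WS) : w.rank ≤ w.dA + w.dB + 3 := by
  unfold rank; split_ifs <;> omega

set_option maxHeartbeats 2000000 in
-- The walker heads straight for the corner: E decreases the distance on the top side, N on the
-- right side. At the tip with W or S still prudent, a detour A, E or D, N is needed, which accounts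
-- for the summand 2 of `rank`; a missing E or N costs one preliminary step.
theorem exists_rank_next_lt {w : WS} (hw : Good w) (h : w ≠ fresh) :
    ∃ d ∈ w.F, rank (w.next d) < rank w := by
  cases hw with
  | tip => exact absurd rfl h
  | tipW => exact ⟨A, by decide, by decide⟩
  | tipS => exact ⟨D, by decide, by decide⟩
  | topCorner a | topCornerD a | topCornerW a | topCornerWD a =>
    refine ⟨E, by simp, ?_⟩
    rcases a with _ | a
    · decide
    · simp [next, rank] 
  | rightCorner a | rightCornerA a | rightCornerS a | rightCornerSA a =>
    refine ⟨N, by simp, ?_⟩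
    rcases a with _ | a
    · decide
    · simp [next, rank]
  | diag a b | diagA a b | diagD a b =>
    refine ⟨E, by simp, ?_⟩
    simp [next, rank]
  | top l d | topE l d =>
    refine ⟨E, by simp, ?_⟩
    rcases d with _ | d <;> simp [next, rank]
  | topW l d =>
    refine ⟨N, by simp, ?_⟩
    rcases d with _ | d <;> simp [next, rank]
  | right l d | rightN l d =>
    refine ⟨N, by simp, ?_⟩
    rcases d with _ | d <;> simp [next, rank]
  | rightS l d =>
    refine ⟨E, by simp, ?_⟩
    rcases d with _ | d <;> simp [next, rank]

theorem height_fresh : height fresh = 0 := by decide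

theorem rank_pos {w : WS} (hw : Good w) (h : w ≠ fresh) : 0 < rank w :=
  let ⟨_, _, h'⟩ := exists_rank_next_lt hw h
  Nat.zero_lt_of_lt h'

/-- The reflection which exchanges `e₁` and `e₂`. -/
def _root_.TriPrudent.Dir.swap : Dir → Dir
  | E => N | N => E | W => S | S => W | D => A | A => D

@[simp] theorem swap_swap_dir (d : Dir) : d.swap.swap = d := by cases d <;> rfl

/-- `Dir.swap` as an equivalence. -/
def swapEquiv : Dir ≃ Dir := ⟨Dir.swap, Dir.swap, swap_swap_dir, swap_swap_dir⟩

/-- The reflected state. -/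
def swap (w : WS) : WS := ⟨w.dB, w.dA, w.dC, w.F.map swapEquiv.toEmbedding⟩

theorem mem_swap {w : WS} {d : Dir} : d ∈ w.swap.F ↔ d.swap ∈ w.F := by
  simp only [swap, Finset.mem_map_equiv]; rfl

theorem swap_next (w : WS) (d : Dir) : (w.next d).swap = w.swap.next d.swap := by
  cases d <;> simp only [next, swap, Dir.swap, Finset.map_union, WS.mk.injEq, true_and, and_true,
    Finset.map_insert, Finset.map_singleton, apply_ite (Finset.map _), Finset.map_empty] <;>
    (ext x; cases x <;> simp [swapEquiv, Dir.swap] <;> tauto)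

theorem Good.swap {w : WS} (hw : Good w) : Good w.swap := by
  cases hw with
  | tip | tipW | tipS => exact .of_tip (by decide)
  | topCorner a | topCornerD a | topCornerW a | topCornerWD a =>
    exact .of_rightCorner (by simp) (by simp only; decide)
  | rightCorner b | rightCornerA b | rightCornerS b | rightCornerSA b =>
    exact .of_topCorner (by simp) (by simp only; decide)
  | diag a b | diagA a b | diagD a b =>
    exact .of_diag (by simp) (by simp) (by simp only; decide)
  | top l d | topE l d => exact .of_right (by simp) (by simp only; omega) (by simp only; decide)
  | topW l d => exact .of_rightS (by simp) (by simp only; omega) (by simp only; decide)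
  | right l d | rightN l d => exact .of_top (by simp) (by simp only; omega) (by simp only; decide)
  | rightS l d => exact .of_topW (by simp) (by simp only; omega) (by simp only; decide)

end WS
end TriPrudent

/-! ### Second-order expansion of the power 2/7 -/

namespace TriPrudent

/-- Taylor expansion of exp((2/7) log(1 + x)) with a cubic remainder; -5/49 is (2/7)(2/7 - 1)/2. -/
theorem one_add_rpow_le {x : ℝ} (hx : |x| ≤ 1 / 4) :
    (1 + x) ^ (2 / 7 : ℝ) ≤ 1 + 2 / 7 * x - 5 / 49 * x ^ 2 + |x| ^ 3 := by
  have hx' := abs_le.1 hx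
  have hlog : Real.log (1 + x) ≤ x - x ^ 2 / 2 + 4 / 3 * |x| ^ 3 := by
    have h := Real.abs_log_sub_add_sum_range_le (x := -x) (by rw [abs_neg]; linarith) 2
    rw [abs_neg, sub_neg_eq_add] at h
    have h2 := (abs_le.1 h).2
    simp [Finset.sum_range_succ] at h2
    have h3 : |x| ^ 3 / (1 - |x|) ≤ 4 / 3 * |x| ^ 3 := by
      rw [div_le_iff₀ (by linarith)]
      nlinarith [pow_nonneg (abs_nonneg x) 3]
    norm_num at h2
    linarith
  have hlog0 : |Real.log (1 + x)| ≤ 4 / 3 * |x| := by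
    have h := Real.abs_log_sub_add_sum_range_le (x := -x) (by rw [abs_neg]; linarith) 0
    rw [abs_neg, sub_neg_eq_add] at h
    simp at h
    refine h.trans ?_
    rw [div_le_iff₀ (by linarith)]
    nlinarith [abs_nonneg x]
  set y := 2 / 7 * Real.log (1 + x) with hy
  have hpos : 0 < 1 + x := by linarith
  have e : (1 + x) ^ (2 / 7 : ℝ) = Real.exp y := by
    rw [Real.rpow_def_of_pos hpos, hy, mul_comm]
  have hyabs : |y| ≤ 8 / 21 * |x| := by
    rw [hy, abs_mul, abs_of_pos (by norm_num : (0 : ℝ) < 2 / 7)]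
    linarith
  have hexp := Real.exp_bound (x := y) (by linarith) (n := 3) (by norm_num)
  have h2 := (abs_le.1 hexp).2
  simp [Finset.sum_range_succ, Nat.factorial] at h2
  norm_num at h2
  have hy3 : |y| ^ 3 ≤ (8 / 21 * |x|) ^ 3 := by gcongr
  have hyle : y ≤ 2 / 7 * (x - x ^ 2 / 2 + 4 / 3 * |x| ^ 3) := by rw [hy]; gcongr
  have hysq : y ^ 2 ≤ 4 / 49 * x ^ 2 + 1 / 2 * |x| ^ 3 := by
    have hlow : |y - 2 / 7 * x| ≤ 8 / 21 * x ^ 2 := by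
      have h := Real.abs_log_sub_add_sum_range_le (x := -x) (by rw [abs_neg]; linarith) 1
      rw [abs_neg, sub_neg_eq_add] at h
      simp at h
      have h5 : |x| ^ 2 / (1 - |x|) ≤ 4 / 3 * x ^ 2 := by
        rw [div_le_iff₀ (by linarith), sq_abs]
        nlinarith [sq_nonneg x]
      rw [hy, ← mul_sub, abs_mul, abs_of_pos (by norm_num : (0 : ℝ) < 2 / 7)]
      rw [sq_abs] at h5
      have : |Real.log (1 + x) - x| = |-x + Real.log (1 + x)| := by congr 1; ring
      rw [this]
      linarith
    have : y ^ 2 - 4 / 49 * x ^ 2 = (y - 2 / 7 * x) * (y + 2 / 7 * x) := by ring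
    have h6 : (y - 2 / 7 * x) * (y + 2 / 7 * x) ≤ 8 / 21 * x ^ 2 * (2 / 3 * |x|) := by
      refine (le_abs_self _).trans ?_
      rw [abs_mul]
      gcongr
      have h7 : |2 / 7 * x| = 2 / 7 * |x| := by
        rw [abs_mul, abs_of_pos (by norm_num : (0 : ℝ) < 2 / 7)]
      have h8 := abs_add_le y (2 / 7 * x)
      linarith
    have : 8 / 21 * x ^ 2 * (2 / 3 * |x|) = 16 / 63 * |x| ^ 3 := by rw [← sq_abs]; ring
    nlinarith [pow_nonneg (abs_nonneg x) 3]
  rw [e]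
  nlinarith [pow_nonneg (abs_nonneg x) 3]


/-- The number c is any upper bound for the second-order term -5 δ²/s², and 1/10 pays for the cubic
remainder. -/
theorem rpow_add_le {s δ c : ℝ} (hs : 10 ^ 7 ≤ s)
    (hδ : |δ| ≤ 17 * s) (hc : -5 * δ ^ 2 ≤ c * s ^ 2) :
    (s ^ 2 + δ) ^ (2 / 7 : ℝ) ≤
      (s ^ 2) ^ (2 / 7 : ℝ) * (1 + (14 * δ + c + 1 / 10) / (49 * s ^ 2)) := by
  have hs0 : 0 < s := by linarith
  have hx : |δ / s ^ 2| ≤ 17 / s := by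
    rw [abs_div, abs_of_pos (by positivity : 0 < s ^ 2), div_le_div_iff₀ (by positivity) hs0]
    nlinarith
  have hx4 : |δ / s ^ 2| ≤ 1 / 4 := hx.trans (by rw [div_le_div_iff₀ hs0 (by norm_num)]; linarith)
  have e : s ^ 2 + δ = s ^ 2 * (1 + δ / s ^ 2) := by field_simp
  rw [e, Real.mul_rpow (by positivity) (by linarith [(abs_le.1 hx4).1])]
  refine mul_le_mul_of_nonneg_left ((one_add_rpow_le hx4).trans ?_) (by positivity)
  -- Here 4913 = 17³ and 1/490 = (1/10)/49; the size of s absorbs the cube.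
  have h3 : |δ / s ^ 2| ^ 3 ≤ (1 / 490) / s ^ 2 := by
    calc |δ / s ^ 2| ^ 3 ≤ (17 / s) ^ 3 := by gcongr
      _ = (4913 / s) / s ^ 2 := by field_simp; norm_num
      _ ≤ _ := by
        refine div_le_div_of_nonneg_right ?_ (by positivity)
        rw [div_le_iff₀ hs0]
        linarith
  have h2 : -(5 / 49) * (δ / s ^ 2) ^ 2 ≤ c / (49 * s ^ 2) := by
    rw [div_pow, ← mul_div_assoc, div_le_div_iff₀ (by positivity) (by positivity)]
    nlinarith [mul_le_mul_of_nonneg_left hc (by positivity : 0 ≤ s ^ 2)]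
  have h1 : (14 * δ + c + 1 / 10) / (49 * s ^ 2) =
      2 / 7 * (δ / s ^ 2) + c / (49 * s ^ 2) + (1 / 490) / s ^ 2 := by
    field_simp
    ring
  rw [h1]
  linarith

/-- The first-order term 4 M m sums to zero, so the sign is that of the second-order terms. Either
M² dominates and the concavity contributes -40 m², or only the size of Z is known and the concavity
is discarded. The two alternatives match `near_ineq` and `far_ineq`. -/
theorem sum_rpow_le {ι : Type*} (F : Finset ι) {m z : ι → ℝ} {M Z : ℝ}
    (hm : ∀ i ∈ F, |m i| ≤ 4) (hz : ∀ i ∈ F, |z i| ≤ 60) (hm0 : ∑ i ∈ F, m i = 0) (hZ : 0 ≤ Z)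
    (h : (7 * ∑ i ∈ F, z i + 2 * F.card ≤ 6 * ∑ i ∈ F, m i ^ 2 ∧ Z ≤ 60 * |M| ∧ 10 ^ 14 ≤ |M|) ∨
      (7 * ∑ i ∈ F, z i + 2 * F.card ≤ -14 * ∑ i ∈ F, m i ^ 2 ∧ 10 ^ 14 ≤ Z)) :
    ∑ i ∈ F, (2 * (M + m i) ^ 2 + (Z + z i) + 1) ^ (2 / 7 : ℝ) ≤
      F.card * (2 * M ^ 2 + Z + 1) ^ (2 / 7 : ℝ) := by
  set s := √(2 * M ^ 2 + Z + 1) with hs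
  have hY : s ^ 2 = 2 * M ^ 2 + Z + 1 := Real.sq_sqrt (by positivity)
  have hs0 : 0 ≤ s := Real.sqrt_nonneg _
  have hMs : |M| ≤ s := by
    rw [← sq_le_sq₀ (abs_nonneg M) hs0, sq_abs, hY]; nlinarith [sq_nonneg M]
  have hs7 : 10 ^ 7 ≤ s := by
    rcases h with ⟨-, -, h⟩ | ⟨-, h⟩
    · linarith
    · rw [← sq_le_sq₀ (by norm_num) hs0, hY]; nlinarith [sq_nonneg M]
  -- The term 4 M m is at most 16 s, and 2 m² + z is at most 32 + 60 ≤ s.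
  have hδ : ∀ i ∈ F, |4 * M * m i + 2 * m i ^ 2 + z i| ≤ 17 * s := by
    intro i hi
    have h1 : |4 * M * m i| ≤ 16 * s := by
      rw [abs_mul, abs_mul, abs_of_pos (by norm_num : (0 : ℝ) < 4)]
      nlinarith [hm i hi, abs_nonneg (m i), abs_nonneg M]
    have h2 : |2 * m i ^ 2| ≤ 32 := by
      rw [abs_of_nonneg (by positivity), ← sq_abs]
      nlinarith [hm i hi, abs_nonneg (m i)]
    have h3 := abs_add_le (4 * M * m i + 2 * m i ^ 2) (z i)
    have h4 := abs_add_le (4 * M * m i) (2 * m i ^ 2)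
    linarith [hz i hi]
  have key : ∃ c : ι → ℝ, (∀ i ∈ F, -5 * (4 * M * m i + 2 * m i ^ 2 + z i) ^ 2 ≤ c i * s ^ 2) ∧
      ∑ i ∈ F, (14 * (4 * M * m i + 2 * m i ^ 2 + z i) + c i + 1 / 10) ≤ 0 := by
    have hcard : (0 : ℝ) ≤ F.card := by positivity
    rcases h with ⟨h, hZM, hM⟩ | ⟨h, hZR⟩
    -- Since δ² is about 16 M² m² and s² about 2 M², the term -5 δ²/s² is about -40 m². The summand
    -- 1 covers the mixed terms and Z, both of order |M| against M² ≥ 10^14 |M|.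
    · refine ⟨fun i => -40 * m i ^ 2 + 1, fun i hi => ?_, ?_⟩
      · have hmi : m i ^ 2 ≤ 16 := by rw [← sq_abs]; nlinarith [hm i hi, abs_nonneg (m i)]
        have h1 : |4 * M * m i * (2 * m i ^ 2 + z i)| ≤ 1472 * |M| := by
          rw [abs_mul, abs_mul, abs_mul, abs_of_pos (by norm_num : (0 : ℝ) < 4)]
          have : |2 * m i ^ 2 + z i| ≤ 92 := by
            have h3 := abs_add_le (2 * m i ^ 2) (z i)
            rw [abs_of_nonneg (by positivity : 0 ≤ 2 * m i ^ 2)] at h3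
            linarith [hz i hi]
          calc 4 * |M| * |m i| * |2 * m i ^ 2 + z i| ≤ 4 * |M| * 4 * 92 := by
                gcongr
                exact hm i hi
            _ = _ := by ring
        have h2 := (abs_le.1 h1).1
        have h3 : m i ^ 2 * (Z + 1) ≤ 16 * (60 * |M| + 1) := by
          apply mul_le_mul hmi (by linarith) (by linarith) (by norm_num)
        have h4 : 10 ^ 14 * |M| ≤ M ^ 2 := by
          rw [← sq_abs]; nlinarith [abs_nonneg M]
        rw [hY]
        nlinarith [sq_nonneg (2 * m i ^ 2 + z i)]
      · simp only [Finset.sum_add_distrib, ← Finset.mul_sum, Finset.sum_const, nsmul_eq_mul, hm0]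
        linarith
    · refine ⟨fun i => 0, fun i hi => ?_, ?_⟩
      · nlinarith [sq_nonneg (4 * M * m i + 2 * m i ^ 2 + z i)]
      · simp only [Finset.sum_add_distrib, ← Finset.mul_sum, Finset.sum_const, nsmul_eq_mul, hm0]
        linarith
  obtain ⟨c, hc, hsum⟩ := key
  calc ∑ i ∈ F, (2 * (M + m i) ^ 2 + (Z + z i) + 1) ^ (2 / 7 : ℝ)
      = ∑ i ∈ F, (s ^ 2 + (4 * M * m i + 2 * m i ^ 2 + z i)) ^ (2 / 7 : ℝ) := by
        refine Finset.sum_congr rfl fun i _ => ?_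
        rw [hY]; congr 1; ring
    _ ≤ ∑ i ∈ F, (s ^ 2) ^ (2 / 7 : ℝ) *
          (1 + (14 * (4 * M * m i + 2 * m i ^ 2 + z i) + c i + 1 / 10) / (49 * s ^ 2)) :=
        Finset.sum_le_sum fun i hi => rpow_add_le hs7 (hδ i hi) (hc i hi)
    _ = (s ^ 2) ^ (2 / 7 : ℝ) * (F.card +
          (∑ i ∈ F, (14 * (4 * M * m i + 2 * m i ^ 2 + z i) + c i + 1 / 10)) / (49 * s ^ 2)) := by
        rw [← Finset.mul_sum, Finset.sum_add_distrib, Finset.sum_div]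
        simp
    _ ≤ (s ^ 2) ^ (2 / 7 : ℝ) * F.card := by
        refine mul_le_mul_of_nonneg_left ?_ (by positivity)
        have := div_nonpos_of_nonpos_of_nonneg hsum (by positivity : 0 ≤ 49 * s ^ 2)
        linarith
    _ = _ := by rw [hY, mul_comm]

end TriPrudent

/-! ### The Lyapunov function -/

namespace TriPrudent
namespace WS
open Dir

/-- The average over the prudent directions. -/
noncomputable def avg (w : WS) (f : Dir → ℝ) : ℝ := (∑ d ∈ w.F, f d) / w.F.card

theorem card_pos' {w : WS} (hw : Good w) : (0 : ℝ) < w.F.card := by exact_mod_cast card_pos hw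

theorem avg_mono {w : WS} {f g : Dir → ℝ} (h : ∀ d ∈ w.F, f d ≤ g d) : avg w f ≤ avg w g :=
  div_le_div_of_nonneg_right (Finset.sum_le_sum h) (by positivity)

theorem avg_congr {w : WS} {f g : Dir → ℝ} (h : ∀ d ∈ w.F, f d = g d) : avg w f = avg w g := by
  unfold avg; rw [Finset.sum_congr rfl h]

theorem avg_const {w : WS} (hw : Good w) (c : ℝ) : avg w (fun _ => c) = c := by
  have := card_pos' hw
  simp [avg]
  field_simp

theorem avg_add (w : WS) (f g : Dir → ℝ) :
    avg w (fun d => f d + g d) = avg w f + avg w g := by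
  simp [avg, Finset.sum_add_distrib, add_div]

theorem avg_sub (w : WS) (f g : Dir → ℝ) :
    avg w (fun d => f d - g d) = avg w f - avg w g := by
  simp [avg, Finset.sum_sub_distrib, sub_div]

theorem avg_const_mul (w : WS) (c : ℝ) (f : Dir → ℝ) :
    avg w (fun d => c * f d) = c * avg w f := by
  simp [avg, ← Finset.mul_sum, mul_div_assoc]

theorem avg_div (w : WS) (c : ℝ) (f : Dir → ℝ) :
    avg w (fun d => f d / c) = avg w f / c := by
  simp [avg, ← Finset.sum_div, div_right_comm]

theorem avg_nonneg {w : WS} {f : Dir → ℝ} (h : ∀ d ∈ w.F, 0 ≤ f d) : 0 ≤ avg w f :=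
  div_nonneg (Finset.sum_nonneg h) (by positivity)

theorem avg_le_const {w : WS} (hw : Good w) {f : Dir → ℝ} {c : ℝ} (h : ∀ d ∈ w.F, f d ≤ c) :
    avg w f ≤ c := (avg_mono h).trans_eq (avg_const hw c)

theorem avg_height {w : WS} (hw : Good w) :
    avg w (fun d => (height (w.next d) : ℝ)) = height w := by
  have h := sum_height_next hw
  have h0 := card_pos' hw
  rw [Finset.sum_sub_distrib, Finset.sum_const, nsmul_eq_mul, sub_eq_zero] at h
  rw [avg, div_eq_iff h0.ne', mul_comm]
  exact_mod_cast h

/-- A function of the state that grows at infinity and is superharmonic there. -/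
noncomputable def lyap (w : WS) : ℝ := (2 * (height w : ℝ) ^ 2 + corr w + 1) ^ (2 / 7 : ℝ)

theorem lyap_nonneg {w : WS} (hw : Good w) : 0 ≤ lyap w := by
  have : (0 : ℝ) ≤ corr w := by exact_mod_cast corr_nonneg hw
  unfold lyap; positivity

/-- On the top and right sides |`height`| is at least the distance from the corner, and in the
interior of the diagonal side `corr` is. So a large distance always puts the state in one of the two
alternatives of `sum_rpow_le`. -/
theorem avg_lyap_le {w : WS} (hw : Good w) (hR : 10 ^ 14 ≤ w.dA + w.dB) :
    avg w (fun d => lyap (w.next d)) ≤ lyap w := by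
  rw [avg, div_le_iff₀ (card_pos' hw), mul_comm]
  have key := sum_rpow_le w.F (m := fun d => ((height (w.next d) - height w : ℤ) : ℝ))
    (z := fun d => ((corr (w.next d) - corr w : ℤ) : ℝ)) (M := height w) (Z := corr w)
    (fun d hd => by exact_mod_cast abs_height_next_sub_le hw hd)
    (fun d hd => by exact_mod_cast abs_corr_next_sub_le hw hd)
    (by exact_mod_cast sum_height_next hw) (by exact_mod_cast corr_nonneg hw) (by
      by_cases h : w.dA = 0 ∨ w.dB = 0
      · left
        refine ⟨by exact_mod_cast near_ineq hw (by omega) h, ?_, ?_⟩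
        · have h1 := (le_abs_self _).trans (corr_le hw)
          have h2 := le_abs_height hw h
          have : corr w ≤ 60 * |height w| := by omega
          exact_mod_cast this
        · have h2 := le_abs_height hw h
          have : (10 : ℤ) ^ 14 ≤ |height w| := by omega
          exact_mod_cast this
      · right
        push Not at h
        refine ⟨by exact_mod_cast far_ineq hw (by omega) h, ?_⟩
        have h2 := le_corr_of_diag hw h
        have : (10 : ℤ) ^ 14 ≤ corr w := by omega
        exact_mod_cast this)
  refine le_trans (le_of_eq ?_) key
  refine Finset.sum_congr rfl fun d _ => ?_
  unfold lyap
  push_cast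
  congr 1
  ring

theorem abs_height_le {w : WS} (hw : Good w) : |height w| ≤ 3 * (w.dA + w.dB + 1) := by
  rw [abs_le]
  cases hw with
  | tip | tipW | tipS => simp [height]
  | _ => simp [height] <;> omega

theorem exists_lyap_next_le (R : ℕ) :
    ∃ C : ℝ, 0 ≤ C ∧ ∀ w, Good w → w.dA + w.dB ≤ R → ∀ d ∈ w.F, lyap (w.next d) ≤ C := by
  refine ⟨(2 * (3 * (R + 1) + 4) ^ 2 + (30 * (R + 1) + 60) + 1) ^ (2 / 7 : ℝ), by positivity,
    fun w hw hR d hd => ?_⟩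
  have h1 : |height (w.next d)| ≤ 3 * (R + 1) + 4 := by
    have h1 := abs_height_next_sub_le hw hd
    have h2 := abs_height_le hw
    have h3 := abs_sub_abs_le_abs_sub (height (w.next d)) (height w)
    omega
  have h2 : corr (w.next d) ≤ 30 * (R + 1) + 60 := by
    have h1 := (le_abs_self _).trans (abs_corr_next_sub_le hw hd)
    have h2 := (le_abs_self _).trans (corr_le hw)
    omega
  have h1' : |(height (w.next d) : ℝ)| ≤ 3 * (R + 1) + 4 := by exact_mod_cast h1
  have h2' : (corr (w.next d) : ℝ) ≤ 30 * (R + 1) + 60 := by exact_mod_cast h2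
  have h3 : (0 : ℝ) ≤ corr (w.next d) := by exact_mod_cast corr_nonneg (hw.next hd)
  unfold lyap
  refine Real.rpow_le_rpow (by positivity) ?_ (by norm_num)
  have : (height (w.next d) : ℝ) ^ 2 ≤ (3 * (R + 1) + 4) ^ 2 := by
    rw [← sq_abs]; gcongr
  linarith

/-- A bounded function of the distance to the state `fresh` which is strictly superharmonic. -/
noncomputable def psi (w : WS) : ℝ := 1 - (1 / 12) ^ rank w

theorem psi_nonneg (w : WS) : 0 ≤ psi w :=
  sub_nonneg.2 (pow_le_one₀ (by norm_num) (by norm_num))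

theorem psi_le_one (w : WS) : psi w ≤ 1 := sub_le_self _ (by positivity)

theorem half_le_psi {w : WS} (hw : Good w) (h : w ≠ fresh) : 1 / 2 ≤ psi w := by
  have h1 := rank_pos hw h
  have : (1 / 12 : ℝ) ^ rank w ≤ (1 / 12) ^ 1 :=
    pow_le_pow_of_le_one (by norm_num) (by norm_num) h1
  unfold psi
  linarith

/-- With ρ = (1/12)^`rank`, the direction that lowers the rank has `psi` at most 1 - 12 ρ, and the
others at most 1. Averaged over at most six directions this is at most 1 - 2 ρ, which is `psi` minus
ρ. -/
theorem avg_psi_le {w : WS} (hw : Good w) (h : w ≠ fresh) :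
    avg w (fun d => psi (w.next d)) ≤ psi w - (1 / 12) ^ rank w := by
  obtain ⟨d₀, hd₀, hr⟩ := exists_rank_next_lt hw h
  have hc := card_pos' hw
  have hc6 : (w.F.card : ℝ) ≤ 6 := by exact_mod_cast card_le w
  rw [avg, div_le_iff₀ hc, ← Finset.sum_erase_add _ _ hd₀]
  have h1 : ∑ d ∈ w.F.erase d₀, psi (w.next d) ≤ (w.F.card : ℝ) - 1 := by
    refine (Finset.sum_le_sum fun d _ => psi_le_one (w.next d)).trans ?_
    rw [Finset.sum_const, nsmul_eq_mul, mul_one, Finset.card_erase_of_mem hd₀,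
      Nat.cast_sub (card_pos hw)]
    simp
  have h2 : psi (w.next d₀) ≤ 1 - 12 * (1 / 12) ^ rank w := by
    obtain ⟨k, hk⟩ := Nat.exists_eq_add_of_lt hr
    have : (1 / 12 : ℝ) ^ (rank w) ≤ (1 / 12) ^ (rank (w.next d₀) + 1) :=
      pow_le_pow_of_le_one (by norm_num) (by norm_num) hr
    rw [pow_succ] at this
    unfold psi
    linarith
  have h3 : (0 : ℝ) < (1 / 12) ^ rank w := by positivity
  unfold psi at h2 ⊢
  unfold psi at h1
  nlinarith

/-- Far from the corner both summands are superharmonic. The rank is bounded on the remaining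
states, where the drift of `psi` is uniformly negative and a large K outweighs any increase of
`lyap`. -/
theorem exists_superharmonic :
    ∃ K : ℝ, 0 ≤ K ∧ ∀ w, Good w → w ≠ fresh →
      avg w (fun d => lyap (w.next d) + K * psi (w.next d)) ≤ lyap w + K * psi w := by
  obtain ⟨R, hR⟩ : ∃ R : ℕ, R = 10 ^ 14 := ⟨_, rfl⟩
  obtain ⟨C, hC, hCR⟩ := exists_lyap_next_le R
  refine ⟨C * 12 ^ (R + 3), by positivity, fun w hw hf => ?_⟩
  rw [avg_add, avg_const_mul]
  have hψ := avg_psi_le hw hf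
  have hK : 0 ≤ C * 12 ^ (R + 3) := by positivity
  rcases le_total R (w.dA + w.dB) with h | h
  · have h1 := avg_lyap_le hw (hR ▸ h)
    have h2 : avg w (fun d => psi (w.next d)) ≤ psi w :=
      hψ.trans (sub_le_self _ (by positivity))
    gcongr
  · have h1 := avg_le_const hw (hCR w hw h)
    have h2 : C ≤ C * 12 ^ (R + 3) * (1 / 12) ^ rank w := by
      have : (1 / 12 : ℝ) ^ (R + 3) ≤ (1 / 12) ^ rank w :=
        pow_le_pow_of_le_one (by norm_num) (by norm_num) ((rank_le w).trans (by omega))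
      calc C = C * 12 ^ (R + 3) * (1 / 12) ^ (R + 3) := by
            rw [mul_assoc, ← mul_pow]; norm_num
        _ ≤ _ := by gcongr
    have h3 := mul_le_mul_of_nonneg_left hψ hK
    have h4 := lyap_nonneg hw
    linarith

end WS
end TriPrudent

/-! ### Recurrence of the corner state -/

namespace TriPrudent
namespace WS
open Dir

theorem good_fresh : Good fresh := .tip

/-- The probability that the state `fresh` is not visited up to time `n`. -/
noncomputable def notHit : ℕ → WS → ℝ
  | 0, w => if w = fresh then 0 else 1
  | n + 1, w => if w = fresh then 0 else avg w fun d => notHit n (w.next d)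

theorem notHit_nonneg (n : ℕ) (w : WS) : 0 ≤ notHit n w := by
  induction n generalizing w with
  | zero => unfold notHit; split_ifs <;> norm_num
  | succ n ih => unfold notHit; split_ifs; exacts [le_rfl, avg_nonneg fun d _ => ih _]

theorem notHit_le_one (n : ℕ) {w : WS} (hw : Good w) : notHit n w ≤ 1 := by
  induction n generalizing w with
  | zero => unfold notHit; split_ifs <;> norm_num
  | succ n ih =>
    unfold notHit; split_ifs
    exacts [zero_le_one, avg_le_const hw fun d hd => ih (hw.next hd)]

theorem notHit_fresh (n : ℕ) : notHit n fresh = 0 := by cases n <;> simp [notHit]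

theorem rpow_le_lyap {w : WS} (hw : Good w) : ((w.dA + w.dB : ℕ) : ℝ) ^ (2 / 7 : ℝ) ≤ lyap w := by
  unfold lyap
  refine Real.rpow_le_rpow (by positivity) ?_ (by norm_num)
  have h : (w.dA + w.dB : ℤ) ≤ 2 * height w ^ 2 + corr w + 1 := by
    by_cases h : w.dA = 0 ∨ w.dB = 0
    · have h1 := le_abs_height hw h
      have h2 := corr_nonneg hw
      have h3 : |height w| ≤ height w ^ 2 := by
        rw [← sq_abs]
        rcases (abs_nonneg (height w)).eq_or_lt with h | h
        · rw [← h]; norm_num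
        · nlinarith
      push_cast at h1 ⊢
      nlinarith [sq_nonneg (height w)]
    · push Not at h
      have h1 := le_corr_of_diag hw h
      nlinarith [sq_nonneg (height w)]
  exact_mod_cast h

/-- A level m of the Lyapunov function is reached before `fresh` with probability at most Φ/m. Below
that level the rank is bounded, so `psi` contracts by a fixed factor at each step. First m is taken
large, then n. -/
theorem tendsto_notHit {w : WS} (hw : Good w) :
    Tendsto (fun n => notHit n w) atTop (𝓝 0) := by
  obtain ⟨K, hK, hsup⟩ := exists_superharmonic
  set Φ : WS → ℝ := fun w => lyap w + K * psi w with hΦ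
  have hΦ0 : ∀ {w}, Good w → 0 ≤ Φ w := fun hw =>
    add_nonneg (lyap_nonneg hw) (mul_nonneg hK (psi_nonneg _))
  have key : ∀ m : ℝ, 0 < m → ∃ c : ℝ, 0 < c ∧ c ≤ 1 ∧ ∀ (n : ℕ) (w : WS), Good w →
      notHit n w ≤ Φ w / m + 2 * (1 - c) ^ n * psi w := by
    intro m hm
    -- By `rpow_le_lyap`, the inequality Φ < m forces the distance from the corner below m^(7/2),
    -- hence the rank to at most R + 3.
    obtain ⟨R, hR⟩ := exists_nat_ge (m ^ (7 / 2 : ℝ))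
    refine ⟨(1 / 12) ^ (R + 3), by positivity, pow_le_one₀ (by norm_num) (by norm_num), ?_⟩
    set c : ℝ := (1 / 12) ^ (R + 3) with hc
    have hc0 : 0 < c := by positivity
    have hc1 : c ≤ 1 := pow_le_one₀ (by norm_num) (by norm_num)
    intro n
    induction n with
    | zero =>
      intro w hw
      have h1 := div_nonneg (hΦ0 hw) hm.le
      have h2 := psi_nonneg w
      unfold notHit
      split_ifs with h
      · simp only [pow_zero]; linarith
      · have := half_le_psi hw h
        simp only [pow_zero]; linarith
    | succ n ih =>
      intro w hw
      have h0 : 0 ≤ 2 * (1 - c) ^ n := mul_nonneg zero_le_two (pow_nonneg (by linarith) _)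
      by_cases hf : w = fresh
      · rw [hf, notHit_fresh, ← hf]
        have h2 := psi_nonneg w
        have : 0 ≤ (1 - c) ^ (n + 1) := pow_nonneg (by linarith) _
        have := div_nonneg (hΦ0 hw) hm.le
        positivity
      -- Above the level m the first summand is already at least 1.
      rcases le_or_gt m (Φ w) with h | h
      · refine (notHit_le_one _ hw).trans ?_
        have h1 : 1 ≤ Φ w / m := (one_le_div hm).2 h
        have h2 := psi_nonneg w
        have : 0 ≤ (1 - c) ^ (n + 1) := pow_nonneg (by linarith) _
        have : 0 ≤ 2 * (1 - c) ^ (n + 1) * psi w := by positivity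
        linarith
      · have hrank : rank w ≤ R + 3 := by
          refine (rank_le w).trans ?_
          have h1 := rpow_le_lyap hw
          have h2 : lyap w ≤ m := by
            have := mul_nonneg hK (psi_nonneg w)
            simp only [hΦ] at h
            linarith
          have h3 : ((w.dA + w.dB : ℕ) : ℝ) ≤ R := by
            have h4 := Real.rpow_le_rpow (by positivity) (h1.trans h2)
              (by norm_num : (0 : ℝ) ≤ 7 / 2)
            rw [← Real.rpow_mul (by positivity)] at h4
            norm_num at h4 hR ⊢
            exact h4.trans hR
          have h5 : w.dA + w.dB ≤ R := by exact_mod_cast h3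
          omega
        have hpsi : avg w (fun d => psi (w.next d)) ≤ (1 - c) * psi w := by
          have h1 := avg_psi_le hw hf
          have h2 : c ≤ (1 / 12) ^ rank w :=
            pow_le_pow_of_le_one (by norm_num) (by norm_num) hrank
          nlinarith [psi_le_one w]
        have h1 : notHit (n + 1) w = avg w fun d => notHit n (w.next d) := by
          rw [notHit, if_neg hf]
        rw [h1]
        calc avg w (fun d => notHit n (w.next d))
            ≤ avg w fun d => Φ (w.next d) / m + 2 * (1 - c) ^ n * psi (w.next d) :=
              avg_mono fun d hd => ih _ (hw.next hd)
          _ = avg w (fun d => Φ (w.next d)) / m +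
                2 * (1 - c) ^ n * avg w (fun d => psi (w.next d)) := by
              rw [avg_add, avg_div, avg_const_mul]
          _ ≤ Φ w / m + 2 * (1 - c) ^ n * ((1 - c) * psi w) := by
              gcongr
              exact hsup w hw hf
          _ = _ := by ring
  rw [Metric.tendsto_atTop]
  intro ε hε
  -- This level makes the first summand at most ε/2; adding 1 keeps it positive.
  obtain ⟨c, hc0, hc1, hc⟩ := key (2 * (Φ w + 1) / ε) (by have := hΦ0 hw; positivity)
  have hpow : Tendsto (fun n => 2 * (1 - c) ^ n * psi w) atTop (𝓝 0) := by
    have := (tendsto_pow_atTop_nhds_zero_of_lt_one (sub_nonneg.2 hc1)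
      (by linarith : 1 - c < 1)).const_mul 2 |>.mul_const (psi w)
    simpa using this
  obtain ⟨N, hN⟩ := Metric.tendsto_atTop.1 hpow (ε / 2) (by positivity)
  refine ⟨N, fun n hn => ?_⟩
  have h1 := hN n hn
  rw [Real.dist_eq, sub_zero] at h1
  replace h1 := (le_abs_self _).trans_lt h1
  have h2 := hc n w hw
  rw [Real.dist_eq, sub_zero, abs_of_nonneg (notHit_nonneg _ _)]
  have h3 : Φ w / (2 * (Φ w + 1) / ε) ≤ ε / 2 := by
    have := hΦ0 hw
    rw [div_le_iff₀ (by positivity)]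
    field_simp
    linarith
  linarith

/-- Whether the step `d` increases the first coordinate of the hull. -/
def growA (w : WS) (d : Dir) : Prop := w.dA = 0 ∧ (d = E ∨ d = D)

/-- Whether the step `d` increases the second coordinate of the hull. -/
def growB (w : WS) (d : Dir) : Prop := w.dB = 0 ∧ (d = N ∨ d = A)

instance (w : WS) (d : Dir) : Decidable (w.growA d) := inferInstanceAs (Decidable (_ ∧ _))
instance (w : WS) (d : Dir) : Decidable (w.growB d) := inferInstanceAs (Decidable (_ ∧ _))

/-- The increase of the first coordinate of the hull at the step `d`. -/
def incA (w : WS) (d : Dir) : ℕ := if w.growA d then 1 else 0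

/-- The increase of the second coordinate of the hull at the step `d`. -/
def incB (w : WS) (d : Dir) : ℕ := if w.growB d then 1 else 0

theorem growB_swap {w : WS} {d : Dir} : w.swap.growB d ↔ w.growA d.swap := by
  cases d <;> simp [growA, growB, swap, Dir.swap]

theorem avg_swap (w : WS) (f : Dir → ℝ) : avg w.swap f = avg w fun d => f d.swap := by
  simp [avg, swap]; rfl

/-- The probability that the second coordinate of the hull increases by `g` up to time `n` and
not later than the first visit to `fresh`. -/
noncomputable def reach : ℕ → WS → ℕ → ℝ
  | 0, _, g => if g = 0 then 1 else 0
  | n + 1, w, g => if g = 0 then 1 else if w = fresh then 0 else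
      avg w fun d => reach n (w.next d) (g - w.incB d)

@[simp] theorem reach_zero_right (n : ℕ) (w : WS) : reach n w 0 = 1 := by
  cases n <;> simp [reach]

theorem reach_nonneg (n : ℕ) (w : WS) (g : ℕ) : 0 ≤ reach n w g := by
  induction n generalizing w g with
  | zero => unfold reach; split_ifs <;> norm_num
  | succ n ih =>
    unfold reach; split_ifs; exacts [zero_le_one, le_rfl, avg_nonneg fun d _ => ih _ _]

theorem reach_le_one (n : ℕ) {w : WS} (hw : Good w) (g : ℕ) : reach n w g ≤ 1 := by
  induction n generalizing w g with
  | zero => unfold reach; split_ifs <;> norm_num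
  | succ n ih =>
    unfold reach; split_ifs
    exacts [le_rfl, zero_le_one, avg_le_const hw fun d hd => ih (hw.next hd) _]

theorem reach_succ {w : WS} (hw : Good w) (hf : w ≠ fresh) (n g : ℕ) :
    reach (n + 1) w g = avg w fun d => reach n (w.next d) (g - w.incB d) := by
  rcases Nat.eq_zero_or_pos g with rfl | hg
  · simp [avg_const hw]
  · rw [reach, if_neg hg.ne', if_neg hf]

theorem reach_le_succ (n : ℕ) {w : WS} (hw : Good w) (g : ℕ) :
    reach n w g ≤ reach (n + 1) w g := by
  induction n generalizing w g with
  | zero =>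
    rcases Nat.eq_zero_or_pos g with rfl | hg
    · simp
    · rw [reach, if_neg hg.ne']; exact reach_nonneg _ _ _
  | succ n ih =>
    by_cases hf : w = fresh
    · rw [reach, reach, if_pos hf, if_pos hf]
    · rw [reach_succ hw hf, reach_succ hw hf]
      exact avg_mono fun d hd => ih (hw.next hd) _

theorem reach_mono {n n' : ℕ} (h : n ≤ n') {w : WS} (hw : Good w) (g : ℕ) :
    reach n w g ≤ reach n' w g := by
  induction h with
  | refl => exact le_rfl
  | step _ ih => exact ih.trans (reach_le_succ _ hw g)

end WS
end TriPrudent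

/-! ### Growth of the hull between visits to the corner -/

namespace TriPrudent
namespace WS
open Dir

/-- Whether the step `d` increases the maximal coordinate sum of the hull. -/
def growC (w : WS) (d : Dir) : Prop := w.dC = 0 ∧ (d = E ∨ d = N)

instance (w : WS) (d : Dir) : Decidable (w.growC d) := inferInstanceAs (Decidable (_ ∧ _))

/-- The length of the part of the diagonal side of the hull within the other two sides. -/
def len (w : WS) : ℤ := w.dA + w.dB - w.dC

/-- Off the side A that side does not move, so the diagonal side gains length from growth in B and
loses length from growth in C. Since `len` is nonnegative on good states, growth in C must be
matched by growth in B up to the initial length; counting growth steps therefore bounds the growth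
in B from below. -/
theorem len_next {w : WS} (h : w.dA ≠ 0) (d : Dir) :
    len (w.next d) = len w + w.incB d - (if w.growC d then 1 else 0) := by
  cases d <;> simp only [len, next, incB, growB, growC] <;> simp <;> grind

theorem dA_ne_zero {w : WS} (hw : Good w) (h : 2 ≤ height w) : w.dA ≠ 0 := by
  cases hw with
  | tip | tipW | tipS => revert h; decide
  | diag | diagA | diagD => simp
  | topCorner | topCornerD | topCornerW | topCornerWD => simp
  | top | topE | topW => simp
  | _ => simp [height] at h; omega

/-- Growth in A would also lengthen the diagonal side. Positive values of `height` before and after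
the step exclude this. -/
theorem len_next_le {w : WS} (hw : Good w) {d : Dir} (hd : d ∈ w.F) (h : 0 < height w)
    (h' : 0 < height (w.next d)) : len (w.next d) ≤ len w + w.incB d := by
  by_cases h0 : w.dA = 0
  · revert hd h'
    cases hw with
    | tip | tipW | tipS => revert d; decide
    | rightCorner | rightCornerA | rightCornerS | rightCornerSA
    | right | rightN | rightS => simp [height] at h; omega
    | _ => simp at h0
  · rw [len_next h0]; split_ifs <;> omega

/-- Off the side A, the steps N, A on the top side and E, N on the diagonal side are growth steps,
and they make up at least half of the prudent ones. -/
theorem card_le_two_mul_card_grow {w : WS} (hw : Good w) (h : w.dA ≠ 0) :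
    w.F.card ≤ 2 * (w.F.filter fun d => w.growB d ∨ w.growC d).card := by
  cases hw with
  | tip | tipW | tipS | rightCorner | rightCornerA | rightCornerS | rightCornerSA
  | right | rightN | rightS => simp at h
  | _ => simp only [growB, growC, Nat.add_eq_zero_iff, one_ne_zero, and_false, false_and, true_and,
          false_or, or_false]; decide

theorem avg_not_grow_le {w : WS} (hw : Good w) (h : w.dA ≠ 0) :
    avg w (fun d => if w.growB d ∨ w.growC d then 0 else 1) ≤ 1 / 2 := by
  have h1 := card_le_two_mul_card_grow hw h
  have h2 := Finset.card_filter_add_card_filter_not (s := w.F) (fun d => w.growB d ∨ w.growC d)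
  rw [avg, div_le_iff₀ (card_pos' hw), Finset.sum_ite, Finset.sum_const_zero, zero_add,
    Finset.sum_const, nsmul_eq_mul, mul_one]
  have h1' : (w.F.card : ℝ) ≤ 2 * (w.F.filter fun d => w.growB d ∨ w.growC d).card := by
    exact_mod_cast h1
  have h2' : ((w.F.filter fun d => w.growB d ∨ w.growC d).card : ℝ) +
    (w.F.filter fun d => ¬ (w.growB d ∨ w.growC d)).card = w.F.card := by exact_mod_cast h2
  linarith

theorem avg_sq_height_sub_le {w : WS} (hw : Good w) (M : ℝ) :
    avg w (fun d => ((height (w.next d) : ℝ) - M) ^ 2) ≤ ((height w : ℝ) - M) ^ 2 + 16 := by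
  calc avg w (fun d => ((height (w.next d) : ℝ) - M) ^ 2)
      ≤ avg w fun d => 2 * ((height w : ℝ) - M) * height (w.next d) +
          (16 + M ^ 2 - (height w : ℝ) ^ 2) := by
        refine avg_mono fun d hd => ?_
        have h1 := abs_le.1 (abs_height_next_sub_le hw hd)
        have h2 : (-4 : ℝ) ≤ height (w.next d) - height w := by exact_mod_cast h1.1
        have h3 : (height (w.next d) - height w : ℝ) ≤ 4 := by exact_mod_cast h1.2
        nlinarith
    _ = 2 * ((height w : ℝ) - M) * height w + (16 + M ^ 2 - (height w : ℝ) ^ 2) := by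
        rw [avg_add, avg_const_mul, avg_height hw, avg_const hw]
    _ = _ := by ring

/-- While the height stays close to its initial value, the hull grows at a positive rate. -/
theorem le_reach_of_height_near {m n Q : ℕ} {M : ℝ} (hm : 4 ≤ m) (hM : m ≤ M) (hn : 0 < n)
    (hQ : 4 * Q ≤ n) (k : ℕ) {w : WS} (hw : Good w) (g j : ℕ)
    (hinv : g = 0 ∨ n + len w + 2 * g ≤ j + k + Q) :
    1 - 4 * (((height w : ℝ) - M) ^ 2 + 16 * k) / m ^ 2 - 4 * (j + k / 2) / (3 * n) ≤
      reach k w g := by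
  -- Here g is the growth still required, k the number of steps left and j the number of steps so
  -- far without growth in B or C. The lower bound subtracts a Chebyshev bound for leaving the
  -- m/2-neighbourhood of M and a Markov bound for j reaching 3n/4. By `hinv`, failure with no steps
  -- left forces n ≤ j + Q, hence j ≥ 3n/4.
  have hm' : (4 : ℝ) ≤ m := by exact_mod_cast hm
  have hn' : (0 : ℝ) < n := by exact_mod_cast hn
  have hQ' : 4 * (Q : ℝ) ≤ n := by exact_mod_cast hQ
  have hL : 0 ≤ len w := by have := dC_le hw; unfold len; omega
  induction k generalizing w g j with
  | zero =>
    rcases hinv with rfl | hinv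
    · rw [reach_zero_right]
      have h1 : 0 ≤ 4 * (((height w : ℝ) - M) ^ 2 + 16 * (0 : ℕ)) / m ^ 2 := by positivity
      have h2 : 0 ≤ 4 * (j + (0 : ℕ) / 2 : ℝ) / (3 * n) := by positivity
      linarith
    · refine le_trans ?_ (reach_nonneg _ _ _)
      have h1 : 0 ≤ 4 * (((height w : ℝ) - M) ^ 2 + 16 * (0 : ℕ)) / m ^ 2 := by positivity
      have h3 : (n : ℝ) ≤ j + Q := by
        have : (n : ℤ) ≤ j + Q := by push_cast at hinv; omega
        exact_mod_cast this
      have h2 : 1 ≤ 4 * (j + (0 : ℕ) / 2 : ℝ) / (3 * n) := by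
        rw [le_div_iff₀ (by positivity)]; push_cast; linarith
      linarith
  | succ k ih =>
    -- At distance at least m/2 from M the Chebyshev term alone is at least 1. Closer to M, `height`
    -- is at least m/2 ≥ 2, so the walker is off the side A and not at `fresh`.
    rcases le_or_gt ((m : ℝ) ^ 2) (4 * ((height w : ℝ) - M) ^ 2) with h | h
    · refine le_trans ?_ (reach_nonneg _ _ _)
      have h1 : 1 ≤ 4 * (((height w : ℝ) - M) ^ 2 + 16 * (k + 1 : ℕ)) / m ^ 2 := by
        rw [le_div_iff₀ (by positivity)]; push_cast; nlinarith
      have h2 : 0 ≤ 4 * (j + (k + 1 : ℕ) / 2 : ℝ) / (3 * n) := by positivity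
      linarith
    have hh : 2 ≤ height w := by
      have : (2 : ℝ) ≤ height w := by
        have h1 : |2 * ((height w : ℝ) - M)| < m := abs_lt_of_sq_lt_sq (by linarith) (by linarith)
        have := (abs_lt.1 h1).1
        linarith
      exact_mod_cast this
    have hA := dA_ne_zero hw hh
    have hf : w ≠ fresh := by rintro rfl; rw [height_fresh] at hh; omega
    rw [reach_succ hw hf]
    calc _ ≤ avg w fun d => (1 - 64 * k / m ^ 2 - 4 * (j + k / 2) / (3 * n)) -
            4 / m ^ 2 * ((height (w.next d) : ℝ) - M) ^ 2 -
            4 / (3 * n) * (if w.growB d ∨ w.growC d then 0 else 1) := by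
          have h1 := avg_sq_height_sub_le hw M
          have h2 := avg_not_grow_le hw hA
          rw [avg_sub, avg_sub, avg_const hw, avg_const_mul, avg_const_mul]
          have h3 := mul_le_mul_of_nonneg_left h1 (by positivity : (0 : ℝ) ≤ 4 / m ^ 2)
          have h4 := mul_le_mul_of_nonneg_left h2 (by positivity : (0 : ℝ) ≤ 4 / (3 * n))
          refine le_trans (le_of_eq ?_) (sub_le_sub (sub_le_sub_left h3 _) h4)
          push_cast
          field_simp
          ring
      _ ≤ _ := by
          refine avg_mono fun d hd => ?_
          have hw' := hw.next hd
          refine le_trans (le_of_eq ?_) (ih hw' (g - w.incB d)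
            (j + if w.growB d ∨ w.growC d then 0 else 1) ?_
            (by have := dC_le hw'; unfold len; omega))
          · push_cast
            field_simp
            split_ifs <;> ring
          -- A growth step lowers `len` + 2 g by at least one: growth in B adds 1 and saves 2,
          -- growth in C subtracts 1. A step without growth is charged to j.
          · rcases hinv with rfl | hinv
            · simp
            · have := len_next hA d
              simp only [incB] at this ⊢
              by_cases hB : w.growB d <;> by_cases hC : w.growC d <;>
                simp only [hB, hC, if_true, if_false, or_true, or_false, Nat.cast_one,
                  Nat.cast_zero] at this ⊢ <;> omega

/-- Gambler's ruin for the martingale `height`: it gets to level m before it becomes nonpositive or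
`fresh` is visited with a probability of at least `height`/(m + 4), where 4 is the overshoot and
`notHit` accounts for the finite time. At level m, `le_reach_of_height_near` gives the factor 1/6.
-/
theorem le_reach {m n Q : ℕ} (hm : 4 ≤ m) (hn : 0 < n) (hQ : 8 * Q ≤ n) (hnm : 600 * n ≤ m ^ 2)
    (k : ℕ) {w : WS} (hw : Good w) (g : ℕ) (hinv : g = 0 ∨ len w + g ≤ Q)
    (hh : height w ≤ m + 4) :
    1 / 6 * ((height w : ℝ) / (m + 4) - notHit k w) ≤ reach (k + n) w g := by
  have hm' : (4 : ℝ) ≤ m := by exact_mod_cast hm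
  have hn' : (0 : ℝ) < n := by exact_mod_cast hn
  have hh' : (height w : ℝ) ≤ m + 4 := by exact_mod_cast hh
  have hle : (height w : ℝ) / (m + 4) ≤ 1 := by rw [div_le_one (by positivity)]; exact hh'
  induction k generalizing w g with
  | zero =>
    by_cases hf : w = fresh
    · rw [hf, height_fresh, notHit_fresh]; simp [reach_nonneg]
    by_cases hmh : m ≤ height w
    · have h2 : (m : ℝ) ≤ height w := by exact_mod_cast hmh
      rw [notHit, if_neg hf]
      have := reach_nonneg (0 + n) w g
      linarith
    · rw [notHit, if_neg hf]
      have := reach_nonneg (0 + n) w g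
      linarith
  | succ k ih =>
    rcases le_or_gt (height w) 0 with h0 | h0
    · refine le_trans ?_ (reach_nonneg _ _ _)
      have h1 : (height w : ℝ) / (m + 4) ≤ 0 :=
        div_nonpos_of_nonpos_of_nonneg (by exact_mod_cast h0) (by positivity)
      have := notHit_nonneg (k + 1) w
      linarith
    rcases le_or_gt (m : ℤ) (height w) with hmh | hmh
    · have h2 : (m : ℝ) ≤ height w := by exact_mod_cast hmh
      -- While `height` is positive, `len` + g does not increase, so both are at most Q on arrival;
      -- this is why the slack is 2 Q.
      have h1 := le_reach_of_height_near (Q := 2 * Q) hm h2 hn (by omega) n hw g 0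
        (by rcases hinv with h | h
            · exact .inl h
            · have hL : 0 ≤ len w := by have := dC_le hw; unfold len; omega
              right; push_cast; omega)
      refine le_trans ?_ (h1.trans (reach_mono (by omega) hw g))
      have h3 := notHit_nonneg (k + 1) w
      have h4 : (600 * n : ℝ) ≤ m ^ 2 := by exact_mod_cast hnm
      -- The two losses are at most 1/6 and 2/3, which leaves 1/6.
      have h5 : 4 * (((height w : ℝ) - height w) ^ 2 + 16 * n) / m ^ 2 ≤ 1 / 6 := by
        rw [div_le_iff₀ (by positivity)]
        nlinarith
      have h6 : 4 * (((0 : ℕ) : ℝ) + n / 2) / (3 * n) = 2 / 3 := by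
        push_cast; field_simp; ring
      rw [h6]
      linarith
    · have hf : w ≠ fresh := by rintro rfl; rw [height_fresh] at h0; omega
      rw [show k + 1 + n = k + n + 1 by ring, reach_succ hw hf, notHit, if_neg hf, ← avg_height hw,
        ← avg_div, ← avg_sub, ← avg_const_mul]
      refine avg_mono fun d hd => ?_
      have hw' := hw.next hd
      rcases le_or_gt (height (w.next d)) 0 with h | h
      · refine le_trans ?_ (reach_nonneg _ _ _)
        have h1 : (height (w.next d) : ℝ) / (m + 4) ≤ 0 :=
          div_nonpos_of_nonpos_of_nonneg (by exact_mod_cast h) (by positivity)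
        have := notHit_nonneg k (w.next d)
        linarith
      · have h4 : height (w.next d) ≤ m + 4 := by
          have := abs_le.1 (abs_height_next_sub_le hw hd)
          omega
        have h4' : (height (w.next d) : ℝ) ≤ m + 4 := by exact_mod_cast h4
        refine ih hw' _ ?_ h4 h4' (by rw [div_le_one (by positivity)]; exact h4')
        have := len_next_le hw hd h0 h
        rcases hinv with rfl | hinv
        · simp
        · omega

/-- From the top of the hull the second coordinate of the hull grows by `g`
before the next visit to `fresh` with a probability of order `1 / √g`. -/
theorem exists_le_reach {g : ℕ} (hg : 1 ≤ g) :
    ∃ N₀, ∀ N ≥ N₀, 1 / (400 * √g) ≤ reach N (fresh.next A) (g - 1) := by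
  -- For growth g a time n = 8 g suffices, and 600 n ≤ m² then requires m of order √g. The walk
  -- starts at `height` 3 with `len` equal to 1.
  set m := Nat.sqrt (4800 * g) + 1 with hm
  have hm1 : 4800 * g ≤ m ^ 2 := by
    have := Nat.lt_succ_sqrt (4800 * g)
    rw [sq]; exact this.le
  have hm2 : (m : ℝ) + 4 ≤ 80 * √g := by
    have h1 : (Nat.sqrt (4800 * g) : ℝ) ≤ √(4800 * g) := by
      have := Real.nat_sqrt_le_real_sqrt (a := 4800 * g)
      exact_mod_cast this
    have h2 : √(4800 * (g : ℝ)) ≤ 70 * √g := by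
      rw [Real.sqrt_le_left (by positivity), mul_pow, Real.sq_sqrt (by positivity)]
      nlinarith
    have h3 : 1 ≤ √(g : ℝ) := by rw [Real.one_le_sqrt]; exact_mod_cast hg
    rw [hm]; push_cast; linarith
  have hm4 : 4 ≤ m := by nlinarith
  have hG : Good (fresh.next A) := good_fresh.next (by decide)
  have hh : height (fresh.next A) = 3 := by decide
  have hs : 0 < √(g : ℝ) := Real.sqrt_pos.2 (by exact_mod_cast hg)
  -- The gambler's ruin term is at least 15/(400 √g); N makes `notHit` at most a fifteenth of this
  -- bound, and 14/6 ≥ 1 remains.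
  obtain ⟨N, hN⟩ := Metric.tendsto_atTop.1 (tendsto_notHit hG) (1 / (400 * √g)) (by positivity)
  refine ⟨N + 8 * g, fun k hk => ?_⟩
  refine le_trans ?_ ((le_reach (n := 8 * g) (Q := g) hm4 (by omega) le_rfl (by omega) N hG (g - 1)
    (Or.inr ?_) ?_).trans (reach_mono hk hG _))
  · have h1 := hN N le_rfl
    rw [Real.dist_eq, sub_zero, abs_of_nonneg (notHit_nonneg _ _)] at h1
    rw [hh]
    have h2 : 3 / (80 * √(g : ℝ)) ≤ ((3 : ℤ) : ℝ) / (m + 4) := by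
      push_cast
      exact div_le_div_of_nonneg_left (by norm_num) (by positivity) hm2
    have h3 : 3 / (80 * √(g : ℝ)) = 15 * (1 / (400 * √g)) := by field_simp; norm_num
    rw [h3] at h2
    have h4 : 0 < 1 / (400 * √(g : ℝ)) := by positivity
    linarith
  · have : len (fresh.next A) = 1 := by decide
    omega
  · rw [hh]; omega

end WS
end TriPrudent

/-! ### Probability of leaving the quadrant from a large box -/

namespace TriPrudent
namespace WS

/-- The probability that a walk in the state `w` with the sides of the hull at the distances `A`
and `B` from two walls gets behind one of the walls up to time `n` and before the `j`-th visit
to `fresh`. -/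
noncomputable def exitBlocks : ℕ → ℕ → WS → ℕ → ℕ → ℝ
  | _, 0, _, _, _ => 0
  | 0, _ + 1, w, A, B => if A < w.dA ∨ B < w.dB then 1 else 0
  | n + 1, j + 1, w, A, B => if A < w.dA ∨ B < w.dB then 1 else avg w fun d =>
      exitBlocks n (if w.next d = fresh then j else j + 1) (w.next d) (A + w.incA d) (B + w.incB d)

/-- The probability that a walk in the state `w` with the sides of the hull at the distances `A`
and `B` from two walls gets behind one of the walls up to time `n`. -/
noncomputable def exit : ℕ → WS → ℕ → ℕ → ℝ
  | 0, w, A, B => if A < w.dA ∨ B < w.dB then 1 else 0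
  | n + 1, w, A, B => if A < w.dA ∨ B < w.dB then 1 else avg w fun d =>
      exit n (w.next d) (A + w.incA d) (B + w.incB d)

@[simp] theorem exitBlocks_zero (n : ℕ) (w : WS) (A B : ℕ) : exitBlocks n 0 w A B = 0 := by
  cases n <;> rw [exitBlocks]

theorem exitBlocks_nonneg (n j : ℕ) (w : WS) (A B : ℕ) : 0 ≤ exitBlocks n j w A B := by
  induction n generalizing j w A B with
  | zero => cases j <;> unfold exitBlocks <;> [rfl; (split_ifs <;> norm_num)]
  | succ n ih =>
    cases j <;> unfold exitBlocks
    · rfl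
    · split_ifs
      exacts [zero_le_one, avg_nonneg fun d _ => ih _ _ _ _]

theorem exitBlocks_le_one (n j : ℕ) {w : WS} (hw : Good w) (A B : ℕ) :
    exitBlocks n j w A B ≤ 1 := by
  induction n generalizing j w A B with
  | zero => cases j <;> unfold exitBlocks <;> [norm_num; (split_ifs <;> norm_num)]
  | succ n ih =>
    cases j <;> unfold exitBlocks
    · exact zero_le_one
    · split_ifs
      exacts [le_rfl, avg_le_const hw fun d hd => ih _ (hw.next hd) _ _]

theorem exitBlocks_le_succ (n j : ℕ) {w : WS} (hw : Good w) (A B : ℕ) :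
    exitBlocks n j w A B ≤ exitBlocks (n + 1) j w A B := by
  induction n generalizing j w A B with
  | zero =>
    rcases j with _ | j
    · simp
    by_cases h : A < w.dA ∨ B < w.dB
    · rw [exitBlocks, exitBlocks, if_pos h, if_pos h]
    · rw [exitBlocks, if_neg h]; exact exitBlocks_nonneg _ _ _ _ _
  | succ n ih =>
    rcases j with _ | j
    · simp
    by_cases h : A < w.dA ∨ B < w.dB
    · rw [exitBlocks, exitBlocks, if_pos h, if_pos h]
    · rw [exitBlocks, if_neg h, exitBlocks, if_neg h]
      exact avg_mono fun d hd => ih _ (hw.next hd) _ _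

theorem exitBlocks_mono {n n' : ℕ} (h : n ≤ n') (j : ℕ) {w : WS} (hw : Good w) (A B : ℕ) :
    exitBlocks n j w A B ≤ exitBlocks n' j w A B := by
  induction h with
  | refl => exact le_rfl
  | step _ ih => exact ih.trans (exitBlocks_le_succ _ _ hw _ _)

/-- In n steps there are at most n visits to `fresh`, so a larger limit on their number is void. -/
theorem exit_le_exitBlocks {n j : ℕ} (h : n < j) {w : WS} (hw : Good w) (A B : ℕ) :
    exit n w A B ≤ exitBlocks n j w A B := by
  induction n generalizing j w A B with
  | zero =>
    obtain ⟨j, rfl⟩ : ∃ i, j = i + 1 := ⟨j - 1, by omega⟩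
    rw [exit, exitBlocks]
  | succ n ih =>
    obtain ⟨j, rfl⟩ : ∃ i, j = i + 1 := ⟨j - 1, by omega⟩
    rw [exit, exitBlocks]
    split_ifs
    · exact le_rfl
    · exact avg_mono fun d hd => ih (by split_ifs <;> omega) (hw.next hd) _ _

/-- The function of the size of the hull that bounds the probability of an exit. -/
noncomputable def theta (A : ℕ) : ℝ := (A : ℝ) ^ (-(1 / 28) : ℝ)

theorem theta_nonneg (A : ℕ) : 0 ≤ theta A := by unfold theta; positivity

theorem theta_anti {A A' : ℕ} (hA : 1 ≤ A) (h : A ≤ A') : theta A' ≤ theta A := by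
  unfold theta
  exact Real.rpow_le_rpow_of_nonpos (by exact_mod_cast hA) (by exact_mod_cast h) (by norm_num)

theorem theta_two_mul (A : ℕ) : theta (2 * A) = (2 : ℝ) ^ (-(1 / 28) : ℝ) * theta A := by
  unfold theta
  push_cast
  rw [Real.mul_rpow (by norm_num) (by positivity)]

/-- The state is close to the corner, or the height is large. -/
def Near (m : ℕ) (w : WS) : Prop := w.dA + w.dB < m ∨ (m : ℤ) ≤ |height w|

theorem mem_F {w : WS} (hw : Good w) : (.W ∈ w.F → w.dB = 0) ∧ (.S ∈ w.F → w.dA = 0) := by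
  cases hw <;> simp

/-- The sum of the distances can only increase while the walker is on the top or right side, where
|`height`| is at least this sum. So the neighbourhood of the corner cannot be left with a small
`height`. -/
theorem Near.next {m : ℕ} {w : WS} (hw : Good w) (h : w.dA + w.dB < m) {d : Dir}
    (hd : d ∈ w.F) : Near m (w.next d) := by
  by_cases h0 : (w.next d).dA = 0 ∨ (w.next d).dB = 0
  · have := le_abs_height (hw.next hd) h0
    by_cases hm : (w.next d).dA + (w.next d).dB < m
    · exact .inl hm
    · right; omega
  · left
    have h2 := mem_F hw
    revert h0
    cases d with
    | W => simp [WS.next, h2.1 hd]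
    | S => simp [WS.next, h2.2 hd]
    | _ => simp [WS.next] <;> omega

theorem rpow_le_lyap_of_le_abs_height {w : WS} (hw : Good w) {m : ℕ}
    (h : (m : ℤ) ≤ |height w|) : (m : ℝ) ^ (4 / 7 : ℝ) ≤ lyap w := by
  have h1 : (0 : ℝ) ≤ corr w := by exact_mod_cast corr_nonneg hw
  have h2 : (m : ℝ) ≤ |(height w : ℝ)| := by exact_mod_cast h
  have h3 : (m : ℝ) ^ (4 / 7 : ℝ) = ((m : ℝ) ^ 2) ^ (2 / 7 : ℝ) := by
    rw [← Real.rpow_natCast, ← Real.rpow_mul (by positivity)]; norm_num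
  rw [h3]
  refine Real.rpow_le_rpow (by positivity) ?_ (by norm_num)
  have h4 : (m : ℝ) ^ 2 ≤ (height w : ℝ) ^ 2 := by
    rw [← sq_abs (height w : ℝ)]; exact pow_le_pow_left₀ (by positivity) h2 2
  nlinarith [sq_nonneg (height w : ℝ)]

theorem swap_fresh : fresh.swap = fresh := by
  simp only [swap, fresh, WS.mk.injEq, true_and]; decide

theorem swap_swap (w : WS) : w.swap.swap = w := by
  have : w.swap.swap.F = w.F := by
    ext d; rw [mem_swap, mem_swap, swap_swap_dir]
  rcases w with ⟨a, b, c, F⟩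
  exact congrArg (WS.mk a b c) this

theorem incB_swap (w : WS) (d : Dir) : w.swap.incB d = w.incA d.swap := by
  unfold incA incB
  simp only [growB_swap]

theorem reach_swap_succ {w : WS} (hw : Good w) (hf : w ≠ fresh) (n g : ℕ) :
    reach (n + 1) w.swap g = avg w fun d => reach n (w.next d).swap (g - w.incA d) := by
  rw [reach_succ hw.swap (fun h => hf (by rw [← swap_swap w, h, swap_fresh])), avg_swap]
  refine avg_congr fun d _ => ?_
  rw [incB_swap, swap_swap_dir, swap_next]

/-- The bound of the exit probability before the next visit to `fresh` and, given bounds after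
this visit, of the exit probability in all. -/
theorem exitBlocks_le_of_near {K : ℝ} (hK : 0 ≤ K)
    (hsup : ∀ w, Good w → w ≠ fresh →
      avg w (fun d => lyap (w.next d) + K * psi (w.next d)) ≤ lyap w + K * psi w)
    {N₀ j A₀ B₀ m : ℕ} (hA₀ : N₀ ≤ A₀) (hB₀ : N₀ ≤ B₀) (hN₀ : 1 ≤ N₀) (hm0 : 1 ≤ m)
    (hmA : m ≤ A₀) (hmB : m ≤ B₀)
    (hj : ∀ n A B, N₀ ≤ A → N₀ ≤ B → exitBlocks n j fresh A B ≤ theta A + theta B)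
    (n : ℕ) {w : WS} (hw : Good w) (hf : w ≠ fresh) (hnear : Near m w) {A B : ℕ}
    (hA : A₀ ≤ A) (hB : B₀ ≤ B) :
    exitBlocks n (j + 1) w A B ≤ (lyap w + K * psi w) / (m : ℝ) ^ (4 / 7 : ℝ)
      + (theta A₀ + theta B₀) - (theta A₀ - theta (2 * A₀)) * reach n w.swap (2 * A₀ - A)
      - (theta B₀ - theta (2 * B₀)) * reach n w (2 * B₀ - B) := by
  have hm : (0 : ℝ) < (m : ℝ) ^ (4 / 7 : ℝ) := by positivity
  have hgA : 0 ≤ theta A₀ - theta (2 * A₀) :=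
    sub_nonneg.2 (theta_anti (by omega) (by omega))
  have hgB : 0 ≤ theta B₀ - theta (2 * B₀) :=
    sub_nonneg.2 (theta_anti (by omega) (by omega))
  have hA2 := theta_nonneg (2 * A₀)
  have hB2 := theta_nonneg (2 * B₀)
  induction n generalizing w A B with
  | zero =>
    have h1 := mul_le_mul_of_nonneg_left (reach_le_one 0 hw.swap (2 * A₀ - A)) hgA
    have h2 := mul_le_mul_of_nonneg_left (reach_le_one 0 hw (2 * B₀ - B)) hgB
    have h0 := add_nonneg (lyap_nonneg hw) (mul_nonneg hK (psi_nonneg w))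
    have h3 := div_nonneg h0 hm.le
    rw [exitBlocks]
    split_ifs with h
    · have h4 : (m : ℤ) ≤ |height w| := by
        rcases hnear with h5 | h5
        · omega
        · exact h5
      have h5 := rpow_le_lyap_of_le_abs_height hw h4
      have h6 : 1 ≤ (lyap w + K * psi w) / (m : ℝ) ^ (4 / 7 : ℝ) := by
        rw [le_div_iff₀ hm]
        have := mul_nonneg hK (psi_nonneg w)
        linarith
      linarith
    · linarith
  | succ n ih =>
    -- With a large `height` the Lyapunov term is at least 1; the gains that are subtracted never
    -- exceed the theta terms.
    by_cases h4 : (m : ℤ) ≤ |height w|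
    · have h1 := mul_le_mul_of_nonneg_left (reach_le_one (n + 1) hw.swap (2 * A₀ - A)) hgA
      have h2 := mul_le_mul_of_nonneg_left (reach_le_one (n + 1) hw (2 * B₀ - B)) hgB
      have h5 := rpow_le_lyap_of_le_abs_height hw h4
      have h6 : 1 ≤ (lyap w + K * psi w) / (m : ℝ) ^ (4 / 7 : ℝ) := by
        rw [le_div_iff₀ hm]
        have := mul_nonneg hK (psi_nonneg w)
        linarith
      have := exitBlocks_le_one (n + 1) (j + 1) hw A B
      linarith
    -- The walker is now closer to the sides than the walls are, so no exit has taken place.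
    have h5 : w.dA + w.dB < m := hnear.resolve_right h4
    rw [exitBlocks, if_neg (by omega), reach_swap_succ hw hf, reach_succ hw hf]
    calc _ ≤ avg w fun d => (lyap (w.next d) + K * psi (w.next d)) / (m : ℝ) ^ (4 / 7 : ℝ)
            + (theta A₀ + theta B₀) - (theta A₀ - theta (2 * A₀)) *
              reach n (w.next d).swap (2 * A₀ - A - w.incA d)
            - (theta B₀ - theta (2 * B₀)) * reach n (w.next d) (2 * B₀ - B - w.incB d) := by
          refine avg_mono fun d hd => ?_
          have hw' := hw.next hd
          split_ifs with hd'
          · have h0 := add_nonneg (lyap_nonneg hw') (mul_nonneg hK (psi_nonneg (w.next d)))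
            have h3 := div_nonneg h0 hm.le
            -- At a visit to `fresh` the theta bound applies to the current box. If its side has
            -- doubled, the full gain is realized; otherwise `reach` vanishes at `fresh`, and
            -- monotonicity of `theta` is enough.
            have key : ∀ X X₀ g : ℕ, X₀ ≤ X → 1 ≤ X₀ → g = 2 * X₀ - X →
                theta X ≤ theta X₀ - (theta X₀ - theta (2 * X₀)) * reach n fresh g := by
              intro X X₀ g hX hX0 hg
              rcases Nat.eq_zero_or_pos g with rfl | hg'
              · rw [reach_zero_right]
                have := theta_anti (A := 2 * X₀) (A' := X) (by omega) (by omega)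
                linarith
              · have : reach n fresh g = 0 := by
                  cases n <;> simp [reach, hg'.ne']
                rw [this, mul_zero, sub_zero]
                exact theta_anti hX0 hX
            have hjA := hj n (A + w.incA d) (B + w.incB d) (by omega) (by omega)
            have k1 := key (A + w.incA d) A₀ (2 * A₀ - A - w.incA d) (by omega) (by omega)
              (by omega)
            have k2 := key (B + w.incB d) B₀ (2 * B₀ - B - w.incB d) (by omega) (by omega)
              (by omega)
            rw [hd'] at h3 ⊢
            rw [swap_fresh]
            linarith
          · have := ih hw' hd' (Near.next hw h5 hd) (A := A + w.incA d) (B := B + w.incB d)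
              (by omega) (by omega)
            rwa [← Nat.sub_sub, ← Nat.sub_sub] at this
      _ = avg w (fun d => lyap (w.next d) + K * psi (w.next d)) / (m : ℝ) ^ (4 / 7 : ℝ)
            + (theta A₀ + theta B₀) - (theta A₀ - theta (2 * A₀)) *
              avg w (fun d => reach n (w.next d).swap (2 * A₀ - A - w.incA d))
            - (theta B₀ - theta (2 * B₀)) *
              avg w (fun d => reach n (w.next d) (2 * B₀ - B - w.incB d)) := by
          simp only [avg_sub, avg_add, avg_const hw, avg_const_mul, avg_div]
      _ ≤ _ := by
          have := div_le_div_of_nonneg_right (hsup w hw hf) hm.le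
          linarith

theorem avg_fresh (f : Dir → ℝ) : avg fresh f = (f .E + f .N + f .D + f .A) / 4 := by
  have : fresh.F = {.E, .N, .D, .A} := rfl
  rw [avg, this, Finset.sum_insert (by decide), Finset.sum_insert (by decide),
    Finset.sum_insert (by decide), Finset.sum_singleton]
  have : (({.E, .N, .D, .A} : Finset Dir).card : ℝ) = 4 := by norm_cast
  rw [this]; ring

theorem next_fresh_ne {d : Dir} : fresh.next d ≠ fresh := by
  cases d <;> decide

theorem near_next_fresh {m : ℕ} (hm : 2 ≤ m) (d : Dir) : Near m (fresh.next d) := by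
  left
  have : (fresh.next d).dA + (fresh.next d).dB ≤ 1 := by cases d <;> decide
  omega

/-- Induction on the number of visits to `fresh`. One block costs an exit probability of order
A^(-4/7) + B^(-4/7). It gains the decrease of `theta` under doubling times the probability, of order
A^(-1/2) or B^(-1/2), that the side doubles. For large sides the gain exceeds the cost. -/
theorem exists_exitBlocks_fresh_le :
    ∃ N₀ : ℕ, ∀ j n A B, N₀ ≤ A → N₀ ≤ B → exitBlocks n j fresh A B ≤ theta A + theta B := by
  obtain ⟨K, hK, hsup⟩ := exists_superharmonic
  set Φ : WS → ℝ := fun w => lyap w + K * psi w with hΦ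
  have hG : ∀ d ∈ fresh.F, Good (fresh.next d) := fun d hd => good_fresh.next hd
  have hΦ0 : ∀ d ∈ fresh.F, 0 ≤ Φ (fresh.next d) := fun d hd =>
    add_nonneg (lyap_nonneg (hG d hd)) (mul_nonneg hK (psi_nonneg _))
  set K₁ : ℝ := ∑ d ∈ fresh.F, Φ (fresh.next d) with hK₁
  have hK₁0 : 0 ≤ K₁ := Finset.sum_nonneg hΦ0
  have hΦK : ∀ d ∈ fresh.F, Φ (fresh.next d) ≤ K₁ := fun d hd =>
    Finset.single_le_sum (f := fun d => Φ (fresh.next d)) hΦ0 hd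
  set q : ℝ := 1 - (2 : ℝ) ^ (-(1 / 28) : ℝ) with hq
  have hq0 : 0 < q := by
    rw [hq, sub_pos]; exact Real.rpow_lt_one_of_one_lt_of_neg (by norm_num) (by norm_num)
  have hlim : Tendsto (fun A : ℕ => (A : ℝ) ^ (1 / 28 : ℝ)) atTop atTop :=
    (tendsto_rpow_atTop (by norm_num)).comp tendsto_natCast_atTop_atTop
  obtain ⟨N₁, hN₁⟩ := eventually_atTop.1 (hlim.eventually_ge_atTop (K₁ * 1600 / q))
  -- The gain has the exponent -1/28 - 1/2 = -15/28, the cost -4/7 = -16/28. The factor 1/4 is the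
  -- probability of the particular first step that starts towards the growth.
  have hcost : ∀ A : ℕ, N₁ ≤ A → 1 ≤ A →
      K₁ * (A : ℝ) ^ (-(4 / 7) : ℝ) ≤ 1 / 4 * ((theta A - theta (2 * A)) * (1 / (400 * √A))) := by
    intro A hA hA1
    have h1 := hN₁ A hA
    have hA0 : (0 : ℝ) < A := by exact_mod_cast hA1
    rw [div_le_iff₀ hq0] at h1
    have h2 : theta A - theta (2 * A) = q * (A : ℝ) ^ (-(1 / 28) : ℝ) := by
      rw [theta_two_mul, hq, theta]; ring
    have h3 : 1 / (400 * √(A : ℝ)) = 1 / 400 * (A : ℝ) ^ (-(1 / 2) : ℝ) := by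
      rw [Real.sqrt_eq_rpow, Real.rpow_neg hA0.le]; field_simp
    rw [h2, h3]
    have h4 : 1 / 4 * (q * (A : ℝ) ^ (-(1 / 28) : ℝ) * (1 / 400 * (A : ℝ) ^ (-(1 / 2) : ℝ))) =
        (A : ℝ) ^ (-(4 / 7) : ℝ) * ((A : ℝ) ^ (1 / 28 : ℝ) * q / 1600) := by
      have : (A : ℝ) ^ (-(1 / 28) : ℝ) * (A : ℝ) ^ (-(1 / 2) : ℝ) =
          (A : ℝ) ^ (-(4 / 7) : ℝ) * (A : ℝ) ^ (1 / 28 : ℝ) := by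
        rw [← Real.rpow_add hA0, ← Real.rpow_add hA0]; norm_num
      linear_combination (q / 1600) * this
    rw [h4, mul_comm]
    refine mul_le_mul_of_nonneg_left ?_ (by positivity)
    linarith
  refine ⟨max N₁ 2, fun j => ?_⟩
  induction j with
  | zero =>
    intro n A B _ _
    rw [exitBlocks_zero]
    exact add_nonneg (theta_nonneg A) (theta_nonneg B)
  | succ j ih =>
    intro n A B hA hB
    obtain ⟨NA, hNA⟩ := exists_le_reach (g := A) (by omega)
    obtain ⟨NB, hNB⟩ := exists_le_reach (g := B) (by omega)
    set N := max n (max NA NB) with hN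
    -- The growth estimates need enough time; lengthening the horizon only increases the exit
    -- probability.
    refine (exitBlocks_mono (show n ≤ N + 1 by omega) _ good_fresh A B).trans ?_
    have hrA := hNA N (by omega)
    have hrB := hNB N (by omega)
    set m := min A B with hm
    have key : ∀ d ∈ fresh.F, exitBlocks N (j + 1) (fresh.next d) (A + fresh.incA d)
        (B + fresh.incB d) ≤ K₁ / (m : ℝ) ^ (4 / 7 : ℝ) + (theta A + theta B) -
        (theta A - theta (2 * A)) * reach N (fresh.next d).swap (2 * A - (A + fresh.incA d)) -
        (theta B - theta (2 * B)) * reach N (fresh.next d) (2 * B - (B + fresh.incB d)) := by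
      intro d hd
      refine (exitBlocks_le_of_near hK hsup hA hB (by omega) (by omega) (min_le_left A B)
        (min_le_right A B) ih N (hG d hd) next_fresh_ne (near_next_fresh (by omega) d)
        (by omega) (by omega)).trans ?_
      gcongr
      exact hΦK d hd
    have hgA : 0 ≤ theta A - theta (2 * A) := sub_nonneg.2 (theta_anti (by omega) (by omega))
    have hgB : 0 ≤ theta B - theta (2 * B) := sub_nonneg.2 (theta_anti (by omega) (by omega))
    have hm' : K₁ / (m : ℝ) ^ (4 / 7 : ℝ) ≤
        K₁ * (A : ℝ) ^ (-(4 / 7) : ℝ) + K₁ * (B : ℝ) ^ (-(4 / 7) : ℝ) := by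
      rw [div_eq_mul_inv, ← Real.rpow_neg (by positivity), ← mul_add]
      refine mul_le_mul_of_nonneg_left ?_ hK₁0
      rcases min_choice A B with h | h <;> rw [hm, h]
      · have : 0 ≤ (B : ℝ) ^ (-(4 / 7) : ℝ) := by positivity
        linarith
      · have : 0 ≤ (A : ℝ) ^ (-(4 / 7) : ℝ) := by positivity
        linarith
    have hcA := hcost A (by omega) (by omega)
    have hcB := hcost B (by omega) (by omega)
    rw [exitBlocks, if_neg (by simp [fresh]), avg_fresh]
    simp only [next_fresh_ne, if_false]
    have kE := key .E (by decide)
    have kN := key .N (by decide)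
    have kD := key .D (by decide)
    have kA := key .A (by decide)
    have n1 := fun d => mul_nonneg hgA (reach_nonneg N (fresh.next d).swap
      (2 * A - (A + fresh.incA d)))
    have n2 := fun d => mul_nonneg hgB (reach_nonneg N (fresh.next d)
      (2 * B - (B + fresh.incB d)))
    have iD : fresh.incA .D = 1 := by decide
    have iA : fresh.incB .A = 1 := by decide
    have sD : (fresh.next .D).swap = fresh.next .A := by
      simp only [swap, fresh, next, WS.mk.injEq]; decide
    have e1 := mul_le_mul_of_nonneg_left hrA hgA
    have e2 := mul_le_mul_of_nonneg_left hrB hgB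
    rw [sD, iD, show 2 * A - (A + 1) = A - 1 by omega] at kD
    rw [iA, show 2 * B - (B + 1) = B - 1 by omega] at kA
    rw [iD, iA]
    have := n1 .E
    have := n1 .N
    have := n1 .A
    have := n2 .E
    have := n2 .N
    have := n2 .D
    linarith

theorem exists_exit_fresh_le :
    ∃ N₀ : ℕ, ∀ n A B, N₀ ≤ A → N₀ ≤ B → exit n fresh A B ≤ 1 / 2 := by
  obtain ⟨N₀, h⟩ := exists_exitBlocks_fresh_le
  have hlim : Tendsto theta atTop (𝓝 0) :=
    (tendsto_rpow_neg_atTop (by norm_num)).comp tendsto_natCast_atTop_atTop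
  obtain ⟨N₁, hN₁⟩ := eventually_atTop.1 (hlim.eventually_lt_const (show (0 : ℝ) < 1 / 4 by norm_num))
  refine ⟨max N₀ N₁, fun n A B hA hB => ?_⟩
  have h1 := hN₁ A (by omega)
  have h2 := hN₁ B (by omega)
  have h3 := h (n + 1) n A B (by omega) (by omega)
  have h4 := exit_le_exitBlocks n.lt_succ_self good_fresh (n := n) A B
  linarith

end WS
end TriPrudent

/-! ### The hull keeps growing in each coordinate -/

namespace TriPrudent
namespace WS

/-- The probability that the second coordinate of the hull does not increase up to time `n`. -/
noncomputable def stay : ℕ → WS → ℝ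
  | 0, _ => 1
  | n + 1, w => avg w fun d => if w.growB d then 0 else stay n (w.next d)

theorem stay_nonneg (n : ℕ) (w : WS) : 0 ≤ stay n w := by
  induction n generalizing w with
  | zero => exact zero_le_one
  | succ n ih => exact avg_nonneg fun d _ => by split_ifs; exacts [le_rfl, ih _]

theorem stay_le_one (n : ℕ) {w : WS} (hw : Good w) : stay n w ≤ 1 := by
  induction n generalizing w with
  | zero => exact le_rfl
  | succ n ih =>
    exact avg_le_const hw fun d hd => by split_ifs; exacts [zero_le_one, ih (hw.next hd)]

theorem stay_succ_le (n : ℕ) {w : WS} (hw : Good w) : stay (n + 1) w ≤ stay n w := by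
  induction n generalizing w with
  | zero => exact stay_le_one 1 hw
  | succ n ih =>
    exact avg_mono fun d hd => by split_ifs; exacts [le_rfl, ih (hw.next hd)]

theorem stay_add_le (n k : ℕ) {w : WS} (hw : Good w) :
    stay (k + n) w ≤ notHit k w + stay n fresh := by
  induction k generalizing w with
  | zero =>
    rw [zero_add, notHit]
    split_ifs with h
    · rw [h, zero_add]
    · have := stay_le_one n hw
      have := stay_nonneg n fresh
      linarith
  | succ k ih =>
    by_cases h : w = fresh
    · rw [h, notHit_fresh, zero_add]
      exact antitone_nat_of_succ_le (f := fun n => stay n fresh)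
        (fun n => stay_succ_le n good_fresh) (show n ≤ k + 1 + n by omega)
    · rw [notHit, if_neg h, show k + 1 + n = k + n + 1 by ring, stay,
        ← avg_const hw (stay n fresh), ← avg_add]
      refine avg_mono fun d hd => ?_
      split_ifs
      · exact add_nonneg (notHit_nonneg _ _) (stay_nonneg _ _)
      · exact ih (hw.next hd)

/-- From `fresh`, two of the four steps increase the second coordinate of the hull at once, and
after the other two the chain returns to `fresh`. Hence the limit l satisfies l ≤ l/2. -/
theorem tendsto_stay_fresh : Tendsto (fun n => stay n fresh) atTop (𝓝 0) := by
  have hanti : Antitone fun n => stay n fresh :=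
    antitone_nat_of_succ_le fun n => stay_succ_le n good_fresh
  have hlim := tendsto_atTop_ciInf hanti ⟨0, by rintro _ ⟨n, rfl⟩; exact stay_nonneg _ _⟩
  set l := ⨅ n, stay n fresh with hl
  have hE : Good (fresh.next .E) := good_fresh.next (by decide)
  have hD : Good (fresh.next .D) := good_fresh.next (by decide)
  have h1 : ∀ n, l ≤ stay n fresh / 2 := by
    intro n
    have h2 : ∀ k, stay (k + n + 1) fresh ≤
        (notHit k (fresh.next .E) + notHit k (fresh.next .D) + 2 * stay n fresh) / 4 := by
      intro k
      rw [stay, avg_fresh]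
      have hN : fresh.growB .N := by decide
      have hA : fresh.growB .A := by decide
      have hnE : ¬ fresh.growB .E := by decide
      have hnD : ¬ fresh.growB .D := by decide
      rw [if_neg hnE, if_pos hN, if_neg hnD, if_pos hA]
      have := stay_add_le n k hE
      have := stay_add_le n k hD
      linarith
    have h3 : Tendsto (fun k => stay (k + n + 1) fresh) atTop (𝓝 l) :=
      hlim.comp (tendsto_atTop_mono (fun k => (by omega : k ≤ k + n + 1)) tendsto_id)
    have h4 : Tendsto (fun k => (notHit k (fresh.next .E) + notHit k (fresh.next .D) +
        2 * stay n fresh) / 4) atTop (𝓝 ((0 + 0 + 2 * stay n fresh) / 4)) :=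
      (((tendsto_notHit hE).add (tendsto_notHit hD)).add_const _).div_const _
    have := le_of_tendsto_of_tendsto' h3 h4 h2
    linarith
  have h5 : l ≤ l / 2 := le_of_tendsto_of_tendsto' tendsto_const_nhds (hlim.div_const 2) h1
  have h6 : 0 ≤ l := le_ciInf fun n => stay_nonneg _ _
  rwa [show l = 0 by linarith] at hlim

theorem tendsto_stay {w : WS} (hw : Good w) : Tendsto (fun n => stay n w) atTop (𝓝 0) := by
  rw [Metric.tendsto_atTop]
  intro ε hε
  obtain ⟨n, hn⟩ := Metric.tendsto_atTop.1 tendsto_stay_fresh (ε / 2) (by positivity)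
  obtain ⟨k, hk⟩ := Metric.tendsto_atTop.1 (tendsto_notHit hw) (ε / 2) (by positivity)
  have hn := hn n le_rfl
  have hk := hk k le_rfl
  refine ⟨k + n, fun N hN => ?_⟩
  rw [Real.dist_eq, sub_zero, abs_of_nonneg (stay_nonneg _ _)] at hn ⊢
  rw [Real.dist_eq, sub_zero, abs_of_nonneg (notHit_nonneg _ _)] at hk
  have h1 : stay N w ≤ stay (k + n) w :=
    antitone_nat_of_succ_le (f := fun n => stay n w) (fun n => stay_succ_le n hw) hN
  have := stay_add_le n k hw
  linarith

theorem stay_swap_succ (n : ℕ) (w : WS) :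
    stay (n + 1) w.swap = avg w fun d => if w.growA d then 0 else stay n (w.next d).swap := by
  rw [stay, avg_swap]
  refine avg_congr fun d _ => ?_
  simp only [growB_swap, swap_swap_dir, swap_next]

end WS

/-! ### Lattice geometry: the chain describes the walk -/

/-- The step of a direction. -/
def Dir.vec : Dir → Site
  | E => (1, 0) | W => (-1, 0) | N => (0, 1) | S => (0, -1) | D => (1, -1) | A => (-1, 1)

theorem Dir.vec_injective : Function.Injective Dir.vec := by
  intro d d' h; cases d <;> cases d' <;> first | rfl | exact absurd h (by decide)

/-- The ray from `p` in the direction `d` avoids `V`. -/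
def Free (V : Set Site) (p : Site) : Dir → Prop
  | .E => ∀ q ∈ V, q.2 = p.2 → q.1 ≤ p.1
  | .W => ∀ q ∈ V, q.2 = p.2 → p.1 ≤ q.1
  | .N => ∀ q ∈ V, q.1 = p.1 → q.2 ≤ p.2
  | .S => ∀ q ∈ V, q.1 = p.1 → p.2 ≤ q.2
  | .D => ∀ q ∈ V, q.1 + q.2 = p.1 + p.2 → q.1 ≤ p.1
  | .A => ∀ q ∈ V, q.1 + q.2 = p.1 + p.2 → p.1 ≤ q.1

theorem vec_mem_allowed {V : Set Site} {p : Site} {d : Dir} :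
    d.vec ∈ allowed V p ↔ Free V p d := by
  have h1 : d.vec ∈ allowed V p ↔ ∀ n : ℕ, 1 ≤ n → p + n • d.vec ∉ V := by
    simp only [allowed, Finset.mem_filter, and_iff_right_iff_imp]
    intro _; cases d <;> decide
  rw [h1]
  constructor
  · intro h
    cases d <;> intro q hq hqp <;> by_contra! hlt <;>
      [refine h (q.1 - p.1).toNat (by omega) ?_; refine h (p.1 - q.1).toNat (by omega) ?_;
       refine h (q.2 - p.2).toNat (by omega) ?_; refine h (p.2 - q.2).toNat (by omega) ?_;
       refine h (q.1 - p.1).toNat (by omega) ?_; refine h (p.1 - q.1).toNat (by omega) ?_] <;>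
      convert hq using 1 <;> ext <;> simp [Dir.vec] <;> omega
  · intro h n hn hV
    cases d <;> have := h _ hV <;> simp [Dir.vec] at this <;> omega

theorem exists_vec_of_mem_allowed {V : Set Site} {p v : Site} (h : v ∈ allowed V p) :
    ∃ d : Dir, d.vec = v := by
  have : v ∈ steps := by classical exact (Finset.mem_filter.1 h).1
  simp only [steps, Finset.mem_insert, Finset.mem_singleton] at this
  rcases this with rfl | rfl | rfl | rfl | rfl | rfl
  exacts [⟨.E, rfl⟩, ⟨.W, rfl⟩, ⟨.N, rfl⟩, ⟨.S, rfl⟩, ⟨.D, rfl⟩, ⟨.A, rfl⟩]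

/-- The values of the three coordinates on `V` form intervals. -/
structure Conv (V : Set Site) : Prop where
  fst : ∀ q ∈ V, ∀ r ∈ V, ∀ y, q.1 ≤ y → y ≤ r.1 → ∃ x ∈ V, x.1 = y
  snd : ∀ q ∈ V, ∀ r ∈ V, ∀ y, q.2 ≤ y → y ≤ r.2 → ∃ x ∈ V, x.2 = y
  sum : ∀ q ∈ V, ∀ r ∈ V, ∀ y, q.1 + q.2 ≤ y → y ≤ r.1 + r.2 → ∃ x ∈ V, x.1 + x.2 = y

/-- Each of the three coordinates changes by at most one in a step, so its range over the visited
sites stays an interval. -/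
theorem Conv.insert {V : Set Site} (h : Conv V) {p : Site} (hp : p ∈ V) (d : Dir) :
    Conv (insert (p + d.vec) V) := by
  have aux : ∀ f : Site → ℤ, |f (p + d.vec) - f p| ≤ 1 →
      (∀ q ∈ V, ∀ r ∈ V, ∀ y, f q ≤ y → y ≤ f r → ∃ x ∈ V, f x = y) →
      ∀ q ∈ Insert.insert (p + d.vec) V, ∀ r ∈ Insert.insert (p + d.vec) V,
        ∀ y, f q ≤ y → y ≤ f r → ∃ x ∈ Insert.insert (p + d.vec) V, f x = y := by
    intro f hf h q hq r hr y hqy hyr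
    by_cases hy : y = f (p + d.vec)
    · exact ⟨_, Set.mem_insert _ _, hy.symm⟩
    rw [abs_le] at hf
    have hq' : ∃ q ∈ V, f q ≤ y := by
      rcases hq with rfl | hq
      exacts [⟨p, hp, by omega⟩, ⟨q, hq, hqy⟩]
    have hr' : ∃ r ∈ V, y ≤ f r := by
      rcases hr with rfl | hr
      exacts [⟨p, hp, by omega⟩, ⟨r, hr, hyr⟩]
    obtain ⟨q, hq, hqy⟩ := hq'
    obtain ⟨r, hr, hyr⟩ := hr'
    obtain ⟨x, hx, rfl⟩ := h q hq r hr y hqy hyr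
    exact ⟨x, Set.mem_insert_of_mem _ hx, rfl⟩
  refine ⟨aux (fun q => q.1) ?_ h.fst, aux (fun q => q.2) ?_ h.snd,
    aux (fun q => q.1 + q.2) ?_ h.sum⟩ <;> cases d <;> simp [Dir.vec] <;> ring_nf <;> simp

/-- The distances from `p` to the sides of the hull of `V`. -/
structure IsHull (V : Set Site) (p : Site) (a b c : ℕ) : Prop where
  mem : p ∈ V
  leA : ∀ q ∈ V, q.1 ≤ p.1 + a
  leB : ∀ q ∈ V, q.2 ≤ p.2 + b
  leC : ∀ q ∈ V, q.1 + q.2 ≤ p.1 + p.2 + c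
  exA : ∃ q ∈ V, q.1 = p.1 + a
  exB : ∃ q ∈ V, q.2 = p.2 + b
  exC : ∃ q ∈ V, q.1 + q.2 = p.1 + p.2 + c

/-- The state of the walker at `p` with the set `V` of visited sites is `w`. -/
structure IsW (V : Set Site) (p : Site) (w : WS) : Prop where
  hull : IsHull V p w.dA w.dB w.dC
  mem_F : ∀ d, d ∈ w.F ↔ Free V p d

theorem IsW.allowed_eq {V : Set Site} {p : Site} {w : WS} (h : IsW V p w) :
    allowed V p = w.F.map ⟨Dir.vec, Dir.vec_injective⟩ := by
  ext v
  simp only [Finset.mem_map, Function.Embedding.coeFn_mk]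
  constructor
  · intro hv
    obtain ⟨d, rfl⟩ := exists_vec_of_mem_allowed hv
    exact ⟨d, (h.mem_F d).2 (vec_mem_allowed.1 hv), rfl⟩
  · rintro ⟨d, hd, rfl⟩
    exact vec_mem_allowed.2 ((h.mem_F d).1 hd)

theorem IsHull.next {V : Set Site} {p : Site} {w : WS} (h : IsHull V p w.dA w.dB w.dC) (d : Dir) :
    IsHull (insert (p + d.vec) V) (p + d.vec) (w.next d).dA (w.next d).dB (w.next d).dC := by
  obtain ⟨hp, hA, hB, hC, ⟨qA, hqA, eA⟩, ⟨qB, hqB, eB⟩, ⟨qC, hqC, eC⟩⟩ := h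
  have aux : ∀ (f : Site → ℤ) (a a' : ℕ) (t : ℤ) (q₀ : Site), f (p + d.vec) = f p + t →
      (∀ q ∈ V, f q ≤ f p + a) → q₀ ∈ V → f q₀ = f p + a → (a : ℤ) - t ≤ a' → 0 ≤ a' →
      ((a' : ℤ) = a - t ∨ a' = 0) →
      (∀ q ∈ insert (p + d.vec) V, f q ≤ f (p + d.vec) + a') ∧
      ∃ q ∈ insert (p + d.vec) V, f q = f (p + d.vec) + a' := by
    intro f a a' t q₀ ht hle hq₀ he h1 h2 h3
    constructor
    · rintro q (rfl | hq)
      · omega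
      · have := hle q hq; omega
    · rcases h3 with h3 | h3
      · exact ⟨q₀, Set.mem_insert_of_mem _ hq₀, by omega⟩
      · exact ⟨_, Set.mem_insert _ _, by omega⟩
  have k1 := aux (fun q => q.1) w.dA (w.next d).dA d.vec.1 qA rfl hA hqA eA
    (by cases d <;> simp [Dir.vec, WS.next] <;> omega) (by omega)
    (by cases d <;> simp [Dir.vec, WS.next] <;> omega)
  have k2 := aux (fun q => q.2) w.dB (w.next d).dB d.vec.2 qB rfl hB hqB eB
    (by cases d <;> simp [Dir.vec, WS.next] <;> omega) (by omega)
    (by cases d <;> simp [Dir.vec, WS.next] <;> omega)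
  have k3 := aux (fun q => q.1 + q.2) w.dC (w.next d).dC (d.vec.1 + d.vec.2) qC
    (by simp; ring) hC hqC eC
    (by cases d <;> simp [Dir.vec, WS.next] <;> omega) (by omega)
    (by cases d <;> simp [Dir.vec, WS.next] <;> omega)
  exact ⟨Set.mem_insert _ _, k1.1, k2.1, k3.1, k1.2, k2.2, k3.2⟩

/-- Whether a ray from the new site is blocked depends on whether its line carries a visited site.
`Conv` guarantees one on every line up to the hull; prudence of the step and the hull bounds tell on
which side of the walker it lies. -/
theorem mem_F_next_E {V : Set Site} {p : Site} {w : WS} (h : IsHull V p w.dA w.dB w.dC)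
    (hV : Conv V) (hE : Free V p .E) (h0 : w.dA = 0 ∨ w.dB = 0 ∨ w.dC = 0) (d : Dir) :
    d ∈ (w.next .E).F ↔ Free (insert (p + Dir.vec .E) V) (p + Dir.vec .E) d := by
  obtain ⟨hp, hA, hB, hC, ⟨qA, hqA, eA⟩, ⟨qB, hqB, eB⟩, ⟨qC, hqC, eC⟩⟩ := h
  have cA : w.dA ≠ 0 → ∃ x ∈ V, x.1 = p.1 + 1 := fun h =>
    hV.fst p hp qA hqA _ (by omega) (by omega)
  have cC : w.dC ≠ 0 → ∃ x ∈ V, x.1 + x.2 = p.1 + p.2 + 1 := fun h =>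
    hV.sum p hp qC hqC _ (by omega) (by omega)
  have hN : ∀ q ∈ V, q.1 = p.1 + 1 → q.2 ≤ p.2 := fun q hq h1 => by
    have := hA q hq; have := hB q hq; have := hC q hq; omega
  cases d <;> simp only [WS.next, Free, Dir.vec, Finset.mem_union, Finset.mem_insert,
    Finset.mem_singleton, Prod.fst_add, Prod.snd_add, Set.forall_mem_insert, add_zero] at hE ⊢
  · simp only [reduceCtorEq]; grind
  · simp
    constructor
    · split_ifs <;> simp
    · grind
  · simpa using hN
  · grind
  · grind
  · grind

/-- The hypothesis `hα` says that the new line a = p.1 - 1 is within the range already visited,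
hence occupied; otherwise further directions could be free. -/
theorem mem_F_next_W {V : Set Site} {p : Site} {w : WS} (h : IsHull V p w.dA w.dB w.dC)
    (hV : Conv V) (hW : Free V p .W) (h0 : w.dB = 0) (hα : ∃ q ∈ V, q.1 ≤ p.1 - 1) (d : Dir) :
    d ∈ (w.next .W).F ↔ Free (insert (p + Dir.vec .W) V) (p + Dir.vec .W) d := by
  obtain ⟨hp, hA, hB, hC, -, -, -⟩ := h
  obtain ⟨q, hq, hqα⟩ := hα
  have cA : ∃ x ∈ V, x.1 = p.1 - 1 := hV.fst q hq p hp _ (by omega) (by omega)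
  have cC : ∃ x ∈ V, x.1 + x.2 = p.1 + p.2 - 1 := hV.sum q hq p hp _
    (by have := hB q hq; omega) (by omega)
  cases d <;> simp only [WS.next, Free, Dir.vec, Finset.mem_insert,
    Finset.mem_singleton, Prod.fst_add, Prod.snd_add, Set.forall_mem_insert, add_zero,
    reduceCtorEq] at hW ⊢ <;> grind

theorem mem_F_next_D {V : Set Site} {p : Site} {w : WS} (h : IsHull V p w.dA w.dB w.dC)
    (hV : Conv V) (hD : Free V p .D) (h0 : w.dA = 0 ∨ w.dC = 0)
    (hβ : ∃ q ∈ V, q.2 ≤ p.2 - 1) (d : Dir) :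
    d ∈ (w.next .D).F ↔ Free (insert (p + Dir.vec .D) V) (p + Dir.vec .D) d := by
  obtain ⟨hp, hA, hB, hC, ⟨qA, hqA, eA⟩, -, -⟩ := h
  obtain ⟨q, hq, hqβ⟩ := hβ
  have cA : w.dA ≠ 0 → ∃ x ∈ V, x.1 = p.1 + 1 := fun h =>
    hV.fst p hp qA hqA _ (by omega) (by omega)
  have cB : ∃ x ∈ V, x.2 = p.2 - 1 := hV.snd q hq p hp _ (by omega) (by omega)
  have hN : ∀ q ∈ V, q.1 = p.1 + 1 → q.2 ≤ p.2 - 1 := fun q hq h1 => by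
    have := hA q hq; have := hC q hq; omega
  cases d <;> simp only [WS.next, Free, Dir.vec, Finset.mem_union, Finset.mem_insert,
    Finset.mem_singleton, Prod.fst_add, Prod.snd_add, Set.forall_mem_insert, add_zero,
    reduceCtorEq] at hD ⊢ <;> grind

theorem free_swap {V : Set Site} {p : Site} {d : Dir} :
    Free (Prod.swap ⁻¹' V) p.swap d.swap ↔ Free V p d := by
  cases d <;> simp only [Free, Dir.swap, Prod.forall, Set.mem_preimage, Prod.swap_prod_mk,
    Prod.fst_swap, Prod.snd_swap] <;> grind

theorem IsHull.swap {V : Set Site} {p : Site} {a b c : ℕ} (h : IsHull V p a b c) :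
    IsHull (Prod.swap ⁻¹' V) p.swap b a c := by
  obtain ⟨hp, hA, hB, hC, ⟨qA, hqA, eA⟩, ⟨qB, hqB, eB⟩, ⟨qC, hqC, eC⟩⟩ := h
  exact ⟨hp, fun q hq => hB _ hq, fun q hq => hA _ hq,
    fun q hq => by have := hC _ hq; simp at this ⊢; omega,
    ⟨qB.swap, hqB, eB⟩, ⟨qA.swap, hqA, eA⟩, ⟨qC.swap, hqC, by simp; omega⟩⟩

theorem Conv.swap {V : Set Site} (h : Conv V) : Conv (Prod.swap ⁻¹' V) := by
  refine ⟨fun q hq r hr y h1 h2 => ?_, fun q hq r hr y h1 h2 => ?_, fun q hq r hr y h1 h2 => ?_⟩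
  · obtain ⟨x, hx, e⟩ := h.snd _ hq _ hr y h1 h2; exact ⟨x.swap, hx, e⟩
  · obtain ⟨x, hx, e⟩ := h.fst _ hq _ hr y h1 h2; exact ⟨x.swap, hx, e⟩
  · obtain ⟨x, hx, e⟩ := h.sum _ hq _ hr y (by simp; omega) (by simp; omega)
    exact ⟨x.swap, hx, by simp; omega⟩

theorem swap_vec (d : Dir) : d.swap.vec = d.vec.swap := by cases d <;> rfl

theorem preimage_swap_insert (V : Set Site) (p : Site) :
    Prod.swap ⁻¹' (insert p V) = insert p.swap (Prod.swap ⁻¹' V) := by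
  ext x; simp only [Set.mem_preimage, Set.mem_insert_iff]
  constructor <;> rintro (h | h) <;> [left; right; left; right] <;>
    first | exact h | (rw [← h]; simp) | (rw [h]; simp)

theorem mem_F_next_of_swap {V : Set Site} {p : Site} {w : WS} {e : Dir}
    (h : ∀ d, d ∈ (w.swap.next e.swap).F ↔ Free (insert (p.swap + e.swap.vec)
      (Prod.swap ⁻¹' V)) (p.swap + e.swap.vec) d) (d : Dir) :
    d ∈ (w.next e).F ↔ Free (insert (p + e.vec) V) (p + e.vec) d := by
  have h1 := h d.swap
  rw [← WS.swap_next, WS.mem_swap, WS.swap_swap_dir] at h1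
  rw [h1, ← free_swap (V := insert (p + e.vec) V), preimage_swap_insert, swap_vec, Prod.swap_add]

theorem WS.Good.zero_of_mem {w : WS} (hw : w.Good) :
    (w.dA = 0 ∨ w.dB = 0 ∨ w.dC = 0) ∧ (.D ∈ w.F → w.dA = 0 ∨ w.dC = 0) ∧
      (.A ∈ w.F → w.dB = 0 ∨ w.dC = 0) := by
  cases hw <;> simp

/-- As long as the walk does not leave the range of the visited sites on the far sides, the state
changes according to `WS.next`. -/
theorem IsW.next {V : Set Site} {p : Site} {w : WS} (h : IsW V p w) (hV : Conv V) (hw : w.Good)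
    {d : Dir} (hd : d ∈ w.F) (hα : ∃ q ∈ V, q.1 ≤ (p + d.vec).1)
    (hβ : ∃ q ∈ V, q.2 ≤ (p + d.vec).2) :
    IsW (insert (p + d.vec) V) (p + d.vec) (w.next d) := by
  refine ⟨h.hull.next d, ?_⟩
  have h0 := hw.zero_of_mem
  have h1 := WS.mem_F hw
  have hf := (h.mem_F d).1 hd
  have hf' := free_swap.2 hf
  cases d with
  | E => exact mem_F_next_E h.hull hV hf h0.1
  | W => exact mem_F_next_W h.hull hV hf (h1.1 hd) hα
  | D => exact mem_F_next_D h.hull hV hf (h0.2.1 hd) hβ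
  | N => exact mem_F_next_of_swap (mem_F_next_E (w := w.swap) h.hull.swap hV.swap hf'
      (by have := h0.1; simp only [WS.swap]; tauto))
  | S => exact mem_F_next_of_swap (mem_F_next_W (w := w.swap) h.hull.swap hV.swap hf'
      (h1.2 hd) (let ⟨q, hq, e⟩ := hβ; ⟨q.swap, hq, e⟩))
  | A => exact mem_F_next_of_swap (mem_F_next_D (w := w.swap) h.hull.swap hV.swap hf'
      (h0.2.2 hd) (let ⟨q, hq, e⟩ := hα; ⟨q.swap, hq, e⟩))

/-- After a step that increases the maximal coordinate sum the walker is in a good state. -/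
theorem exists_isW_of_growC {V : Set Site} {p : Site} {a b : ℕ} (h : IsHull V p a b 0)
    (hV : Conv V) {d : Dir} (hd : d = .E ∨ d = .N) (hf : Free V p d) :
    ∃ w : WS, w.Good ∧ IsW (insert (p + d.vec) V) (p + d.vec) w := by
  have hf' := free_swap.2 hf
  have hG : ∀ a b, (WS.next ⟨a, b, 0, ∅⟩ .E).Good := by
    intro a b
    have h : (1 = 0) = False ∧ (∀ p, (p ∧ False) = False) ∧ (∀ p, (p ∨ True) = True) := by simp
    rcases a with _ | _ | a <;> rcases b with _ | b <;> simp only [WS.next]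
    · exact .of_tip (by decide)
    · exact .of_rightCorner (by simp) (by simp only [Nat.add_eq_zero_iff, h]; decide)
    · exact .of_tip (by decide)
    · exact .of_rightCorner (by simp) (by simp only [Nat.add_eq_zero_iff, h]; decide)
    · exact .of_topCorner (by simp) (by simp only [Nat.add_eq_zero_iff, h]; decide)
    · exact .of_diag (by simp) (by simp) (by simp only [Nat.add_eq_zero_iff, h]; decide)
  rcases hd with rfl | rfl
  · exact ⟨WS.next ⟨a, b, 0, ∅⟩ .E, hG a b, IsHull.next (w := ⟨a, b, 0, ∅⟩) h .E,
      mem_F_next_E (w := ⟨a, b, 0, ∅⟩) h hV hf (by simp)⟩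
  · refine ⟨WS.next ⟨a, b, 0, ∅⟩ .N, ?_, IsHull.next (w := ⟨a, b, 0, ∅⟩) h .N,
      mem_F_next_of_swap (mem_F_next_E (w := WS.swap ⟨a, b, 0, ∅⟩) h.swap hV.swap hf'
        (by simp [WS.swap]))⟩
    have h1 := (hG b a).swap
    rw [WS.swap_next] at h1
    exact h1

theorem exists_isHull {V : Set Site} (hV : V.Finite) {p : Site} (hp : p ∈ V) :
    ∃ a b c, IsHull V p a b c := by
  have aux : ∀ f : Site → ℤ, ∃ a : ℕ, (∀ q ∈ V, f q ≤ f p + a) ∧ ∃ q ∈ V, f q = f p + a := by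
    intro f
    obtain ⟨q, hq, hmax⟩ := hV.exists_maximalFor f V ⟨p, hp⟩
    have h : ∀ r ∈ V, f r ≤ f q := fun r hr => by
      rcases le_total (f r) (f q) with h | h
      exacts [h, hmax hr h]
    exact ⟨(f q - f p).toNat, fun r hr => by have := h r hr; have := h p hp; omega,
      q, hq, by have := h p hp; omega⟩
  obtain ⟨a, ha, ha'⟩ := aux fun q => q.1
  obtain ⟨b, hb, hb'⟩ := aux fun q => q.2
  obtain ⟨c, hc, hc'⟩ := aux fun q => q.1 + q.2
  exact ⟨a, b, c, hp, ha, hb, hc, ha', hb', hc'⟩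

end TriPrudent

/-! ### Path probabilities of the prudent walk -/

namespace TriPrudent

/-- The sites that count as visited at time `n`. -/
def visited (K : Set Site) (x : ℕ → Site) (n : ℕ) : Set Site := K ∪ {y | ∃ i ≤ n, x i = y}

theorem visited_succ (K : Set Site) (x : ℕ → Site) (n : ℕ) :
    visited K x (n + 1) = insert (x (n + 1)) (visited K x n) := by
  ext y
  simp only [visited, Set.mem_union, Set.mem_ofPred_eq, Set.mem_insert_iff]
  constructor
  · rintro (h | ⟨i, hi, rfl⟩)
    · exact .inr (.inl h)
    · rcases hi.eq_or_lt with rfl | h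
      exacts [.inl rfl, .inr (.inr ⟨i, by omega, rfl⟩)]
  · rintro (rfl | h | ⟨i, hi, rfl⟩)
    exacts [.inr ⟨_, le_rfl, rfl⟩, .inl h, .inr ⟨i, by omega, rfl⟩]

theorem mem_visited (K : Set Site) (x : ℕ → Site) {i n : ℕ} (h : i ≤ n) : x i ∈ visited K x n :=
  .inr ⟨i, h, rfl⟩

theorem visited_mono (K : Set Site) (x : ℕ → Site) {n m : ℕ} (h : n ≤ m) :
    visited K x n ⊆ visited K x m := by
  rintro y (hy | ⟨i, hi, rfl⟩)
  exacts [.inl hy, .inr ⟨i, hi.trans h, rfl⟩]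

theorem visited_congr {K : Set Site} {x y : ℕ → Site} {n : ℕ} (h : ∀ i ≤ n, x i = y i) :
    visited K x n = visited K y n := by
  ext z
  simp only [visited, Set.mem_union, Set.mem_ofPred_eq]
  refine or_congr_right ⟨?_, ?_⟩ <;> rintro ⟨i, hi, rfl⟩
  exacts [⟨i, hi, (h i hi).symm⟩, ⟨i, hi, h i hi⟩]

/-- The steps of the path are prudent. -/
def Prudent (K : Set Site) (x : ℕ → Site) : Prop :=
  x 0 = 0 ∧ ∀ n, x (n + 1) - x n ∈ allowed (visited K x n) (x n)

open Classical in
/-- The probability that `Q` holds for the next `n` steps of the prudent walk at `p` with the set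
`V` of visited sites. -/
noncomputable def val (Q : Set Site → Site → Prop) : ℕ → Set Site → Site → ℝ
  | 0, V, p => if Q V p then 1 else 0
  | n + 1, V, p => if Q V p then
      (∑ v ∈ allowed V p, val Q n (insert (p + v) V) (p + v)) / (allowed V p).card else 0

theorem val_nonneg (Q : Set Site → Site → Prop) (n : ℕ) (V : Set Site) (p : Site) :
    0 ≤ val Q n V p := by
  induction n generalizing V p with
  | zero => unfold val; split_ifs <;> norm_num
  | succ n ih =>
    unfold val; split_ifs
    exacts [div_nonneg (Finset.sum_nonneg fun _ _ => ih _ _) (by positivity), le_rfl]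

theorem val_le_one (Q : Set Site → Site → Prop) (n : ℕ) (V : Set Site) (p : Site) :
    val Q n V p ≤ 1 := by
  induction n generalizing V p with
  | zero => unfold val; split_ifs <;> norm_num
  | succ n ih =>
    unfold val; split_ifs
    · refine div_le_one_of_le₀ ?_ (by positivity)
      exact (Finset.sum_le_card_nsmul _ _ 1 fun _ _ => ih _ _).trans (by simp)
    · norm_num

variable {K : Set Site} {Ω : Type*} [MeasurableSpace Ω] {P : Measure Ω} {X : ℕ → Ω → Site}

theorem measurableSet_prefix (hX : ∀ n, Measurable (X n)) (n : ℕ) (R : (ℕ → Site) → Prop)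
    (hR : ∀ x y : ℕ → Site, (∀ i ≤ n, x i = y i) → R x → R y) :
    MeasurableSet {ω | R fun i => X i ω} := by
  have h1 : Measurable fun ω (i : Fin (n + 1)) => X i ω := measurable_pi_lambda _ fun i => hX i
  have h2 : {ω | R fun i => X i ω} = (fun ω (i : Fin (n + 1)) => X i ω) ⁻¹'
      {f | R fun i => f ⟨min i n, by omega⟩} := by
    ext ω
    simp only [Set.mem_ofPred_eq, Set.mem_preimage]
    exact ⟨hR _ _ fun i hi => by simp [hi], hR _ _ fun i hi => by simp [hi]⟩
  rw [h2]
  exact h1 (Set.to_countable _).measurableSet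

theorem measurableSet_val (hX : ∀ n, Measurable (X n)) (Q : Set Site → Site → Prop) (x : ℕ → Site)
    (t n : ℕ) : MeasurableSet {ω | (∀ i ≤ t, X i ω = x i) ∧
      ∀ j ≤ n, Q (visited K (fun i => X i ω) (t + j)) (X (t + j) ω)} := by
  refine measurableSet_prefix hX (t + n) (fun y => (∀ i ≤ t, y i = x i) ∧
    ∀ j ≤ n, Q (visited K y (t + j)) (y (t + j))) ?_
  rintro y z h ⟨h1, h2⟩
  refine ⟨fun i hi => by rw [← h i (by omega), h1 i hi], fun j hj => ?_⟩
  rw [← visited_congr fun i hi => h i (by omega), ← h _ (by omega)]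
  exact h2 j hj

theorem measure_prefix_succ (h : IsPrudentWalkPast K P X) (x : ℕ → Site) (t : ℕ) (y : Site) :
    P {ω | ∀ i ≤ t + 1, X i ω = Function.update x (t + 1) y i} = P {ω | ∀ i ≤ t, X i ω = x i} *
      stepProb (visited K x t) (x t) (y - x t) := by
  have hx : ∀ i ≤ t, Function.update x (t + 1) y i = x i := fun i hi =>
    Function.update_of_ne (by omega) _ _
  have h1 := h.2.2 t (Function.update x (t + 1) y)
  rw [Function.update_self, hx t le_rfl] at h1
  rw [h1]
  have h2 : K ∪ {z | ∃ i ≤ t, Function.update x (t + 1) y i = z} = visited K x t :=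
    visited_congr hx
  rw [h2]
  congr 2
  ext ω
  exact forall₂_congr fun i hi => by rw [hx i hi]

/-- The law of the next `n` steps given the path up to time `t`. -/
theorem measure_prefix_and_forall (h : IsPrudentWalkPast K P X) (Q : Set Site → Site → Prop)
    (n : ℕ) (x : ℕ → Site) (t : ℕ) :
    P {ω | (∀ i ≤ t, X i ω = x i) ∧
      ∀ j ≤ n, Q (visited K (fun i => X i ω) (t + j)) (X (t + j) ω)} =
    P {ω | ∀ i ≤ t, X i ω = x i} * ENNReal.ofReal (val Q n (visited K x t) (x t)) := by
  have h0 : ∀ ω, (∀ i ≤ t, X i ω = x i) →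
      (Q (visited K (fun i => X i ω) t) (X t ω) ↔ Q (visited K x t) (x t)) := fun ω hω => by
    rw [visited_congr hω, hω t le_rfl]
  by_cases hQ : Q (visited K x t) (x t)
  swap
  · have h1 : val Q n (visited K x t) (x t) = 0 := by
      cases n <;> rw [val, if_neg hQ]
    rw [h1, ENNReal.ofReal_zero, mul_zero, ← measure_empty (μ := P)]
    congr 1
    ext ω
    simp only [Set.mem_ofPred_eq, Set.mem_empty_iff_false, iff_false, not_and]
    exact fun hω hj => hQ ((h0 ω hω).1 (hj 0 (Nat.zero_le _)))
  induction n generalizing x t with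
  | zero =>
    rw [val, if_pos hQ, ENNReal.ofReal_one, mul_one]
    congr 1
    ext ω
    simp only [Set.mem_ofPred_eq, and_iff_left_iff_imp, Nat.le_zero, forall_eq, add_zero]
    exact fun hω => (h0 ω hω).2 hQ
  | succ n ih =>
    have hev : {ω | (∀ i ≤ t, X i ω = x i) ∧
        ∀ j ≤ n + 1, Q (visited K (fun i => X i ω) (t + j)) (X (t + j) ω)} =
        ⋃ y : Site, {ω | (∀ i ≤ t + 1, X i ω = Function.update x (t + 1) y i) ∧
          ∀ j ≤ n, Q (visited K (fun i => X i ω) (t + 1 + j)) (X (t + 1 + j) ω)} := by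
      ext ω
      simp only [Set.mem_ofPred_eq, Set.mem_iUnion]
      constructor
      · rintro ⟨h1, h2⟩
        refine ⟨X (t + 1) ω, fun i hi => ?_, fun j hj => ?_⟩
        · rcases hi.eq_or_lt with rfl | hi
          · simp
          · rw [Function.update_of_ne hi.ne]; exact h1 i (by omega)
        · rw [show t + 1 + j = t + (j + 1) by ring]; exact h2 _ (by omega)
      · rintro ⟨y, h1, h2⟩
        have h1' : ∀ i ≤ t, X i ω = x i := fun i hi => by
          rw [h1 i (by omega), Function.update_of_ne (by omega)]
        refine ⟨h1', fun j hj => ?_⟩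
        rcases j with _ | j
        · exact (h0 ω h1').2 hQ
        · rw [show t + (j + 1) = t + 1 + j by ring]; exact h2 j (by omega)
    have hval : ∀ y : Site,
        P {ω | (∀ i ≤ t + 1, X i ω = Function.update x (t + 1) y i) ∧
          ∀ j ≤ n, Q (visited K (fun i => X i ω) (t + 1 + j)) (X (t + 1 + j) ω)} =
        P {ω | ∀ i ≤ t, X i ω = x i} * (stepProb (visited K x t) (x t) (y - x t) *
          ENNReal.ofReal (val Q n (insert y (visited K x t)) y)) := by
      intro y
      have hV : visited K (Function.update x (t + 1) y) (t + 1) = insert y (visited K x t) := by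
        rw [visited_succ, Function.update_self]
        congr 1
        exact visited_congr fun i hi => Function.update_of_ne (by omega) _ _
      rw [← mul_assoc, ← measure_prefix_succ h]
      by_cases hQ' : Q (visited K (Function.update x (t + 1) y) (t + 1))
          (Function.update x (t + 1) y (t + 1))
      · rw [ih _ _ (fun ω hω => by rw [visited_congr hω, hω _ le_rfl]) hQ', hV,
          Function.update_self]
      · rw [hV, Function.update_self] at hQ'
        have h1 : val Q n (insert y (visited K x t)) y = 0 := by
          cases n <;> rw [val, if_neg hQ']
        rw [h1, ENNReal.ofReal_zero, mul_zero, ← measure_empty (μ := P)]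
        congr 1
        ext ω
        simp only [Set.mem_ofPred_eq, Set.mem_empty_iff_false, iff_false, not_and]
        intro hω hj
        have := hj 0 (Nat.zero_le _)
        rw [add_zero, visited_congr hω, hω _ le_rfl, hV, Function.update_self] at this
        exact hQ' this
    rw [hev, measure_iUnion ?_ fun y => measurableSet_val h.1 Q _ _ _]
    swap
    · intro y z hyz
      refine Set.disjoint_left.2 fun ω h1 h2 => hyz ?_
      have h3 := h1.1 (t + 1) le_rfl
      have h4 := h2.1 (t + 1) le_rfl
      rw [Function.update_self] at h3 h4
      rw [← h3, h4]
    simp only [hval]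
    rw [ENNReal.tsum_mul_left]
    congr 1
    rw [← (Equiv.addLeft (x t)).tsum_eq]
    simp only [Equiv.coe_addLeft, add_sub_cancel_left]
    rw [tsum_eq_sum (s := allowed (visited K x t) (x t)) fun v hv => by
      rw [stepProb, if_neg hv, zero_mul]]
    rw [val, if_pos hQ, Finset.sum_div, ENNReal.ofReal_sum_of_nonneg fun v _ =>
      div_nonneg (val_nonneg _ _ _ _) (by positivity)]
    refine Finset.sum_congr rfl fun v hv => ?_
    have hc : (0 : ℝ) < (allowed (visited K x t) (x t)).card := by
      exact_mod_cast Finset.card_pos.2 ⟨v, hv⟩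
    rw [stepProb, if_pos hv, ENNReal.ofReal_div_of_pos hc, ENNReal.ofReal_natCast, mul_comm]
    rfl

theorem ae_prudent (h : IsPrudentWalkPast K P X) : ∀ᵐ ω ∂P, Prudent K fun n => X n ω := by
  have h1 : ∀ n, ∀ᵐ ω ∂P, X (n + 1) ω - X n ω ∈ allowed (visited K (fun i => X i ω) n) (X n ω) := by
    intro n
    -- Prefixes are indexed by a countable type and extended by their last value, so countably many
    -- null events suffice.
    have h2 : ∀ f : Fin (n + 1) → Site, ∀ y : Site,
        y - f (Fin.last n) ∉ allowed (visited K (fun i => f ⟨min i n, by omega⟩) n)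
          (f (Fin.last n)) →
        P {ω | ∀ i ≤ n + 1, X i ω =
          Function.update (fun i => f ⟨min i n, by omega⟩) (n + 1) y i} = 0 := by
      intro f y hy
      have e : f ⟨min n n, by omega⟩ = f (Fin.last n) := congrArg f (Fin.ext (min_self n))
      rw [measure_prefix_succ h, e, stepProb, if_neg hy, mul_zero]
    have h3 : ∀ᵐ ω ∂P, ∀ f : Fin (n + 1) → Site, ∀ y : Site,
        y - f (Fin.last n) ∉ allowed (visited K (fun i => f ⟨min i n, by omega⟩) n)
          (f (Fin.last n)) →
        ¬ ∀ i ≤ n + 1, X i ω =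
          Function.update (fun i => f ⟨min i n, by omega⟩) (n + 1) y i := by
      rw [ae_all_iff]; intro f
      rw [ae_all_iff]; intro y
      rw [eventually_imp_distrib_left]
      intro hy
      have := h2 f y hy
      rw [ae_iff]; simpa using this
    filter_upwards [h3] with ω hω
    by_contra hc
    have e : ∀ i ≤ n, X (min i n) ω = X i ω := fun i hi => by rw [min_eq_left hi]
    refine hω (fun i => X i ω) (X (n + 1) ω) ?_ ?_
    · simp only [Fin.val_last]
      rwa [visited_congr e]
    · intro i hi
      rcases hi.eq_or_lt with rfl | hi
      · simp
      · rw [Function.update_of_ne hi.ne]; exact (e i (by omega)).symm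
  filter_upwards [h.2.1, ae_all_iff.2 h1] with ω h2 h3
  exact ⟨h2, h3⟩

/-- If the probability that `Q` holds for `n` steps tends to zero, then `Q` eventually fails. -/
theorem ae_exists_not (h : IsPrudentWalkPast K P X) [IsFiniteMeasure P]
    {Q S : Set Site → Site → Prop}
    (hS : ∀ V p, S V p → Tendsto (fun n => val Q n V p) atTop (𝓝 0)) :
    ∀ᵐ ω ∂P, ∀ t, S (visited K (fun i => X i ω) t) (X t ω) →
      ∃ j, ¬ Q (visited K (fun i => X i ω) (t + j)) (X (t + j) ω) := by
  rw [ae_all_iff]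
  intro t
  have h3 : ∀ᵐ ω ∂P, ∀ f : Fin (t + 1) → Site,
      S (visited K (fun i => f ⟨min i t, by omega⟩) t) (f (Fin.last t)) →
      ¬ ((∀ i ≤ t, X i ω = f ⟨min i t, by omega⟩) ∧
        ∀ j, Q (visited K (fun i => X i ω) (t + j)) (X (t + j) ω)) := by
    rw [ae_all_iff]; intro f
    rw [eventually_imp_distrib_left]
    intro hf
    rw [ae_iff]
    simp only [not_not]
    have e : f ⟨min t t, by omega⟩ = f (Fin.last t) := congrArg f (Fin.ext (min_self t))
    have hle : ∀ n, P {ω | (∀ i ≤ t, X i ω = f ⟨min i t, by omega⟩) ∧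
        ∀ j, Q (visited K (fun i => X i ω) (t + j)) (X (t + j) ω)} ≤
        P {ω | ∀ i ≤ t, X i ω = f ⟨min i t, by omega⟩} *
          ENNReal.ofReal (val Q n (visited K (fun i => f ⟨min i t, by omega⟩) t)
            (f (Fin.last t))) := by
      intro n
      have := measure_prefix_and_forall h Q n (fun i => f ⟨min i t, by omega⟩) t
      rw [e] at this
      rw [← this]
      exact measure_mono fun ω hω => ⟨hω.1, fun j _ => hω.2 j⟩
    have hlim := ENNReal.Tendsto.const_mul (a := P {ω | ∀ i ≤ t, X i ω = f ⟨min i t, by omega⟩})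
      (ENNReal.tendsto_ofReal (hS _ _ hf)) (.inr (measure_ne_top _ _))
    rw [ENNReal.ofReal_zero, mul_zero] at hlim
    exact le_antisymm (ge_of_tendsto' hlim hle) zero_le
  filter_upwards [h3] with ω hω hS'
  by_contra! hc
  have e : ∀ i ≤ t, X (min i t) ω = X i ω := fun i hi => by rw [min_eq_left hi]
  refine hω (fun i => X i ω) ?_ ⟨fun i hi => (e i hi).symm, hc⟩
  simp only [Fin.val_last]
  rwa [visited_congr e]

end TriPrudent

/-! ### Comparison of the walk with the chain -/

namespace TriPrudent

theorem IsW.sum_allowed_div {V : Set Site} {p : Site} {w : WS} (h : IsW V p w) (f : Site → ℝ) :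
    (∑ v ∈ allowed V p, f v) / (allowed V p).card = w.avg fun d => f d.vec := by
  rw [h.allowed_eq, Finset.sum_map, Finset.card_map]; rfl

/-- The sites that satisfy `R` are within the range of `V` on the far sides. -/
def Low (R : Site → Prop) (V : Set Site) : Prop :=
  ∀ p, R p → (∃ q ∈ V, q.1 ≤ p.1) ∧ ∃ q ∈ V, q.2 ≤ p.2

theorem Low.mono {R : Site → Prop} {V V' : Set Site} (h : Low R V) (hV : V ⊆ V') : Low R V' :=
  fun p hp => let ⟨⟨q, hq, e⟩, ⟨r, hr, e'⟩⟩ := h p hp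
    ⟨⟨q, hV hq, e⟩, ⟨r, hV hr, e'⟩⟩

theorem val_of_not {Q : Set Site → Site → Prop} {n : ℕ} {V : Set Site} {p : Site} (h : ¬ Q V p) :
    val Q n V p = 0 := by
  cases n <;> rw [val, if_neg h]

/-- The property `Low` makes the transition to the next state valid for every step that stays in R.
Steps out of R contribute nothing to `val`. -/
theorem val_le_notHit {R : Site → Prop} (n : ℕ) {V : Set Site} {p : Site} {w : WS} (hV : Conv V)
    (h : IsW V p w) (hw : w.Good) (hR : Low R V) :
    val (fun V p => R p ∧ ¬ IsW V p .fresh) n V p ≤ w.notHit n := by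
  induction n generalizing V p w with
  | zero =>
    rw [WS.notHit]
    split_ifs with hf
    · exact (val_of_not fun hQ => hQ.2 (hf ▸ h)).le
    · exact val_le_one _ _ _ _
  | succ n ih =>
    by_cases hQ : R p ∧ ¬ IsW V p .fresh
    · rw [val, if_pos hQ, h.sum_allowed_div, WS.notHit,
        if_neg fun hf : w = .fresh => hQ.2 (hf ▸ h)]
      refine WS.avg_mono fun d hd => ?_
      by_cases hp : R (p + d.vec)
      · exact ih (hV.insert h.hull.mem d) (h.next hV hw hd (hR _ hp).1 (hR _ hp).2) (hw.next hd)
          (hR.mono (Set.subset_insert _ _))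
      · rw [val_of_not fun hQ => hp hQ.1]
        exact WS.notHit_nonneg _ _
    · rw [val_of_not hQ]; exact WS.notHit_nonneg _ _

theorem val_le_stay {R : Site → Prop} (n : ℕ) {V : Set Site} {p : Site} {w : WS} {b : ℤ}
    (hV : Conv V) (h : IsW V p w) (hw : w.Good) (hR : Low R V) (hb : p.2 + w.dB = b) :
    val (fun _ p => R p ∧ p.2 ≤ b) n V p ≤ w.stay n := by
  induction n generalizing V p w with
  | zero => exact val_le_one _ _ _ _
  | succ n ih =>
    by_cases hQ : R p ∧ p.2 ≤ b
    · rw [val, if_pos hQ, h.sum_allowed_div, WS.stay]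
      refine WS.avg_mono fun d hd => ?_
      split_ifs with hg
      · refine (val_of_not fun hQ' => ?_).le
        have h1 := hQ'.2
        obtain ⟨h0, rfl | rfl⟩ := hg <;> simp [Dir.vec] at h1 <;> omega
      · by_cases hp : R (p + d.vec)
        · refine ih (hV.insert h.hull.mem d) (h.next hV hw hd (hR _ hp).1 (hR _ hp).2) (hw.next hd)
            (hR.mono (Set.subset_insert _ _)) ?_
          cases d <;> simp [WS.growB] at hg <;> simp [Dir.vec, WS.next] <;> omega
        · rw [val_of_not fun hQ => hp hQ.1]
          exact WS.stay_nonneg _ _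
    · rw [val_of_not hQ]; exact WS.stay_nonneg _ _

theorem val_le_stay_swap {R : Site → Prop} (n : ℕ) {V : Set Site} {p : Site} {w : WS} {a : ℤ}
    (hV : Conv V) (h : IsW V p w) (hw : w.Good) (hR : Low R V) (ha : p.1 + w.dA = a) :
    val (fun _ p => R p ∧ p.1 ≤ a) n V p ≤ w.swap.stay n := by
  induction n generalizing V p w with
  | zero => exact val_le_one _ _ _ _
  | succ n ih =>
    by_cases hQ : R p ∧ p.1 ≤ a
    · rw [val, if_pos hQ, h.sum_allowed_div, WS.stay_swap_succ]
      refine WS.avg_mono fun d hd => ?_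
      split_ifs with hg
      · refine (val_of_not fun hQ' => ?_).le
        have h1 := hQ'.2
        obtain ⟨h0, rfl | rfl⟩ := hg <;> simp [Dir.vec] at h1 <;> omega
      · by_cases hp : R (p + d.vec)
        · refine ih (hV.insert h.hull.mem d) (h.next hV hw hd (hR _ hp).1 (hR _ hp).2) (hw.next hd)
            (hR.mono (Set.subset_insert _ _)) ?_
          cases d <;> simp [WS.growA] at hg <;> simp [Dir.vec, WS.next] <;> omega
        · rw [val_of_not fun hQ => hp hQ.1]
          exact WS.stay_nonneg _ _
    · rw [val_of_not hQ]; exact WS.stay_nonneg _ _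

/-- A and B are the coordinates of the hull sides, so a distance to a side beyond them means a
negative coordinate of the walker. -/
theorem one_sub_exit_le_val (n : ℕ) {V : Set Site} {p : Site} {w : WS} {A B : ℕ} (hV : Conv V)
    (h : IsW V p w) (hw : w.Good) (hR : Low (· ∈ firstQuadrant) V) (hA : p.1 + w.dA = A)
    (hB : p.2 + w.dB = B) :
    1 - w.exit n A B ≤ val (fun _ p => p ∈ firstQuadrant) n V p := by
  have aux : ∀ p : Site, ∀ w : WS, ∀ A B : ℕ, p.1 + w.dA = A → p.2 + w.dB = B →
      (p ∈ firstQuadrant ↔ ¬ (A < w.dA ∨ B < w.dB)) := by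
    intro p w A B hA hB
    simp only [firstQuadrant, Set.mem_ofPred_eq]
    omega
  induction n generalizing V p w A B with
  | zero =>
    have := aux p w A B hA hB
    rw [WS.exit, val]
    by_cases hQ : p ∈ firstQuadrant
    · rw [if_pos hQ, if_neg (this.1 hQ), sub_zero]
    · rw [if_neg hQ, if_pos (not_not.1 fun h => hQ (this.2 h)), sub_self]
  | succ n ih =>
    have hp := aux p w A B hA hB
    by_cases hQ : p ∈ firstQuadrant
    · rw [val, if_pos hQ, h.sum_allowed_div, WS.exit, if_neg (hp.1 hQ), ← WS.avg_const hw 1,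
        ← WS.avg_sub]
      refine WS.avg_mono fun d hd => ?_
      have hA' : (p + d.vec).1 + (w.next d).dA = (A + w.incA d : ℕ) := by
        cases d <;> simp only [WS.incA, WS.growA] <;> simp [Dir.vec, WS.next] <;> grind
      have hB' : (p + d.vec).2 + (w.next d).dB = (B + w.incB d : ℕ) := by
        cases d <;> simp only [WS.incB, WS.growB] <;> simp [Dir.vec, WS.next] <;> grind
      by_cases hp' : p + d.vec ∈ firstQuadrant
      · exact ih (hV.insert h.hull.mem d) (h.next hV hw hd (hR _ hp').1 (hR _ hp').2) (hw.next hd)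
          (hR.mono (Set.subset_insert _ _)) hA' hB'
      · have h1 := (aux _ _ _ _ hA' hB').not.1 hp'
        rw [not_not] at h1
        have h2 : (w.next d).exit n (A + w.incA d) (B + w.incB d) = 1 := by
          cases n <;> rw [WS.exit, if_pos h1]
        rw [h2, sub_self]
        exact val_nonneg _ _ _ _
    · have h1 := hp.not.1 hQ
      rw [not_not] at h1
      rw [WS.exit, if_pos h1, sub_self]
      exact val_nonneg _ _ _ _

variable {K : Set Site} {x : ℕ → Site}

theorem Prudent.exists_dir (hx : Prudent K x) (n : ℕ) :
    ∃ d : Dir, x (n + 1) = x n + d.vec ∧ Free (visited K x n) (x n) d := by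
  obtain ⟨d, hd⟩ := exists_vec_of_mem_allowed (hx.2 n)
  exact ⟨d, by rw [hd]; abel, vec_mem_allowed.1 (hd ▸ hx.2 n)⟩

theorem Prudent.conv (hx : Prudent K x) (h0 : Conv (visited K x 0)) (n : ℕ) :
    Conv (visited K x n) := by
  induction n with
  | zero => exact h0
  | succ n ih =>
    obtain ⟨d, hd, -⟩ := hx.exists_dir n
    rw [visited_succ, hd]
    exact ih.insert (mem_visited _ _ le_rfl) d

theorem conv_singleton (p : Site) : Conv {p} := by
  refine ⟨?_, ?_, ?_⟩ <;> rintro q rfl r rfl y h1 h2 <;> exact ⟨_, rfl, le_antisymm h1 h2⟩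

theorem visited_empty_zero (x : ℕ → Site) : visited ∅ x 0 = {x 0} := by
  ext y; simp [visited, eq_comm]

theorem Prudent.conv_empty (hx : Prudent ∅ x) (n : ℕ) : Conv (visited ∅ x n) :=
  hx.conv (by rw [visited_empty_zero]; exact conv_singleton _) n

theorem Prudent.isW_succ (hx : Prudent K x) {n : ℕ} {w : WS} (hV : Conv (visited K x n))
    (h : IsW (visited K x n) (x n) w) (hw : w.Good) {R : Site → Prop}
    (hR : Low R (visited K x n)) (hn : R (x (n + 1))) :
    ∃ d ∈ w.F, x (n + 1) = x n + d.vec ∧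
      IsW (visited K x (n + 1)) (x (n + 1)) (w.next d) := by
  obtain ⟨d, hd, hf⟩ := hx.exists_dir n
  have hdF := (h.mem_F d).2 hf
  refine ⟨d, hdF, hd, ?_⟩
  rw [visited_succ]
  rw [hd] at hn ⊢
  exact h.next hV hw hdF (hR _ hn).1 (hR _ hn).2

theorem visited_cornerBox_zero (h0 : x 0 = 0) : visited cornerBox x 0 = cornerBox := by
  ext y
  simp only [visited, Set.mem_union, Set.mem_ofPred_eq, Nat.le_zero, exists_eq_left, h0,
    or_iff_left_iff_imp]
  rintro rfl; simp [cornerBox]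

theorem conv_cornerBox : Conv cornerBox := by
  refine ⟨fun q _ r hr y _ h2 => ⟨(y, 0), ?_, rfl⟩, fun q _ r hr y _ h2 => ⟨(0, y), ?_, ?_⟩,
    fun q _ r hr y _ h2 => ⟨(y, 0), ?_, ?_⟩⟩ <;>
    simp [cornerBox] at hr ⊢ <;> omega

theorem isW_cornerBox : IsW cornerBox 0 .fresh := by
  refine ⟨⟨?_, ?_, ?_, ?_, ⟨0, ?_, ?_⟩, ⟨0, ?_, ?_⟩, ⟨0, ?_, ?_⟩⟩, ?_⟩
  any_goals simp [cornerBox, WS.fresh]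
  any_goals omega
  intro d
  have h1 : ¬ ∀ a ≤ (0 : ℤ), 0 ≤ a := fun h => absurd (h (-1) (by norm_num)) (by norm_num)
  cases d <;> simp only [Free, cornerBox, Set.mem_ofPred_eq, Prod.forall, Finset.mem_insert,
    Finset.mem_singleton, Prod.fst_zero, Prod.snd_zero, reduceCtorEq, or_false, or_true, false_iff,
    true_iff]
  all_goals first | (intros; omega) | (intro h; have := h (-1) 0; have := h 0 (-1); omega)

theorem low_cornerBox (n : ℕ) : Low (fun _ => True) (visited cornerBox x n) := fun p _ =>
  ⟨⟨(min p.1 0, 0), .inl (by simp [cornerBox]), by simp⟩,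
    ⟨(0, min p.2 0), .inl (by simp [cornerBox]), by simp⟩⟩

theorem Prudent.conv_cornerBox (hx : Prudent cornerBox x) (n : ℕ) :
    Conv (visited cornerBox x n) :=
  hx.conv (by rw [visited_cornerBox_zero hx.1]; exact TriPrudent.conv_cornerBox) n

theorem Prudent.exists_isW_cornerBox (hx : Prudent cornerBox x) (n : ℕ) :
    ∃ w : WS, w.Good ∧ IsW (visited cornerBox x n) (x n) w := by
  induction n with
  | zero =>
    refine ⟨.fresh, .tip, ?_⟩
    rw [visited_cornerBox_zero hx.1, hx.1]
    exact isW_cornerBox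
  | succ n ih =>
    obtain ⟨w, hw, h⟩ := ih
    obtain ⟨d, hd, -, h'⟩ := hx.isW_succ (hx.conv_cornerBox n) h hw (low_cornerBox n) trivial
    exact ⟨_, hw.next hd, h'⟩

/-! ### Confined paths and their returns to the corner -/

/-- The path stays within a translate of the first quadrant. -/
def Confined (x : ℕ → Site) : Prop := ∃ α β : ℤ, ∀ n, α ≤ (x n).1 ∧ β ≤ (x n).2

theorem exists_min_of_le {f : ℕ → ℤ} {α : ℤ} (h : ∀ n, α ≤ f n) : ∃ m, ∀ n, f m ≤ f n := by
  obtain ⟨_, ⟨m, rfl⟩, hm⟩ := Int.exists_least_of_bdd (P := fun z => ∃ n, f n = z)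
    ⟨α, by rintro _ ⟨n, rfl⟩; exact h n⟩ ⟨f 0, 0, rfl⟩
  exact ⟨m, fun n => hm _ ⟨n, rfl⟩⟩

/-- For a confined path the corner of the range of the path is eventually determined. -/
theorem Confined.exists_low (h : Confined x) : ∃ (α β : ℤ) (n₀ : ℕ),
    (∀ n, α ≤ (x n).1 ∧ β ≤ (x n).2) ∧
      ∀ n ≥ n₀, Low (fun p => α ≤ p.1 ∧ β ≤ p.2) (visited K x n) := by
  obtain ⟨α, β, h⟩ := h
  obtain ⟨m, hm⟩ := exists_min_of_le fun n => (h n).1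
  obtain ⟨l, hl⟩ := exists_min_of_le fun n => (h n).2
  refine ⟨(x m).1, (x l).2, max m l, fun n => ⟨hm n, hl n⟩, fun n hn p hp => ?_⟩
  exact ⟨⟨x m, mem_visited _ _ (by omega), hp.1⟩, ⟨x l, mem_visited _ _ (by omega), hp.2⟩⟩

theorem Prudent.injective (hx : Prudent K x) : Function.Injective x := by
  refine Function.Injective.of_lt_imp_ne fun m n hmn e => ?_
  obtain ⟨k, rfl⟩ : ∃ k, n = k + 1 := ⟨n - 1, by omega⟩
  have h := hx.2 k
  classical
  have h2 := (Finset.mem_filter.1 h).2 1 le_rfl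
  rw [one_smul, add_sub_cancel, ← e] at h2
  exact h2 (mem_visited _ _ (by omega))

/-- A prudent path never revisits a site, and a confined path with bounded coordinate sum would lie
in a finite triangle. -/
theorem Prudent.exists_growC (hx : Prudent K x) (hc : Confined x) (t : ℕ) :
    ∃ s ≥ t, ∀ i ≤ s, (x i).1 + (x i).2 < (x (s + 1)).1 + (x (s + 1)).2 := by
  by_contra! hcon
  obtain ⟨C, hC⟩ : ∃ C : ℤ, ∀ i ≤ t, (x i).1 + (x i).2 ≤ C := by
    obtain ⟨i, hi, h⟩ := (Set.finite_Iic t).exists_maximalFor (fun i => (x i).1 + (x i).2) _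
      ⟨t, Set.self_mem_Iic⟩
    refine ⟨(x i).1 + (x i).2, fun j hj => ?_⟩
    rcases le_total ((x j).1 + (x j).2) ((x i).1 + (x i).2) with h1 | h1
    exacts [h1, h hj h1]
  have hall : ∀ n, (x n).1 + (x n).2 ≤ C := by
    intro n
    induction n using Nat.strong_induction_on with
    | _ n ih =>
      rcases le_or_gt n t with h | h
      · exact hC n h
      · obtain ⟨i, hi, h'⟩ := hcon (n - 1) (by omega)
        rw [Nat.sub_add_cancel (by omega)] at h'
        exact h'.trans (ih i (by omega))
  obtain ⟨α, β, h⟩ := hc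
  refine Set.infinite_range_of_injective hx.injective
    (((Set.finite_Icc α (C - β)).prod (Set.finite_Icc β (C - α))).subset ?_)
  rintro _ ⟨n, rfl⟩
  have h1 := h n
  have h2 := hall n
  simp only [Set.mem_prod, Set.mem_Icc]
  omega

theorem finite_visited_empty (x : ℕ → Site) (n : ℕ) : (visited ∅ x n).Finite := by
  have : visited ∅ x n = x '' Set.Iic n := by ext; simp [visited]
  rw [this]; exact (Set.finite_Iic n).image _

/-- A record of the coordinate sum is made by a step E or N from the diagonal side. Such a step
leads to a good state whatever came before. -/
theorem Prudent.exists_isW (hx : Prudent ∅ x) (hc : Confined x) (t : ℕ) :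
    ∃ s ≥ t, ∃ w : WS, w.Good ∧ IsW (visited ∅ x s) (x s) w := by
  obtain ⟨s, hs, h⟩ := hx.exists_growC hc t
  obtain ⟨a, b, c, hull⟩ := exists_isHull (finite_visited_empty x s) (mem_visited ∅ x le_rfl)
  obtain ⟨d, hd, hf⟩ := hx.exists_dir s
  have hs1 := h s le_rfl
  rw [hd] at h hs1
  have hdEN : d = .E ∨ d = .N := by cases d <;> simp [Dir.vec] at hs1 ⊢ <;> omega
  have hc : c = 0 := by
    obtain ⟨q, hq, e⟩ := hull.exC
    simp only [visited, Set.empty_union, Set.mem_ofPred_eq] at hq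
    obtain ⟨i, hi, rfl⟩ := hq
    have := h i hi
    rcases hdEN with rfl | rfl <;> simp [Dir.vec] at this <;> omega
  subst hc
  obtain ⟨w, hw, hW⟩ := exists_isW_of_growC hull (hx.conv_empty s) hdEN hf
  refine ⟨s + 1, by omega, w, hw, ?_⟩
  rw [visited_succ, hd]
  exact hW

section process

variable {Ω : Type*} [MeasurableSpace Ω] {P : Measure Ω} [IsProbabilityMeasure P]
  {X : ℕ → Ω → Site}

theorem tendsto_zero_of_le {f g : ℕ → ℝ} (h0 : ∀ n, 0 ≤ f n) (h : ∀ n, f n ≤ g n)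
    (hg : Tendsto g atTop (𝓝 0)) : Tendsto f atTop (𝓝 0) :=
  tendsto_of_tendsto_of_tendsto_of_le_of_le tendsto_const_nhds hg h0 h

/-- A corners process returns to a corner infinitely often. -/
theorem ae_exists_fresh_cornerBox (h : IsPrudentWalkPast cornerBox P X) :
    ∀ᵐ ω ∂P, ∀ t, ∃ s ≥ t, IsW (visited cornerBox (fun i => X i ω) s) (X s ω) .fresh := by
  have h1 := ae_exists_not h (Q := fun V p => True ∧ ¬ IsW V p .fresh)
    (S := fun V p => Conv V ∧ Low (fun _ => True) V ∧ ∃ w : WS, w.Good ∧ IsW V p w) (by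
      rintro V p ⟨hV, hR, w, hw, hW⟩
      exact tendsto_zero_of_le (fun n => val_nonneg _ _ _ _)
        (fun n => val_le_notHit n hV hW hw hR) (WS.tendsto_notHit hw))
  filter_upwards [h1, ae_prudent h] with ω h1 hx t
  obtain ⟨j, hj⟩ := h1 t ⟨hx.conv_cornerBox t, low_cornerBox t, hx.exists_isW_cornerBox t⟩
  exact ⟨t + j, by omega, by simpa using hj⟩

/-- A confined prudent walk returns to a corner infinitely often. -/
theorem ae_exists_fresh (h : IsPrudentWalkPast ∅ P X) :
    ∀ᵐ ω ∂P, Confined (fun i => X i ω) →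
      ∀ t, ∃ s ≥ t, IsW (visited ∅ (fun i => X i ω) s) (X s ω) .fresh := by
  have h1 := ae_all_iff.2 fun α : ℤ => ae_all_iff.2 fun β : ℤ =>
    ae_exists_not h (Q := fun V p => (α ≤ p.1 ∧ β ≤ p.2) ∧ ¬ IsW V p .fresh)
      (S := fun V p => Conv V ∧ Low (fun p => α ≤ p.1 ∧ β ≤ p.2) V ∧
        ∃ w : WS, w.Good ∧ IsW V p w) (by
      rintro V p ⟨hV, hR, w, hw, hW⟩
      exact tendsto_zero_of_le (fun n => val_nonneg _ _ _ _)
        (fun n => val_le_notHit n hV hW hw hR) (WS.tendsto_notHit hw))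
  filter_upwards [h1, ae_prudent h] with ω h1 hx hc t
  obtain ⟨α, β, n₀, hαβ, hlow⟩ := hc.exists_low (K := ∅)
  obtain ⟨s, hs, hw⟩ := hx.exists_isW hc (max t n₀)
  obtain ⟨j, hj⟩ := h1 α β s ⟨hx.conv_empty s, hlow s (by omega), hw⟩
  refine ⟨s + j, by omega, ?_⟩
  by_contra hn
  exact hj ⟨hαβ _, hn⟩

/-- The hull of a confined prudent walk grows in both coordinates infinitely often. -/
theorem ae_exists_lt (h : IsPrudentWalkPast ∅ P X) :
    ∀ᵐ ω ∂P, Confined (fun i => X i ω) → ∀ t,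
      (∃ s, ∀ i ≤ t, (X i ω).1 < (X s ω).1) ∧ ∃ s, ∀ i ≤ t, (X i ω).2 < (X s ω).2 := by
  have hA := ae_all_iff.2 fun α : ℤ => ae_all_iff.2 fun β : ℤ => ae_all_iff.2 fun a : ℤ =>
    ae_exists_not h (Q := fun V p => (α ≤ p.1 ∧ β ≤ p.2) ∧ p.1 ≤ a)
      -- Starting at `fresh` makes the current coordinate the maximum so far, so exceeding it is a
      -- growth of the hull.
      (S := fun V p => Conv V ∧ Low (fun p => α ≤ p.1 ∧ β ≤ p.2) V ∧ IsW V p .fresh ∧ p.1 = a) (by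
      rintro V p ⟨hV, hR, hW, rfl⟩
      exact tendsto_zero_of_le (fun n => val_nonneg _ _ _ _)
        (fun n => val_le_stay_swap n hV hW .tip hR (by simp [WS.fresh]))
        (WS.tendsto_stay WS.Good.tip.swap))
  have hB := ae_all_iff.2 fun α : ℤ => ae_all_iff.2 fun β : ℤ => ae_all_iff.2 fun b : ℤ =>
    ae_exists_not h (Q := fun V p => (α ≤ p.1 ∧ β ≤ p.2) ∧ p.2 ≤ b)
      (S := fun V p => Conv V ∧ Low (fun p => α ≤ p.1 ∧ β ≤ p.2) V ∧ IsW V p .fresh ∧ p.2 = b) (by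
      rintro V p ⟨hV, hR, hW, rfl⟩
      exact tendsto_zero_of_le (fun n => val_nonneg _ _ _ _)
        (fun n => val_le_stay n hV hW .tip hR (by simp [WS.fresh]))
        (WS.tendsto_stay .tip))
  filter_upwards [hA, hB, ae_prudent h, ae_exists_fresh h] with ω hA hB hx hfr hc t
  obtain ⟨α, β, n₀, hαβ, hlow⟩ := hc.exists_low (K := ∅)
  obtain ⟨s, hs, hW⟩ := hfr hc (max t n₀)
  constructor
  · obtain ⟨j, hj⟩ := hA α β _ s ⟨hx.conv_empty s, hlow s (by omega), hW, rfl⟩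
    refine ⟨s + j, fun i hi => ?_⟩
    have h1 := hW.hull.leA _ (mem_visited _ _ (show i ≤ s by omega))
    have h2 := not_le.1 fun h => hj ⟨hαβ _, h⟩
    simp [WS.fresh] at h1
    omega
  · obtain ⟨j, hj⟩ := hB α β _ s ⟨hx.conv_empty s, hlow s (by omega), hW, rfl⟩
    refine ⟨s + j, fun i hi => ?_⟩
    have h1 := hW.hull.leB _ (mem_visited _ _ (show i ≤ s by omega))
    have h2 := not_le.1 fun h => hj ⟨hαβ _, h⟩
    simp [WS.fresh] at h1
    omega

end process

end TriPrudent

/-! ### Excursions, and settling implies confinement -/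

namespace TriPrudent

theorem extent_succ_lt_iff (f : ℕ → ℤ) (t : ℕ) : extent f t < extent f (t + 1) ↔
    (∀ i ≤ t, f i < f (t + 1)) ∨ ∀ i ≤ t, f (t + 1) < f i := by
  have hs : (Finset.range (t + 1 + 1)).sup' Finset.nonempty_range_add_one f =
      max (f (t + 1)) ((Finset.range (t + 1)).sup' Finset.nonempty_range_add_one f) := by
    simp only [Finset.range_add_one (n := t + 1)]
    exact Finset.sup'_insert (Finset.nonempty_range_add_one (n := t)) f
  have hi : (Finset.range (t + 1 + 1)).inf' Finset.nonempty_range_add_one f =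
      min (f (t + 1)) ((Finset.range (t + 1)).inf' Finset.nonempty_range_add_one f) := by
    simp only [Finset.range_add_one (n := t + 1)]
    exact Finset.inf'_insert (Finset.nonempty_range_add_one (n := t)) f
  have h1 : (∀ i ≤ t, f i < f (t + 1)) ↔
      (Finset.range (t + 1)).sup' Finset.nonempty_range_add_one f < f (t + 1) := by
    rw [Finset.sup'_lt_iff]; simp
  have h2 : (∀ i ≤ t, f (t + 1) < f i) ↔
      f (t + 1) < (Finset.range (t + 1)).inf' Finset.nonempty_range_add_one f := by
    rw [Finset.lt_inf'_iff]; simp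
  have h3 : (Finset.range (t + 1)).inf' Finset.nonempty_range_add_one f ≤
      (Finset.range (t + 1)).sup' Finset.nonempty_range_add_one f :=
    (Finset.inf'_le f (Finset.self_mem_range_succ t)).trans
      (Finset.le_sup' f (Finset.self_mem_range_succ t))
  rw [h1, h2, extent, extent, hs, hi]
  omega

theorem nextGrowth_spec {f : ℕ → ℤ} {τ : ℕ∞} {t : ℕ} (h : nextGrowth f τ = t) :
    τ < t ∧ f (t - 1) < f t ∧ ∀ s : ℕ, τ < s → s < t → ¬ f (s - 1) < f s := by
  have hlow : ∀ s : ℕ, τ < s → f (s - 1) < f s → (t : ℕ∞) ≤ s := fun s h1 h2 => by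
    rw [← h]; exact iInf₂_le (f := fun (s : ℕ) (_ : τ < s ∧ f (s - 1) < f s) => (s : ℕ∞)) s ⟨h1, h2⟩
  have hex : ∃ s : ℕ, (τ < s ∧ f (s - 1) < f s) ∧ (s : ℕ∞) < t + 1 := by
    have : nextGrowth f τ < t + 1 := by rw [h]; exact_mod_cast Nat.lt_succ_self t
    simpa [nextGrowth, iInf_lt_iff] using this
  obtain ⟨s, ⟨h1, h2⟩, h3⟩ := hex
  have h4 : s < t + 1 := by exact_mod_cast h3
  have h5 : t ≤ s := by exact_mod_cast hlow s h1 h2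
  obtain rfl : s = t := by omega
  exact ⟨h1, h2, fun r hr1 hr2 hr3 => by
    have : s ≤ r := by exact_mod_cast hlow r hr1 hr3
    omega⟩

theorem exists_nextGrowth_eq {f : ℕ → ℤ} {n : ℕ} (h : ∃ t, n < t ∧ f (t - 1) < f t) :
    ∃ t : ℕ, nextGrowth f n = t := by
  obtain ⟨t, h1, h2⟩ := h
  refine ⟨(nextGrowth f n).toNat, (ENat.natCast_toNat ?_).symm⟩
  refine ne_top_of_le_ne_top (ENat.natCast_ne_top t) ?_
  exact iInf₂_le (f := fun (s : ℕ) (_ : (n : ℕ∞) < s ∧ f (s - 1) < f s) => (s : ℕ∞)) t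
    ⟨by exact_mod_cast h1, h2⟩

/-- The first time at which all values up to n are exceeded is a record of f, so the extent grows
there. -/
theorem exists_nextGrowth_eq_of_lt {f : ℕ → ℤ} {n s : ℕ} (h : ∀ i ≤ n, f i < f s) :
    ∃ t : ℕ, nextGrowth (extent f) n = t := by
  classical
  have hex : ∃ s, ∀ i ≤ n, f i < f s := ⟨s, h⟩
  set r := Nat.find hex with hr
  have h1 : ∀ i ≤ n, f i < f r := Nat.find_spec hex
  have hnr : n < r := by
    by_contra! hle
    exact lt_irrefl _ (h1 r hle)
  obtain ⟨q, hq⟩ : ∃ q, r = q + 1 := ⟨r - 1, by omega⟩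
  refine exists_nextGrowth_eq ⟨r, hnr, ?_⟩
  rw [hq, Nat.add_sub_cancel, extent_succ_lt_iff, ← hq]
  left
  intro i hi
  have h2 := Nat.find_min hex (show i < r by omega)
  push Not at h2
  obtain ⟨j, hj, hij⟩ := h2
  exact hij.trans_lt (h1 j hj)

theorem exists_eq_add_one_of_sub_one_eq {a : ℕ∞} {u : ℕ} (ha : 0 < a) (h : a - 1 = u) :
    a = (u + 1 : ℕ) := by
  induction a using ENat.recTopCoe with
  | top => simp at h
  | coe a =>
    norm_cast at h ha ⊢
    omega

theorem nextGrowth_pos (f : ℕ → ℤ) (τ : ℕ∞) : 0 < nextGrowth f τ := by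
  refine lt_of_lt_of_le (zero_lt_one (α := ℕ∞)) (le_iInf₂ fun t ht => ?_)
  have : 0 < t := by
    rcases Nat.eq_zero_or_pos t with rfl | h
    · simp at ht
    · exact h
  exact_mod_cast this

variable {x : ℕ → Site}

theorem Prudent.swap (hx : Prudent ∅ x) : Prudent ∅ fun n => (x n).swap := by
  refine ⟨by simp [hx.1], fun n => ?_⟩
  obtain ⟨d, hd, hf⟩ := hx.exists_dir n
  have h1 : visited ∅ (fun n => (x n).swap) n = Prod.swap ⁻¹' visited ∅ x n := by
    ext y
    simp only [visited, Set.empty_union, Set.mem_ofPred_eq, Set.mem_preimage]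
    exact exists_congr fun i => and_congr_right fun _ =>
      ⟨fun h => by rw [← h, Prod.swap_swap], fun h => by rw [h, Prod.swap_swap]⟩
  have h2 : (x (n + 1)).swap - (x n).swap = d.swap.vec := by rw [hd, swap_vec, Prod.swap_add]; abel
  rw [h1, h2, vec_mem_allowed]
  exact free_swap.2 hf

/-- A walker that crosses the left side of its box remains behind the box as long as the height of
the box does not change. -/
theorem Prudent.trapped (hx : Prudent ∅ x) {n m : ℕ} (hdrop : ∀ i ≤ n, (x (n + 1)).1 < (x i).1)
    (hnm : n < m) (hb : ∀ j, n < j → j ≤ m →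
      (∃ i ≤ n, (x i).2 ≤ (x j).2) ∧ ∃ i ≤ n, (x j).2 ≤ (x i).2) : x m ∉ firstQuadrant := by
  set V := visited ∅ x n with hVdef
  have hVi : ∀ i ≤ n, x i ∈ V := fun i hi => mem_visited _ _ hi
  have hVe : ∀ q ∈ V, ∃ i ≤ n, x i = q := fun q hq => by
    simpa [hVdef, visited] using hq
  have hV : Conv V := hx.conv_empty n
  have hfin : V.Finite := finite_visited_empty x n
  have hmin : ∀ f : Site → ℤ, ∃ q ∈ V, ∀ r ∈ V, f q ≤ f r := by
    intro f
    obtain ⟨q, hq, h⟩ := hfin.exists_minimalFor f V ⟨_, hVi n le_rfl⟩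
    refine ⟨q, hq, fun r hr => ?_⟩
    rcases le_total (f q) (f r) with h1 | h1
    exacts [h1, h hr h1]
  obtain ⟨qa, hqa, ha⟩ := hmin fun q => q.1
  obtain ⟨qs, hqs, hs⟩ := hmin fun q => q.1 + q.2
  have h0 : (0 : Site) ∈ V := hx.1 ▸ hVi 0 (Nat.zero_le _)
  have ha0 := ha 0 h0
  have hs0 := hs 0 h0
  -- Being left of the old box, or below its smallest coordinate sum, is preserved. The steps E, N,
  -- D out of this region point at visited sites, because the row, column or diagonal line in
  -- question is occupied; W, S, A cannot leave it.
  have key : ∀ j, n < j → j ≤ m → (x j).1 < qa.1 ∨ (x j).1 + (x j).2 < qs.1 + qs.2 := by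
    intro j hj
    induction j, hj using Nat.le_induction with
    | base =>
      intro _
      obtain ⟨i, hi, rfl⟩ := hVe qa hqa
      exact .inl (hdrop i hi)
    | succ j hj ih =>
      intro hjm
      obtain ⟨⟨i₁, hi₁, hb₁⟩, i₂, hi₂, hb₂⟩ := hb j hj (by omega)
      have hv₁ := hVi i₁ hi₁
      have hv₂ := hVi i₂ hi₂
      have hVj : V ⊆ visited ∅ x j := visited_mono _ _ (by omega)
      obtain ⟨d, hd, hf⟩ := hx.exists_dir j
      have hs₁ := hs _ hv₁
      have ha₂ := ha _ hv₂
      have ih := ih (by omega)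
      rw [hd]
      cases d with
      | E =>
        exfalso
        obtain ⟨q, hq, e⟩ := hV.snd _ hv₁ _ hv₂ _ hb₁ hb₂
        have h1 := hf q (hVj hq) e
        have h2 := ha q hq
        have h3 := hs q hq
        omega
      | N =>
        by_cases h : (x j).1 < qa.1
        · left; simpa [Dir.vec] using h
        exfalso
        obtain ⟨q, hq, e⟩ := hV.fst qa hqa _ hv₁ (x j).1 (by omega) (by omega)
        have h1 := hf q (hVj hq) e
        have h3 := hs q hq
        omega
      | D =>
        by_cases h : (x j).1 + (x j).2 < qs.1 + qs.2
        · right; simp [Dir.vec]; omega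
        exfalso
        obtain ⟨q, hq, e⟩ := hV.sum qs hqs _ hv₂ ((x j).1 + (x j).2) (by omega) (by omega)
        have h1 := hf q (hVj hq) e
        have h3 := ha q hq
        omega
      | W | S | A => simp [Dir.vec]; omega
  have := key m hnm le_rfl
  -- The origin is visited, so both minima are at most 0 and the region is disjoint from the
  -- quadrant.
  simp only [firstQuadrant, Set.mem_ofPred_eq]
  simp only [Prod.fst_zero, Prod.snd_zero] at ha0 hs0
  omega

/-- A new minimum strictly between two consecutive times c i enlarges the width. This is impossible
where the width is constant. Where the height is constant the walk would be trapped until the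
excursion ends, against `hFQ`. A new minimum at a time c i itself is one step away from the
quadrant, hence at least -1. -/
theorem Prudent.bddBelow_fst (hx : Prudent ∅ x) {c : ℕ → ℕ} (hc : StrictMono c)
    (hFQ : ∀ i, x (c i - 1) ∈ firstQuadrant)
    (hgrow : ∀ i, (∀ s, c i < s → s < c (i + 1) → ¬ width x (s - 1) < width x s) ∨
      ∀ s, c i < s → s < c (i + 1) → ¬ height x (s - 1) < height x s) :
    ∃ L : ℤ, ∀ n, L ≤ (x n).1 := by
  obtain ⟨L, hL⟩ : ∃ L : ℤ, ∀ i ≤ c 0, L ≤ (x i).1 := by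
    obtain ⟨i, hi, h⟩ := (Set.finite_Iic (c 0)).exists_minimalFor (fun i => (x i).1) _
      ⟨c 0, Set.self_mem_Iic⟩
    refine ⟨(x i).1, fun j hj => ?_⟩
    rcases le_total (x i).1 (x j).1 with h1 | h1
    exacts [h1, h hj h1]
  refine ⟨min L (-1), fun n => ?_⟩
  induction n using Nat.strong_induction_on with
  | _ n ih =>
    rcases le_or_gt n (c 0) with h0 | h0
    · exact (min_le_left _ _).trans (hL n h0)
    obtain ⟨n, rfl⟩ : ∃ k, n = k + 1 := ⟨n - 1, by omega⟩
    by_cases hdrop : ∀ i ≤ n, (x (n + 1)).1 < (x i).1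
    swap
    · push Not at hdrop
      obtain ⟨i, hi, h⟩ := hdrop
      exact (ih i (by omega)).trans h
    classical
    obtain ⟨i, hi1, hi2⟩ : ∃ i, c i ≤ n + 1 ∧ n + 1 < c (i + 1) := by
      have hex : ∃ k, n + 1 < c k := ⟨n + 2, lt_of_lt_of_le (by omega) (hc.le_apply (x := n + 2))⟩
      have h1 := Nat.find_spec hex
      have h2 : Nat.find hex ≠ 0 := fun h => by rw [h] at h1; omega
      obtain ⟨k, hk⟩ := Nat.exists_eq_succ_of_ne_zero h2
      refine ⟨k, not_lt.1 (Nat.find_min hex (by omega)), ?_⟩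
      rw [hk] at h1; exact h1
    rcases hi1.eq_or_lt with heq | hlt
    · have h1 := hFQ i
      rw [heq, Nat.add_sub_cancel] at h1
      obtain ⟨d, hd, -⟩ := hx.exists_dir n
      rw [hd]
      have h2 := h1.1
      refine (min_le_right _ _).trans ?_
      cases d <;> simp [Dir.vec] <;> omega
    · exfalso
      rcases hgrow i with hw | hh
      · refine hw (n + 1) hlt hi2 ?_
        rw [Nat.add_sub_cancel, width, width, extent_succ_lt_iff]
        exact .inr hdrop
      · refine hx.trapped hdrop (m := c (i + 1) - 1) (by omega) ?_ (hFQ (i + 1))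
        intro j hj
        induction j using Nat.strong_induction_on with
        | _ j ih =>
          intro hjm
          have h1 := hh j (by omega) (by omega)
          obtain ⟨j, rfl⟩ : ∃ k, j = k + 1 := ⟨j - 1, by omega⟩
          rw [Nat.add_sub_cancel, height, height, extent_succ_lt_iff] at h1
          push Not at h1
          obtain ⟨⟨i₁, hi₁, h₁⟩, i₂, hi₂, h₂⟩ := h1
          constructor
          · rcases le_or_gt i₂ n with h | h
            · exact ⟨i₂, h, h₂⟩
            · obtain ⟨⟨k, hk, h'⟩, -⟩ := ih i₂ (by omega) h (by omega)
              exact ⟨k, hk, h'.trans h₂⟩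
          · rcases le_or_gt i₁ n with h | h
            · exact ⟨i₁, h, h₁⟩
            · obtain ⟨-, k, hk, h'⟩ := ih i₁ (by omega) h (by omega)
              exact ⟨k, hk, h₁.trans h'⟩

/-- A prudent walk that settles in the first quadrant is confined. -/
theorem Prudent.confined_of_settles (hx : Prudent ∅ x) {K : ℕ}
    (h : ∀ k ≥ K, ∃ u t : ℕ, timeU x k = u ∧ timeT x (k + 1) = t ∧
      x u ∈ firstQuadrant ∧ x t ∈ firstQuadrant) : Confined x := by
  choose! u t hu ht hxu hxt using h
  have hH : ∀ k ≥ K, nextGrowth (height x) (growthT x k) = (u k + 1 : ℕ) := fun k hk =>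
    exists_eq_add_one_of_sub_one_eq (nextGrowth_pos _ _) (hu k hk)
  have hG : ∀ k ≥ K, growthT x (k + 1) = (t k + 1 : ℕ) := fun k hk =>
    exists_eq_add_one_of_sub_one_eq (nextGrowth_pos _ _) (ht k hk)
  have hH' : ∀ k ≥ K, _ := fun k hk => nextGrowth_spec (hH k hk)
  have hG' : ∀ k ≥ K, _ := fun k hk => nextGrowth_spec (hG k hk)
  -- Growth times of the height and of the width alternate; between a growth of the height and the
  -- next one in the list the width is constant, and conversely.
  set c : ℕ → ℕ := fun i => if i % 2 = 0 then u (K + i / 2) + 1 else t (K + i / 2) + 1 with hc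
  have c0 : ∀ j, c (2 * j) = u (K + j) + 1 := fun j => by simp [hc]
  have c1 : ∀ j, c (2 * j + 1) = t (K + j) + 1 := fun j => by
    have h1 : (2 * j + 1) % 2 = 1 := by omega
    have h2 : (2 * j + 1) / 2 = j := by omega
    simp [hc, h1, h2]
  have hFQ : ∀ i, x (c i - 1) ∈ firstQuadrant := fun i => by
    simp only [hc]
    split_ifs
    exacts [hxu _ (by omega), hxt _ (by omega)]
  have hmono : StrictMono c := by
    refine strictMono_nat_of_lt_succ fun i => ?_
    obtain ⟨j, rfl | rfl⟩ : ∃ j, i = 2 * j ∨ i = 2 * j + 1 := ⟨i / 2, by omega⟩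
    · rw [c0, c1]
      have := (hG' (K + j) (by omega)).1
      rw [hH _ (by omega)] at this
      exact_mod_cast this
    · rw [c1, show 2 * j + 1 + 1 = 2 * (j + 1) by ring, c0]
      have := (hH' (K + (j + 1)) (by omega)).1
      rw [show K + (j + 1) = K + j + 1 by ring, hG _ (by omega)] at this
      exact_mod_cast this
  have hgrow : ∀ i, (∀ s, c i < s → s < c (i + 1) → ¬ width x (s - 1) < width x s) ∨
      ∀ s, c i < s → s < c (i + 1) → ¬ height x (s - 1) < height x s := by
    intro i
    obtain ⟨j, rfl | rfl⟩ : ∃ j, i = 2 * j ∨ i = 2 * j + 1 := ⟨i / 2, by omega⟩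
    · left
      rw [c0, c1]
      intro s h1 h2
      refine (hG' (K + j) (by omega)).2.2 s ?_ h2
      rw [hH _ (by omega)]; exact_mod_cast h1
    · right
      rw [c1, show 2 * j + 1 + 1 = 2 * (j + 1) by ring, c0]
      intro s h1 h2
      refine (hH' (K + (j + 1)) (by omega)).2.2 s ?_ h2
      rw [show K + (j + 1) = K + j + 1 by ring, hG _ (by omega)]; exact_mod_cast h1
  obtain ⟨L, hL⟩ := hx.bddBelow_fst hmono hFQ hgrow
  obtain ⟨L', hL'⟩ := hx.swap.bddBelow_fst hmono (fun i => ⟨(hFQ i).2, (hFQ i).1⟩)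
    (fun i => (hgrow i).symm)
  exact ⟨L, L', fun n => ⟨hL n, hL' n⟩⟩

/-- If both coordinates of a path in the first quadrant are unbounded, then it settles there. -/
theorem settles_of_forall_mem (hFQ : ∀ n, x n ∈ firstQuadrant)
    (hgrow : ∀ t, (∃ s, ∀ i ≤ t, (x i).1 < (x s).1) ∧ ∃ s, ∀ i ≤ t, (x i).2 < (x s).2) (k : ℕ) :
    ∃ u t : ℕ, timeU x k = u ∧ timeT x (k + 1) = t ∧
      x u ∈ firstQuadrant ∧ x t ∈ firstQuadrant := by
  have hH : ∀ n : ℕ, ∃ t : ℕ, nextGrowth (height x) n = t := fun n =>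
    let ⟨_, hs⟩ := (hgrow n).2
    exists_nextGrowth_eq_of_lt hs
  have hW : ∀ n : ℕ, ∃ t : ℕ, nextGrowth (width x) n = t := fun n =>
    let ⟨_, hs⟩ := (hgrow n).1
    exists_nextGrowth_eq_of_lt hs
  have hG : ∀ k, ∃ n : ℕ, growthT x k = n := by
    intro k
    induction k with
    | zero => exact ⟨0, rfl⟩
    | succ k ih =>
      obtain ⟨n, hn⟩ := ih
      obtain ⟨t, ht⟩ := hH n
      obtain ⟨r, hr⟩ := hW t
      exact ⟨r, by rw [growthT, hn, ht, hr]⟩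
  obtain ⟨n, hn⟩ := hG k
  obtain ⟨m, hm⟩ := hG (k + 1)
  obtain ⟨t, ht⟩ := hH n
  refine ⟨t - 1, m - 1, ?_, ?_, hFQ _, hFQ _⟩
  · rw [timeU, hn, ht]; rfl
  · rw [timeT, hm]; rfl

end TriPrudent

/-! ### Settling has positive probability -/

namespace TriPrudent

/-- A prudent path to the corner `(m, m)` of its hull. -/
def cornerPath (m n : ℕ) : Site :=
  if n ≤ m then (n, 0) else if n < 2 * m then (m, n - m) else if n = 2 * m then (m - 1, m)
  else (m, m)

theorem cornerPath_zero (m : ℕ) : cornerPath m 0 = 0 := by simp [cornerPath]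

theorem cornerPath_mem_firstQuadrant {m : ℕ} (hm : 1 ≤ m) (n : ℕ) :
    cornerPath m n ∈ firstQuadrant := by
  unfold cornerPath firstQuadrant
  split_ifs <;> simp <;> omega

theorem mem_visited_cornerPath {m n : ℕ} {q : Site} (h : q ∈ visited ∅ (cornerPath m) n) :
    ∃ i ≤ n, cornerPath m i = q := by simpa [visited] using h

theorem cornerPath_step {m : ℕ} (hm : 1 ≤ m) {n : ℕ} (hn : n ≤ 2 * m) :
    cornerPath m (n + 1) - cornerPath m n ∈
      allowed (visited ∅ (cornerPath m) n) (cornerPath m n) := by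
  have key : ∀ d : Dir, cornerPath m (n + 1) - cornerPath m n = d.vec →
      Free (visited ∅ (cornerPath m) n) (cornerPath m n) d → _ := fun d h1 h2 =>
    h1 ▸ vec_mem_allowed.2 h2
  rcases lt_or_ge n m with h | h
  · refine key .E ?_ fun q hq _ => ?_
    · rw [cornerPath, cornerPath, if_pos (by omega), if_pos (by omega)]; simp [Dir.vec]
    · obtain ⟨i, hi, rfl⟩ := mem_visited_cornerPath hq
      rw [cornerPath, cornerPath, if_pos (by omega), if_pos (by omega)]
      simpa using hi
  rcases lt_or_ge n (2 * m - 1) with h' | h'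
  · refine key .N ?_ fun q hq => ?_
    · rcases h.eq_or_lt with rfl | h
      · simp only [cornerPath]
        rw [if_neg (by omega), if_pos (by omega), if_pos (by omega)]; simp [Dir.vec]
      · simp only [cornerPath]
        rw [if_neg (by omega), if_pos (by omega), if_neg (by omega), if_pos (by omega)]
        simp [Dir.vec]
    · obtain ⟨i, hi, rfl⟩ := mem_visited_cornerPath hq
      simp only [cornerPath]
      split_ifs <;> simp <;> omega
  rcases hn.lt_or_eq with h'' | rfl
  · obtain rfl : n = 2 * m - 1 := by omega
    refine key .A ?_ fun q hq => ?_
    · simp only [cornerPath]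
      split_ifs <;> simp [Dir.vec] <;> omega
    · obtain ⟨i, hi, rfl⟩ := mem_visited_cornerPath hq
      simp only [cornerPath]
      split_ifs <;> simp <;> omega
  · refine key .E ?_ fun q hq => ?_
    · simp only [cornerPath]
      split_ifs <;> simp [Dir.vec] <;> omega
    · obtain ⟨i, hi, rfl⟩ := mem_visited_cornerPath hq
      simp only [cornerPath]
      split_ifs <;> simp <;> omega

/-- The path ends (m, m - 1), (m - 1, m), (m, m): the first two sites block S and W at the corner,
which leaves exactly the four directions of `fresh`. -/
theorem isW_cornerPath {m : ℕ} (hm : 1 ≤ m) :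
    IsW (visited ∅ (cornerPath m) (2 * m + 1)) (cornerPath m (2 * m + 1)) .fresh := by
  have e : cornerPath m (2 * m + 1) = ((m : ℤ), (m : ℤ)) := by
    simp only [cornerPath]; split_ifs <;> first | omega | rfl
  have hmem : ∀ i ≤ 2 * m + 1, cornerPath m i ∈ visited ∅ (cornerPath m) (2 * m + 1) :=
    fun i hi => mem_visited _ _ hi
  have h1 := hmem (2 * m + 1) le_rfl
  have h2 : ((m : ℤ) - 1, (m : ℤ)) ∈ visited ∅ (cornerPath m) (2 * m + 1) := by
    convert hmem (2 * m) (by omega) using 1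
    simp only [cornerPath]; split_ifs <;> first | omega | rfl
  have h3 : ((m : ℤ), (m : ℤ) - 1) ∈ visited ∅ (cornerPath m) (2 * m + 1) := by
    convert hmem (2 * m - 1) (by omega) using 1
    simp only [cornerPath]; split_ifs <;> simp <;> omega
  have hle : ∀ q ∈ visited ∅ (cornerPath m) (2 * m + 1), q.1 ≤ m ∧ q.2 ≤ m := by
    intro q hq
    obtain ⟨i, hi, rfl⟩ := mem_visited_cornerPath hq
    simp only [cornerPath]
    split_ifs <;> simp <;> omega
  rw [e] at h1 ⊢
  refine ⟨⟨h1, fun q hq => ?_, fun q hq => ?_, fun q hq => ?_, ⟨_, h1, ?_⟩, ⟨_, h1, ?_⟩,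
    ⟨_, h1, ?_⟩⟩, fun d => ?_⟩
  any_goals simp [WS.fresh]
  · exact (hle q hq).1
  · exact (hle q hq).2
  · have := hle q hq; omega
  · cases d <;> simp only [Free, reduceCtorEq, or_false, or_true, false_iff,
      true_iff]
    · intro q hq _; exact (hle q hq).1
    · intro h; have := h _ h2 rfl; simp at this
    · intro q hq _; exact (hle q hq).2
    · intro h; have := h _ h3 rfl; simp at this
    · intro q hq _; exact (hle q hq).1
    · intro q hq hs; have := hle q hq; omega

variable {Ω : Type*} [MeasurableSpace Ω] {P : Measure Ω} [IsProbabilityMeasure P]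
  {X : ℕ → Ω → Site}

theorem measure_prefix_pos {K : Set Site} (h : IsPrudentWalkPast K P X) {x : ℕ → Site}
    (h0 : x 0 = 0) {t : ℕ}
    (hx : ∀ n < t, x (n + 1) - x n ∈ allowed (visited K x n) (x n)) :
    0 < P {ω | ∀ i ≤ t, X i ω = x i} := by
  induction t with
  | zero =>
    refine (zero_lt_one.trans_eq (measure_univ (μ := P)).symm).trans_le (measure_mono_ae ?_)
    filter_upwards [h.2.1] with ω hω _ i hi
    rw [Nat.le_zero.1 hi, hω, h0]
  | succ t ih =>
    rw [h.2.2 t x]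
    refine ENNReal.mul_pos (ih fun n hn => hx n (by omega)).ne' ?_
    have : x (t + 1) - x t ∈ allowed (K ∪ {y | ∃ i ≤ t, x i = y}) (x t) := hx t (by omega)
    rw [stepProb, if_pos this]
    exact ENNReal.inv_ne_zero.2 (ENNReal.natCast_ne_top _)

/-- After the path to the corner of a box of side m, the walk stays in the quadrant forever with
conditional probability at least 1/2. There it is confined, so almost surely both coordinates are
unbounded and it settles. -/
theorem measure_settles_pos (h : IsPrudentWalk P X) : 0 < P (settlesQ₁ X) := by
  obtain ⟨N₀, hN₀⟩ := WS.exists_exit_fresh_le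
  set m := max N₀ 1 with hm
  have hm1 : 1 ≤ m := le_max_right _ _
  set x := cornerPath m with hx
  set t := 2 * m + 1 with ht
  have hpre : 0 < P {ω | ∀ i ≤ t, X i ω = x i} := measure_prefix_pos h (cornerPath_zero m)
    fun n hn => cornerPath_step hm1 (by omega)
  set Q : Set Site → Site → Prop := fun _ p => p ∈ firstQuadrant with hQ
  set A : ℕ → Set Ω := fun n => {ω | (∀ i ≤ t, X i ω = x i) ∧
    ∀ j ≤ n, Q (visited ∅ (fun i => X i ω) (t + j)) (X (t + j) ω)} with hA
  have hV : Conv (visited ∅ x t) := by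
    have : ∀ n ≤ t, Conv (visited ∅ x n) := by
      intro n
      induction n with
      | zero => intro _; rw [visited_empty_zero]; exact conv_singleton _
      | succ n ih =>
        intro hn
        obtain ⟨d, hd⟩ := exists_vec_of_mem_allowed (cornerPath_step hm1 (show n ≤ 2 * m by omega))
        have hd' : x (n + 1) = x n + d.vec := by rw [hd]; abel
        rw [visited_succ, hd']
        exact (ih (by omega)).insert (mem_visited _ _ le_rfl) d
    exact this t le_rfl
  have hlow : Low (· ∈ firstQuadrant) (visited ∅ x t) := fun p hp =>
    ⟨⟨x 0, mem_visited _ _ (Nat.zero_le _), by rw [hx, cornerPath_zero]; exact hp.1⟩,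
      ⟨x 0, mem_visited _ _ (Nat.zero_le _), by rw [hx, cornerPath_zero]; exact hp.2⟩⟩
  have e : x t = ((m : ℤ), (m : ℤ)) := by
    simp only [hx, ht, cornerPath]; split_ifs <;> first | omega | rfl
  have hval : ∀ n, 1 / 2 ≤ val Q n (visited ∅ x t) (x t) := by
    intro n
    have h1 := one_sub_exit_le_val n hV (isW_cornerPath hm1) .tip hlow (A := m) (B := m)
      (by change (x t).1 + _ = _; rw [e]; simp [WS.fresh])
      (by change (x t).2 + _ = _; rw [e]; simp [WS.fresh])
    have h2 := hN₀ n m m (le_max_left _ _) (le_max_left _ _)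
    linarith
  have hAn : ∀ n, P {ω | ∀ i ≤ t, X i ω = x i} * ENNReal.ofReal (1 / 2) ≤ P (A n) := by
    intro n
    rw [hA, measure_prefix_and_forall h Q n x t]
    gcongr
    exact hval n
  have hanti : Antitone A := fun n k hnk ω hω => ⟨hω.1, fun j hj => hω.2 j (hj.trans hnk)⟩
  have hlim := tendsto_measure_iInter_atTop (μ := P) (s := A)
    (fun n => (measurableSet_val (K := ∅) h.1 Q x t n).nullMeasurableSet) hanti ⟨0, measure_ne_top P _⟩
  have hpos : 0 < P (⋂ n, A n) :=
    (ENNReal.mul_pos hpre.ne' (by simp)).trans_le (ge_of_tendsto' hlim hAn)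
  refine hpos.trans_le (measure_mono_ae ?_)
  filter_upwards [ae_exists_lt h] with ω hω hE
  have hE' := Set.mem_iInter.1 hE
  have hFQ : ∀ n, X n ω ∈ firstQuadrant := by
    intro n
    rcases le_or_gt n t with hn | hn
    · rw [(hE' 0).1 n hn]; exact cornerPath_mem_firstQuadrant hm1 n
    · have := (hE' (n - t)).2 (n - t) le_rfl
      rwa [Nat.add_sub_cancel' hn.le] at this
  exact ⟨0, fun k _ => settles_of_forall_mem hFQ (hω ⟨0, 0, hFQ⟩) k⟩

end TriPrudent

/-! ### Walks driven by random numbers, with waiting -/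

namespace TriPrudent

/-- Sequences of random numbers that drive the walks. -/
abbrev Noise : Type := ℕ → Fin 60

/-- The uniform distribution of a random number. -/
noncomputable def uniformNoise : Measure (Fin 60) := (PMF.uniformOfFintype (Fin 60)).toMeasure

instance : IsProbabilityMeasure uniformNoise := by unfold uniformNoise; infer_instance

/-- The law of a sequence of independent uniform random numbers. -/
noncomputable def noise : Measure Noise := Measure.infinitePi fun _ => uniformNoise

instance : IsProbabilityMeasure noise := by unfold noise; infer_instance

/-- The element of `F` that the random number `r` selects. -/
noncomputable def pick (F : Finset Site) (r : Fin 60) : Site :=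
  F.toList.getD (r % F.card) 0

theorem pick_mem {F : Finset Site} (hF : F.Nonempty) (r : Fin 60) : pick F r ∈ F := by
  have h : (r : ℕ) % F.card < F.toList.length := by
    rw [Finset.length_toList]; exact Nat.mod_lt _ hF.card_pos
  rw [pick, List.getD_eq_getElem _ _ h, ← Finset.mem_toList]
  exact List.getElem_mem h

/-- 60 is the least common multiple of 1, …, 6, so reduction modulo any possible number of prudent
steps is exactly uniform. -/
theorem card_filter_mod : ∀ c ∈ Finset.Icc 1 6, ∀ i < c,
    (Finset.univ.filter fun r : Fin 60 => (r : ℕ) % c = i).card * c = 60 := by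
  decide

theorem uniformNoise_pick {F : Finset Site} (hF : F.card ≤ 6) {v : Site} (hv : v ∈ F) :
    uniformNoise {r | pick F r = v} = (F.card : ℝ≥0∞)⁻¹ := by
  have hpos : 0 < F.card := Finset.card_pos.2 ⟨v, hv⟩
  obtain ⟨i, hi, hiv⟩ := List.getElem_of_mem (Finset.mem_toList.2 hv)
  have hi' : i < F.card := by rwa [Finset.length_toList] at hi
  have h1 : {r : Fin 60 | pick F r = v} =
      ↑(Finset.univ.filter fun r : Fin 60 => (r : ℕ) % F.card = i) := by
    ext r
    have h : (r : ℕ) % F.card < F.toList.length := by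
      rw [Finset.length_toList]; exact Nat.mod_lt _ hpos
    simp only [Set.mem_ofPred_eq, Finset.coe_filter, Finset.mem_univ, true_and]
    rw [pick, List.getD_eq_getElem _ _ h, ← hiv]
    exact F.nodup_toList.getElem_inj_iff
  have h2 := card_filter_mod F.card (Finset.mem_Icc.2 ⟨hpos, hF⟩) i hi'
  rw [h1, uniformNoise, PMF.toMeasure_uniformOfFintype_apply _ (Set.toFinite _).measurableSet]
  simp only [Finset.coe_sort_coe, Fintype.card_coe, Fintype.card_fin]
  set a := (Finset.univ.filter fun r : Fin 60 => (r : ℕ) % F.card = i).card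
  have ha : a ≠ 0 := by rintro h; rw [h] at h2; omega
  rw [← h2, Nat.cast_mul, ENNReal.div_eq_inv_mul, ENNReal.mul_inv (by simp) (by simp), mul_comm,
    ← mul_assoc, ENNReal.mul_inv_cancel (by simpa using ha) (by simp), one_mul]

theorem card_allowed_le (V : Set Site) (p : Site) : (allowed V p).card ≤ 6 := by
  classical
  refine (Finset.card_filter_le _ _).trans ?_
  decide

/-- The property `R` depends on the first `n` random numbers only. -/
def DependsOnFirst (n : ℕ) (R : Noise → Prop) : Prop :=
  ∀ ω ω' : Noise, (∀ i < n, ω i = ω' i) → R ω → R ω'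

theorem DependsOnFirst.eq_preimage {n : ℕ} {R : Noise → Prop} (hR : DependsOnFirst n R) :
    {ω | R ω} = (fun ω (i : Finset.range n) => ω i) ⁻¹' {f | ∃ ω, R ω ∧ ∀ i : Finset.range n, f i = ω i} := by
  ext ω
  simp only [Set.mem_ofPred_eq, Set.mem_preimage]
  refine ⟨fun h => ⟨ω, h, fun _ => rfl⟩, ?_⟩
  rintro ⟨ω', h, h'⟩
  exact hR ω' ω (fun i hi => (h' ⟨i, Finset.mem_range.2 hi⟩).symm) h

theorem DependsOnFirst.measurableSet {n : ℕ} {R : Noise → Prop} (hR : DependsOnFirst n R) :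
    MeasurableSet {ω | R ω} := by
  rw [hR.eq_preimage]
  have : Measurable fun (ω : Noise) (i : Finset.range n) => ω i := by fun_prop
  exact this (Set.to_countable _).measurableSet

theorem DependsOnFirst.noise_inter {n : ℕ} {R : Noise → Prop} (hR : DependsOnFirst n R)
    (s : Set (Fin 60)) : noise {ω | R ω ∧ ω n ∈ s} = noise {ω | R ω} * uniformNoise s := by
  have hind : ProbabilityTheory.iIndepFun (fun (i : ℕ) (ω : Noise) => ω i) noise :=
    ProbabilityTheory.iIndepFun_infinitePi (X := fun _ r => r) (fun _ => measurable_id)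
  have h1 := hind.indepFun_finset (Finset.range n) {n} (by simp) fun i => measurable_pi_apply i
  have h2 := h1.measure_inter_preimage_eq_mul {f | ∃ ω : Noise, R ω ∧ ∀ i : Finset.range n, f i = ω i}
    {f | f ⟨n, Finset.mem_singleton_self n⟩ ∈ s} (Set.to_countable _).measurableSet
    (Set.to_countable _).measurableSet
  rw [← hR.eq_preimage] at h2
  have h3 : (fun (ω : Noise) (i : ({n} : Finset ℕ)) => ω i) ⁻¹'
      {f | f ⟨n, Finset.mem_singleton_self n⟩ ∈ s} = (fun ω : Noise => ω n) ⁻¹' s := rfl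
  rw [h3] at h2
  have h4 : noise ((fun ω : Noise => ω n) ⁻¹' s) = uniformNoise s := by
    rw [← Measure.map_apply (measurable_pi_apply n) (Set.to_countable _).measurableSet]
    unfold noise
    rw [Measure.infinitePi_map_eval]
  rw [h4] at h2
  exact h2

/-- The path `x` after the prudent step at time `k` that the random number `r` selects. -/
noncomputable def extend (K : Set Site) (k : ℕ) (x : ℕ → Site) (r : Fin 60) : ℕ → Site :=
  Function.update x (k + 1) (x k + pick (allowed (visited K x k) (x k)) r)

/-- At each stage the walk `x` of the current length `k` either waits or makes a prudent step. -/
structure IsDelayed (K : Set Site) (k : ℕ → Noise → ℕ) (x : ℕ → Noise → ℕ → Site)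
    (adv : ℕ → Noise → Prop) : Prop where
  zero_k : ∀ ω, k 0 ω = 0
  zero_x : ∀ ω, x 0 ω = 0
  adv_k : ∀ n ω, adv n ω → k (n + 1) ω = k n ω + 1
  adv_x : ∀ n ω, adv n ω → x (n + 1) ω = extend K (k n ω) (x n ω) (ω n)
  wait_k : ∀ n ω, ¬ adv n ω → k (n + 1) ω = k n ω
  wait_x : ∀ n ω, ¬ adv n ω → x (n + 1) ω = x n ω
  dep : ∀ n (ω ω' : Noise), (∀ i < n, ω i = ω' i) →
    k n ω = k n ω' ∧ x n ω = x n ω' ∧ (adv n ω ↔ adv n ω')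

open Classical in
/-- The path without the waiting times. -/
noncomputable def limitPath (k : ℕ → Noise → ℕ) (x : ℕ → Noise → ℕ → Site) (t : ℕ) (ω : Noise) :
    Site :=
  if h : ∃ n, t ≤ k n ω then x (Nat.find h) ω t else 0

namespace IsDelayed

variable {K : Set Site} {k : ℕ → Noise → ℕ} {x : ℕ → Noise → ℕ → Site} {adv : ℕ → Noise → Prop}

theorem mono (h : IsDelayed K k x adv) (ω : Noise) : Monotone fun n => k n ω := by
  refine monotone_nat_of_le_succ fun n => ?_
  by_cases ha : adv n ω
  · rw [h.adv_k n ω ha]; omega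
  · rw [h.wait_k n ω ha]

theorem k_le (h : IsDelayed K k x adv) (n : ℕ) (ω : Noise) : k n ω ≤ n := by
  induction n with
  | zero => rw [h.zero_k]
  | succ n ih =>
    by_cases ha : adv n ω
    · rw [h.adv_k n ω ha]; omega
    · rw [h.wait_k n ω ha]; omega

theorem x_eq (h : IsDelayed K k x adv) {n m t : ℕ} {ω : Noise} (ht : t ≤ k n ω) (hnm : n ≤ m) :
    x m ω t = x n ω t := by
  induction m, hnm using Nat.le_induction with
  | base => rfl
  | succ m hm ih =>
    by_cases ha : adv m ω
    · have := h.mono ω hm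
      simp only at this
      rw [h.adv_x m ω ha, extend, Function.update_of_ne (by omega), ih]
    · rw [h.wait_x m ω ha, ih]

theorem limitPath_eq (h : IsDelayed K k x adv) {n t : ℕ} {ω : Noise} (ht : t ≤ k n ω) :
    limitPath k x t ω = x n ω t := by
  classical
  have hex : ∃ n, t ≤ k n ω := ⟨n, ht⟩
  rw [limitPath, dif_pos hex]
  exact (h.x_eq (Nat.find_spec hex) (Nat.find_min' hex ht)).symm

theorem visited_limitPath (h : IsDelayed K k x adv) {n t : ℕ} {ω : Noise} (ht : t ≤ k n ω) :
    visited K (fun i => limitPath k x i ω) t = visited K (x n ω) t :=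
  visited_congr fun _ hi => h.limitPath_eq (hi.trans ht)

theorem measurable_limitPath (h : IsDelayed K k x adv) (t : ℕ) : Measurable (limitPath k x t) := by
  refine measurable_to_countable' fun y => ?_
  have h1 : limitPath k x t ⁻¹' {y} = (⋃ n, {ω | t ≤ k n ω ∧ x n ω t = y}) ∪
      ⋂ n, {ω | k n ω < t ∧ 0 = y} := by
    ext ω
    simp only [Set.mem_preimage, Set.mem_singleton_iff, Set.mem_union, Set.mem_iUnion,
      Set.mem_iInter, Set.mem_ofPred_eq]
    by_cases hex : ∃ n, t ≤ k n ω
    · obtain ⟨n, hn⟩ := hex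
      rw [h.limitPath_eq hn]
      constructor
      · exact fun e => .inl ⟨n, hn, e⟩
      · rintro (⟨m, hm, e⟩ | h')
        · rw [← e, ← h.limitPath_eq hn, h.limitPath_eq hm]
        · have := (h' n).1; omega
    · rw [limitPath, dif_neg hex]
      push Not at hex
      constructor
      · exact fun e => .inr fun n => ⟨hex n, e⟩
      · rintro (⟨m, hm, -⟩ | h')
        · have := hex m; omega
        · exact (h' 0).2
  rw [h1]
  refine (MeasurableSet.iUnion fun n => DependsOnFirst.measurableSet (n := n) ?_).union
    (MeasurableSet.iInter fun n => DependsOnFirst.measurableSet (n := n) ?_)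
  · rintro ω ω' hω ⟨h1, h2⟩
    obtain ⟨e1, e2, -⟩ := h.dep n ω ω' hω
    exact ⟨e1 ▸ h1, e2 ▸ h2⟩
  · rintro ω ω' hω ⟨h1, h2⟩
    obtain ⟨e1, e2, -⟩ := h.dep n ω ω' hω
    exact ⟨e1 ▸ h1, h2⟩

theorem exists_stage (h : IsDelayed K k x adv) {ω : Noise} (ha : ∀ n, ∃ m ≥ n, adv m ω) (t : ℕ) :
    ∃ n, k n ω = t ∧ adv n ω := by
  classical
  have key : ∀ n, ∃ m, k m ω = k n ω ∧ adv m ω := by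
    intro n
    have hex := ha n
    obtain ⟨h1, h2⟩ := Nat.find_spec hex
    refine ⟨Nat.find hex, ?_, h2⟩
    have : ∀ j, n ≤ j → j ≤ Nat.find hex → k j ω = k n ω := by
      intro j hj
      induction j, hj using Nat.le_induction with
      | base => intro _; rfl
      | succ j hj ih =>
        intro hj'
        rw [h.wait_k j ω fun h' => Nat.find_min hex (by omega) ⟨hj, h'⟩, ih (by omega)]
    exact this _ h1 le_rfl
  induction t with
  | zero =>
    obtain ⟨m, hm, ha⟩ := key 0
    exact ⟨m, by rw [hm, h.zero_k], ha⟩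
  | succ t ih =>
    obtain ⟨n, hn, hadv⟩ := ih
    obtain ⟨m, hm, ha⟩ := key (n + 1)
    exact ⟨m, by rw [hm, h.adv_k n ω hadv, hn], ha⟩

theorem stage_unique (h : IsDelayed K k x adv) {ω : Noise} {n m : ℕ} (hn : adv n ω)
    (hm : adv m ω) (hk : k n ω = k m ω) : n = m := by
  have aux : ∀ n m, adv n ω → k n ω = k m ω → ¬ n < m := by
    intro n m hn hk hlt
    have h1 := h.mono ω (show n + 1 ≤ m from hlt)
    simp only [h.adv_k n ω hn] at h1
    omega
  have := aux n m hn hk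
  have := aux m n hm hk.symm
  omega

end IsDelayed

/-- Repeating the last step is always prudent, so the walk never gets stuck. -/
theorem nonempty_allowed_insert {V : Set Site} {p v : Site} (hv : v ∈ allowed V p) :
    v ∈ allowed (insert (p + v) V) (p + v) := by
  classical
  simp only [allowed, Finset.mem_filter] at hv ⊢
  refine ⟨hv.1, fun n hn => ?_⟩
  rw [Set.mem_insert_iff, not_or]
  constructor
  · intro h
    rw [add_eq_left, smul_eq_zero] at h
    rcases h with h | rfl
    · omega
    · exact absurd hv.1 (by decide)
  · have := hv.2 (n + 1) (by omega)
    rwa [add_smul, one_smul, add_comm (n • v), ← add_assoc] at this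

namespace IsDelayed

variable {K : Set Site} {k : ℕ → Noise → ℕ} {x : ℕ → Noise → ℕ → Site} {adv : ℕ → Noise → Prop}

theorem nonempty_allowed (h : IsDelayed K k x adv) (h0 : (allowed (K ∪ {0}) 0).Nonempty) (n : ℕ)
    (ω : Noise) : (allowed (visited K (x n ω) (k n ω)) (x n ω (k n ω))).Nonempty := by
  induction n with
  | zero =>
    rw [h.zero_k, h.zero_x]
    have : visited K 0 0 = K ∪ {0} := by ext y; simp [visited, eq_comm]
    rw [this]
    exact h0
  | succ n ih =>
    by_cases ha : adv n ω
    · have hv : visited K (extend K (k n ω) (x n ω) (ω n)) (k n ω) = visited K (x n ω) (k n ω) :=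
        visited_congr fun i hi => Function.update_of_ne (by omega) _ _
      rw [h.adv_k n ω ha, h.adv_x n ω ha, visited_succ, hv, extend, Function.update_self]
      exact ⟨_, nonempty_allowed_insert (pick_mem ih _)⟩
    · rwa [h.wait_k n ω ha, h.wait_x n ω ha]

/-- Split according to the stage n at which the step at time t is made. The event that this stage is
n and the path so far depend on the first n random numbers only, so the number that selects the step
is independent of them and uniform. -/
theorem isPrudentWalkPast (h : IsDelayed K k x adv) (h0 : (allowed (K ∪ {0}) 0).Nonempty)
    (hadv : ∀ᵐ ω ∂noise, ∀ n, ∃ m ≥ n, adv m ω) :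
    IsPrudentWalkPast K noise (limitPath k x) := by
  refine ⟨h.measurable_limitPath, ae_of_all _ fun ω => ?_, fun t y => ?_⟩
  · rw [h.limitPath_eq (n := 0) (Nat.zero_le _), h.zero_x]; rfl
  set S : ℕ → Noise → Prop := fun n ω => adv n ω ∧ k n ω = t with hS
  have hdecomp : ∀ A : Set Noise, MeasurableSet A →
      noise A = ∑' n, noise (A ∩ {ω | S n ω}) := by
    intro A hA
    rw [← measure_iUnion]
    · refine measure_congr ?_
      filter_upwards [hadv] with ω hω
      obtain ⟨n, hn, ha⟩ := h.exists_stage hω t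
      refine propext ⟨fun hA => ?_, fun hA => ?_⟩
      · exact Set.mem_iUnion.2 ⟨n, hA, ha, hn⟩
      · obtain ⟨n, hn, -⟩ := Set.mem_iUnion.1 hA
        exact hn
    · intro n m hnm
      refine Set.disjoint_left.2 ?_
      rintro ω ⟨-, h1, h2⟩ ⟨-, h3, h4⟩
      exact hnm (h.stage_unique h1 h3 (h2.trans h4.symm))
    · intro n
      refine hA.inter (DependsOnFirst.measurableSet (n := n) ?_)
      rintro ω ω' hω ⟨h1, h2⟩
      obtain ⟨e1, -, e3⟩ := h.dep n ω ω' hω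
      exact ⟨e3.1 h1, e1 ▸ h2⟩
  have hmeas : ∀ t, MeasurableSet {ω | ∀ i ≤ t, limitPath k x i ω = y i} := fun t =>
    measurableSet_prefix h.measurable_limitPath t (fun z => ∀ i ≤ t, z i = y i)
      fun z z' hz hzy i hi => by rw [← hz i hi, hzy i hi]
  rw [hdecomp _ (hmeas (t + 1)), hdecomp _ (hmeas t), ← ENNReal.tsum_mul_right]
  refine tsum_congr fun n => ?_
  set R : Noise → Prop := fun ω => (adv n ω ∧ k n ω = t) ∧ ∀ i ≤ t, x n ω i = y i with hR
  have hRdep : DependsOnFirst n R := by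
    rintro ω ω' hω ⟨⟨h1, h2⟩, h3⟩
    obtain ⟨e1, e2, e3⟩ := h.dep n ω ω' hω
    exact ⟨⟨e3.1 h1, e1 ▸ h2⟩, e2 ▸ h3⟩
  have e1 : {ω | ∀ i ≤ t, limitPath k x i ω = y i} ∩ {ω | S n ω} = {ω | R ω} := by
    ext ω
    simp only [Set.mem_inter_iff, Set.mem_ofPred_eq, hS, hR]
    rw [and_comm]
    refine and_congr_right fun h1 => forall₂_congr fun i hi => ?_
    rw [h.limitPath_eq (n := n) (by omega)]
  have e2 : {ω | ∀ i ≤ t + 1, limitPath k x i ω = y i} ∩ {ω | S n ω} =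
      {ω | R ω ∧ ω n ∈ {r | pick (allowed (visited K y t) (y t)) r = y (t + 1) - y t}} := by
    ext ω
    simp only [Set.mem_inter_iff, Set.mem_ofPred_eq, hS, hR]
    constructor
    · rintro ⟨h1, h2, h3⟩
      have h4 : ∀ i ≤ t, x n ω i = y i := fun i hi => by
        rw [← h1 i (by omega), h.limitPath_eq (n := n) (by omega)]
      refine ⟨⟨⟨h2, h3⟩, h4⟩, ?_⟩
      have h5 := h1 (t + 1) le_rfl
      rw [h.limitPath_eq (n := n + 1) (by rw [h.adv_k n ω h2]; omega), h.adv_x n ω h2, extend, h3,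
        Function.update_self, h4 t le_rfl, visited_congr h4] at h5
      rw [← h5]; abel
    · rintro ⟨⟨⟨h2, h3⟩, h4⟩, h5⟩
      refine ⟨fun i hi => ?_, h2, h3⟩
      rcases hi.eq_or_lt with rfl | hi
      · rw [h.limitPath_eq (n := n + 1) (by rw [h.adv_k n ω h2]; omega), h.adv_x n ω h2, extend, h3,
          Function.update_self, h4 t le_rfl, visited_congr h4, h5]
        abel
      · rw [h.limitPath_eq (n := n) (by omega), h4 i (by omega)]
  rw [e1, e2, hRdep.noise_inter]
  rcases Set.eq_empty_or_nonempty {ω | R ω} with he | ⟨ω, ⟨⟨-, h2⟩, h3⟩⟩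
  · rw [he]; simp
  congr 1
  -- As some step is prudent, the default value in `pick` is never used.
  have hne := h.nonempty_allowed h0 n ω
  rw [h2, visited_congr h3, h3 t le_rfl] at hne
  change _ = stepProb (visited K y t) (y t) (y (t + 1) - y t)
  rw [stepProb]
  split_ifs with hm
  · exact uniformNoise_pick (card_allowed_le _ _) hm
  · rw [← measure_empty (μ := uniformNoise)]
    congr 1
    ext r
    simp only [Set.mem_ofPred_eq, Set.mem_empty_iff_false, iff_false]
    rintro h
    exact hm (h ▸ pick_mem hne r)

end IsDelayed

end TriPrudent

/-! ### The coupling -/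

namespace TriPrudent

/-- The corners process up to time `n` that is driven by the random numbers. -/
noncomputable def hatPath : ℕ → Noise → ℕ → Site
  | 0, _ => 0
  | n + 1, ω => extend cornerBox n (hatPath n ω) (ω n)

/-- The walk `x` of length `k` is at a corner of its hull, but the corners process `y`
of length `n` is not. -/
def Waits (k : ℕ) (x : ℕ → Site) (n : ℕ) (y : ℕ → Site) : Prop :=
  IsW (visited ∅ x k) (x k) .fresh ∧ ¬ IsW (visited cornerBox y n) (y n) .fresh

open Classical in
/-- The length and the path of the coupled prudent walk at stage `n`. The walk
waits at a corner for the corners process. -/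
noncomputable def coupled : ℕ → Noise → ℕ × (ℕ → Site)
  | 0, _ => (0, 0)
  | n + 1, ω => if Waits (coupled n ω).1 (coupled n ω).2 n (hatPath n ω) then coupled n ω
      else ((coupled n ω).1 + 1, extend ∅ (coupled n ω).1 (coupled n ω).2 (ω n))

/-- The corners process of the coupling. -/
noncomputable def couplingHat : ℕ → Noise → Site := limitPath (fun n _ => n) hatPath

/-- The prudent walk of the coupling. -/
noncomputable def couplingWalk : ℕ → Noise → Site :=
  limitPath (fun n ω => (coupled n ω).1) fun n ω => (coupled n ω).2

theorem hatPath_congr {n : ℕ} {ω ω' : Noise} (h : ∀ i < n, ω i = ω' i) :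
    hatPath n ω = hatPath n ω' := by
  induction n with
  | zero => rfl
  | succ n ih => rw [hatPath, hatPath, ih fun i hi => h i (by omega), h n (by omega)]

theorem coupled_congr {n : ℕ} {ω ω' : Noise} (h : ∀ i < n, ω i = ω' i) :
    coupled n ω = coupled n ω' := by
  induction n with
  | zero => rfl
  | succ n ih =>
    rw [coupled, coupled, ih fun i hi => h i (by omega), h n (by omega),
      hatPath_congr fun i hi => h i (by omega)]

theorem isDelayed_hat : IsDelayed cornerBox (fun n _ => n) hatPath fun _ _ => True where
  zero_k _ := rfl
  zero_x _ := rfl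
  adv_k _ _ _ := rfl
  adv_x _ _ _ := rfl
  wait_k _ _ h := (h trivial).elim
  wait_x _ _ h := (h trivial).elim
  dep _ _ _ h := ⟨rfl, hatPath_congr h, Iff.rfl⟩

theorem isDelayed_coupled : IsDelayed ∅ (fun n ω => (coupled n ω).1) (fun n ω => (coupled n ω).2)
    fun n ω => ¬ Waits (coupled n ω).1 (coupled n ω).2 n (hatPath n ω) where
  zero_k _ := rfl
  zero_x _ := rfl
  adv_k n ω h := by rw [coupled, if_neg h]
  adv_x n ω h := by rw [coupled, if_neg h]
  wait_k n ω h := by rw [coupled, if_pos (not_not.1 h)]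
  wait_x n ω h := by rw [coupled, if_pos (not_not.1 h)]
  dep n ω ω' h := by rw [coupled_congr h, hatPath_congr h]; exact ⟨rfl, rfl, Iff.rfl⟩

theorem couplingHat_eq (n : ℕ) (ω : Noise) : couplingHat n ω = hatPath n ω n :=
  isDelayed_hat.limitPath_eq (n := n) le_rfl

theorem visited_couplingHat (n : ℕ) (ω : Noise) :
    visited cornerBox (fun i => couplingHat i ω) n = visited cornerBox (hatPath n ω) n :=
  isDelayed_hat.visited_limitPath (n := n) le_rfl

theorem isCornersProcess_couplingHat : IsCornersProcess noise couplingHat := by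
  refine isDelayed_hat.isPrudentWalkPast ⟨Dir.vec .E, vec_mem_allowed.2 ?_⟩
    (ae_of_all _ fun ω n => ⟨n, le_rfl, trivial⟩)
  rintro q (hq | rfl) -
  exacts [hq.1, le_rfl]

theorem ae_exists_fresh_couplingHat : ∀ᵐ ω ∂noise, ∀ t, ∃ s ≥ t,
    IsW (visited cornerBox (hatPath s ω) s) (hatPath s ω s) .fresh := by
  filter_upwards [ae_exists_fresh_cornerBox isCornersProcess_couplingHat] with ω h t
  obtain ⟨s, hs, hW⟩ := h t
  rw [visited_couplingHat, couplingHat_eq] at hW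
  exact ⟨s, hs, hW⟩

theorem isPrudentWalk_couplingWalk : IsPrudentWalk noise couplingWalk := by
  refine isDelayed_coupled.isPrudentWalkPast ⟨Dir.vec .E, vec_mem_allowed.2 ?_⟩ ?_
  · rintro q (hq | rfl) -
    exacts [hq.elim, le_rfl]
  · filter_upwards [ae_exists_fresh_couplingHat] with ω h t
    obtain ⟨s, hs, hW⟩ := h t
    exact ⟨s, hs, fun hw => hw.2 hW⟩

theorem IsW.unique {V : Set Site} {p : Site} {w w' : WS} (h : IsW V p w) (h' : IsW V p w') :
    w = w' := by
  obtain ⟨⟨-, hA, hB, hC, ⟨qA, hqA, eA⟩, ⟨qB, hqB, eB⟩, ⟨qC, hqC, eC⟩⟩, hF⟩ := h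
  obtain ⟨⟨-, hA', hB', hC', ⟨rA, hrA, fA⟩, ⟨rB, hrB, fB⟩, ⟨rC, hrC, fC⟩⟩, hF'⟩ := h'
  have h1 : w.dA = w'.dA := by have := hA' _ hqA; have := hA _ hrA; omega
  have h2 : w.dB = w'.dB := by have := hB' _ hqB; have := hB _ hrB; omega
  have h3 : w.dC = w'.dC := by have := hC' _ hqC; have := hC _ hrC; omega
  have h4 : w.F = w'.F := by ext d; rw [hF, hF']
  cases w; cases w'
  simp only at h1 h2 h3 h4
  subst h1 h2 h3 h4
  rfl

/-- After a common visit to a corner both walks make the same steps. -/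
theorem exists_parallel {ω : Noise} (hx : Prudent ∅ fun n => couplingWalk n ω)
    (hy : Prudent cornerBox fun n => couplingHat n ω)
    (hadv : ∀ t, ∃ s ≥ t, IsW (visited cornerBox (hatPath s ω) s) (hatPath s ω s) .fresh)
    (hc : Confined fun n => couplingWalk n ω)
    (hfr : ∀ t, ∃ s ≥ t, IsW (visited ∅ (fun i => couplingWalk i ω) s) (couplingWalk s ω) .fresh) :
    ∃ m s, s ≤ m ∧ ∀ j, couplingHat (m + j) ω - couplingWalk (s + j) ω =
      couplingHat m ω - couplingWalk s ω := by
  obtain ⟨α, β, n₀, hαβ, hlow⟩ := hc.exists_low (K := ∅)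
  obtain ⟨s, hs, hW⟩ := hfr n₀
  have hadv' : ∀ n, ∃ m ≥ n, ¬ Waits (coupled m ω).1 (coupled m ω).2 m (hatPath m ω) := fun n =>
    let ⟨m, hm, hW⟩ := hadv n
    ⟨m, hm, fun hw => hw.2 hW⟩
  obtain ⟨m, hk, hm⟩ := isDelayed_coupled.exists_stage hadv' s
  have hcur : ∀ n t, (coupled n ω).1 = t → (coupled n ω).2 t = couplingWalk t ω ∧
      visited ∅ (coupled n ω).2 t = visited ∅ (fun i => couplingWalk i ω) t := fun n t h =>
    ⟨(isDelayed_coupled.limitPath_eq (n := n) h.ge).symm,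
      (isDelayed_coupled.visited_limitPath (n := n) h.ge).symm⟩
  refine ⟨m, s, hk ▸ isDelayed_coupled.k_le m ω, ?_⟩
  have hsync : ∀ n t, (coupled n ω).1 = t →
      (Waits (coupled n ω).1 (coupled n ω).2 n (hatPath n ω) ↔
        IsW (visited ∅ (fun i => couplingWalk i ω) t) (couplingWalk t ω) .fresh ∧
        ¬ IsW (visited cornerBox (fun i => couplingHat i ω) n) (couplingHat n ω) .fresh) := by
    intro n t h
    rw [Waits, h, (hcur n t h).1, (hcur n t h).2, visited_couplingHat, couplingHat_eq]
  have key : ∀ j, (coupled (m + j) ω).1 = s + j ∧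
      couplingHat (m + j) ω - couplingWalk (s + j) ω = couplingHat m ω - couplingWalk s ω ∧
      ∃ w : WS, w.Good ∧
        IsW (visited ∅ (fun i => couplingWalk i ω) (s + j)) (couplingWalk (s + j) ω) w ∧
        IsW (visited cornerBox (fun i => couplingHat i ω) (m + j)) (couplingHat (m + j) ω) w := by
    intro j
    induction j with
    | zero =>
      refine ⟨hk, rfl, .fresh, .tip, hW, ?_⟩
      have := (hsync m s hk).not.1 hm
      by_contra hn
      exact this ⟨hW, hn⟩
    | succ j ih =>
      obtain ⟨hk, hdiff, w, hw, hW, hW'⟩ := ih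
      -- Equal states are fresh together, so the walk never waits again.
      have ha : ¬ Waits (coupled (m + j) ω).1 (coupled (m + j) ω).2 (m + j)
          (hatPath (m + j) ω) := by
        rw [hsync _ _ hk]
        rintro ⟨h1, h2⟩
        exact h2 (hW.unique h1 ▸ hW')
      obtain ⟨d, hd, hxd, hWd⟩ := hx.isW_succ (hx.conv_empty _) hW hw (hlow (s + j) (by omega))
        (hαβ _)
      obtain ⟨d', hd', hyd, hWd'⟩ := hy.isW_succ (hy.conv_cornerBox _) hW' hw (low_cornerBox _)
        trivial
      have h1 : (coupled (m + j + 1) ω).1 = s + j + 1 := by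
        rw [isDelayed_coupled.adv_k _ _ ha, hk]
      have e1 := (hcur _ _ h1).1
      rw [isDelayed_coupled.adv_x _ _ ha, extend, hk, Function.update_self, (hcur _ _ hk).1,
        (hcur _ _ hk).2, hW.allowed_eq] at e1
      have e2 := couplingHat_eq (m + j + 1) ω
      rw [hatPath, extend, Function.update_self, ← visited_couplingHat, ← couplingHat_eq,
        hW'.allowed_eq] at e2
      -- Both pick with the same random number from the same set of prudent steps.
      have hdd : d' = d := by
        refine Dir.vec_injective (add_left_cancel (a := couplingHat (m + j) ω) ?_)
        rw [← hyd, e2]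
        exact congrArg _ (add_left_cancel (e1.trans hxd))
      subst hdd
      refine ⟨h1, ?_, _, hw.next hd, hWd, hWd'⟩
      rw [← hdiff, ← add_assoc, ← add_assoc, hxd, hyd]
      abel
  exact fun j => (key j).2.1

/-! ### From parallel motion to the bounds on the distance -/

theorem pos_sub (x y : Site) : pos x - pos y = pos (x - y) := by
  simp only [pos, Prod.fst_sub, Prod.snd_sub, Int.cast_sub, sub_smul]
  abel

theorem norm_pos_le (x : Site) : ‖pos x‖ ≤ |(x.1 : ℝ)| + |(x.2 : ℝ)| := by
  have h1 : ‖e₁‖ = 1 := by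
    rw [e₁, EuclideanSpace.norm_eq]
    norm_num [Fin.sum_univ_two, div_pow]
  have h2 : ‖e₂‖ = 1 := by
    rw [e₂, EuclideanSpace.norm_eq]
    norm_num [Fin.sum_univ_two, div_pow]
  refine (norm_add_le _ _).trans ?_
  rw [norm_smul, norm_smul, h1, h2, mul_one, mul_one, Real.norm_eq_abs, Real.norm_eq_abs]

theorem Prudent.norm_pos_sub_le {K : Set Site} {x : ℕ → Site} (hx : Prudent K x) (n j : ℕ) :
    ‖pos (x (n + j)) - pos (x n)‖ ≤ 2 * j := by
  induction j with
  | zero => simp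
  | succ j ih =>
    obtain ⟨d, hd, -⟩ := hx.exists_dir (n + j)
    have h1 : ‖pos d.vec‖ ≤ 2 := by
      refine (norm_pos_le _).trans ?_
      cases d <;> simp [Dir.vec] <;> norm_num
    have h2 : pos (x (n + (j + 1))) - pos (x n) = pos d.vec + (pos (x (n + j)) - pos (x n)) := by
      have : pos (x (n + (j + 1))) - pos (x (n + j)) = pos d.vec := by
        rw [pos_sub, ← add_assoc, hd, add_sub_cancel_left]
      rw [← this]; abel
    rw [h2]
    refine (norm_add_le _ _).trans ?_
    push_cast
    linarith

/-- At equal times the two differ by the constant displacement and by what the walk covers in the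
fixed lag m - s. Before time m, both are within a bounded distance of the origin. -/
theorem bounded_of_parallel {K K' : Set Site} {x y : ℕ → Site} (hx : Prudent K x)
    (hy : Prudent K' y) {m s : ℕ} (hsm : s ≤ m) (h : ∀ j, y (m + j) - x (s + j) = y m - x s) :
    ∃ C : ℝ, ∀ t, ‖pos (y t) - pos (x t)‖ ≤ C := by
  refine ⟨‖pos (y m - x s)‖ + 2 * m + 4 * m, fun t => ?_⟩
  have h0 := norm_nonneg (pos (y m - x s))
  rcases le_or_gt m t with ht | ht
  · obtain ⟨j, rfl⟩ := Nat.exists_eq_add_of_le ht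
    obtain ⟨l, rfl⟩ := Nat.exists_eq_add_of_le hsm
    have h1 := hx.norm_pos_sub_le (s + j) l
    have h2 : pos (y (s + l + j)) - pos (x (s + l + j)) =
        pos (y (s + l) - x s) - (pos (x (s + j + l)) - pos (x (s + j))) := by
      rw [← h j, ← pos_sub, show s + l + j = s + j + l by ring]; abel
    rw [h2]
    refine (norm_sub_le _ _).trans ?_
    push_cast
    have : (0 : ℝ) ≤ s := by positivity
    have : (0 : ℝ) ≤ l := by positivity
    linarith
  · have h1 := hx.norm_pos_sub_le 0 t
    have h2 := hy.norm_pos_sub_le 0 t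
    rw [zero_add, hx.1] at h1
    rw [zero_add, hy.1] at h2
    have h3 : pos (y t) - pos (x t) = (pos (y t) - pos 0) - (pos (x t) - pos 0) := by abel
    rw [h3]
    refine (norm_sub_le _ _).trans ?_
    have : (t : ℝ) ≤ m := by exact_mod_cast ht.le
    have : (0 : ℝ) ≤ m := by positivity
    linarith

theorem ae_bounded : ∀ᵐ ω ∂noise, ω ∈ settlesQ₁ couplingWalk →
    ∃ C : ℝ, ∀ t : ℕ, ‖pos (couplingHat t ω) - pos (couplingWalk t ω)‖ ≤ C := by
  filter_upwards [ae_prudent isPrudentWalk_couplingWalk, ae_prudent isCornersProcess_couplingHat,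
    ae_exists_fresh_couplingHat, ae_exists_fresh isPrudentWalk_couplingWalk] with ω hx hy hadv hfr hQ
  obtain ⟨K, hK⟩ := hQ
  have hc := hx.confined_of_settles hK
  obtain ⟨m, s, hsm, h⟩ := exists_parallel hx hy hadv hc (hfr hc)
  exact bounded_of_parallel hx hy hsm h

theorem tendsto_scaledSupDist {γhat γ : ℕ → Noise → Site} {ω : Noise} {C : ℝ}
    (h : ∀ t : ℕ, ‖pos (γhat t ω) - pos (γ t ω)‖ ≤ C) :
    Tendsto (fun t => scaledSupDist γhat γ t ω) atTop (𝓝 0) := by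
  have h1 : Tendsto (fun t : ℕ => C / (t : ℝ)) atTop (𝓝 0) := tendsto_const_div_atTop_nhds_zero_nat C
  refine tendsto_of_tendsto_of_tendsto_of_le_of_le tendsto_const_nhds h1 (fun t => ?_) fun t => ?_
  · exact (norm_nonneg _).trans (Finset.le_sup' (fun s => ‖(1 / (t : ℝ)) •
      (pos (γhat s ω) - pos (γ s ω))‖) (Finset.self_mem_range_succ t))
  · refine Finset.sup'_le _ _ fun s _ => ?_
    rw [norm_smul, Real.norm_eq_abs, abs_of_nonneg (by positivity), div_mul_eq_mul_div, one_mul]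
    exact div_le_div_of_nonneg_right (h s) (by positivity)

theorem measurable_of_sites {Ω : Type*} [MeasurableSpace Ω] {x y : Ω → Site} (hx : Measurable x)
    (hy : Measurable y) (f : Site × Site → ℝ) : Measurable fun ω => f (x ω, y ω) :=
  (measurable_of_countable f).comp (hx.prodMk hy)

theorem measurable_norm_sub {Ω : Type*} [MeasurableSpace Ω] {γhat γ : ℕ → Ω → Site}
    (hγhat : ∀ n, Measurable (γhat n)) (hγ : ∀ n, Measurable (γ n)) (c : ℝ) (s : ℕ) :
    Measurable fun ω => ‖c • (pos (γhat s ω) - pos (γ s ω))‖ :=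
  measurable_of_sites (hγhat s) (hγ s) fun p => ‖c • (pos p.1 - pos p.2)‖

theorem measurable_scaledSupDist {γhat γ : ℕ → Noise → Site} (hγhat : ∀ n, Measurable (γhat n))
    (hγ : ∀ n, Measurable (γ n)) (t : ℕ) : Measurable (scaledSupDist γhat γ t) := by
  have := Finset.measurable_sup' (Finset.nonempty_range_add_one (n := t))
    (f := fun s ω => ‖(1 / (t : ℝ)) • (pos (γhat s ω) - pos (γ s ω))‖)
    fun s _ => measurable_norm_sub hγhat hγ _ s
  convert this using 1
  ext ω
  rw [scaledSupDist, Finset.sup'_apply]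

/-- Bounded distance gives almost sure convergence to 0 under the conditional measure, hence
convergence in measure. The measurable set B carries the argument, so measurability of s is not
needed. -/
theorem tendsto_cond {γhat γ : ℕ → Noise → Site} (hγhat : ∀ n, Measurable (γhat n))
    (hγ : ∀ n, Measurable (γ n)) {s : Set Noise} (hs : noise s ≠ 0)
    (h : ∀ᵐ ω ∂noise, ω ∈ s → ∃ C : ℝ, ∀ t : ℕ, ‖pos (γhat t ω) - pos (γ t ω)‖ ≤ C) {ε : ℝ}
    (hε : 0 < ε) :
    Tendsto (fun t : ℕ => ProbabilityTheory.cond noise s {ω | ε ≤ scaledSupDist γhat γ t ω})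
      atTop (𝓝 0) := by
  set B : Set Noise := {ω | ∃ C : ℕ, ∀ t : ℕ, ‖(1 : ℝ) • (pos (γhat t ω) - pos (γ t ω))‖ ≤ C}
    with hB
  have hBm : MeasurableSet B := by
    have : B = ⋃ C : ℕ, ⋂ t : ℕ, {ω | ‖(1 : ℝ) • (pos (γhat t ω) - pos (γ t ω))‖ ≤ C} := by
      ext ω; simp [hB]
    rw [this]
    exact MeasurableSet.iUnion fun C => MeasurableSet.iInter fun t =>
      measurableSet_le (measurable_norm_sub hγhat hγ 1 t) measurable_const
  have hBs : ∀ᵐ ω ∂ProbabilityTheory.cond noise s, ω ∈ B := by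
    rw [ProbabilityTheory.cond]
    refine Measure.ae_smul_measure ?_ _
    rw [ae_iff, show {ω | ω ∉ B} = Bᶜ from rfl, Measure.restrict_apply hBm.compl]
    refine measure_mono_null ?_ (ae_iff.1 h)
    rintro ω ⟨h1, h2⟩ h3
    obtain ⟨C, hC⟩ := h3 h2
    obtain ⟨N, hN⟩ := exists_nat_ge C
    exact h1 ⟨N, fun t => by rw [one_smul]; exact (hC t).trans hN⟩
  have hprob : IsProbabilityMeasure (ProbabilityTheory.cond noise s) :=
    ProbabilityTheory.cond_isProbabilityMeasure hs
  have hT := tendstoInMeasure_of_tendsto_ae (μ := ProbabilityTheory.cond noise s)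
    (f := fun t => scaledSupDist γhat γ t) (g := fun _ => 0)
    (fun t => (measurable_scaledSupDist hγhat hγ t).aestronglyMeasurable) (by
      filter_upwards [hBs] with ω hω
      obtain ⟨C, hC⟩ := hω
      exact tendsto_scaledSupDist (C := C) fun t => by simpa using hC t)
  rw [tendstoInMeasure_iff_norm] at hT
  refine tendsto_of_tendsto_of_tendsto_of_le_of_le tendsto_const_nhds (hT ε hε)
    (fun _ => zero_le) fun t => measure_mono fun ω hω => ?_
  simp only [Set.mem_ofPred_eq, sub_zero] at hω ⊢
  exact hω.trans (le_abs_self _)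

end TriPrudent

theorem mainTheorem2 :
    ∃ (Ω : Type) (_ : MeasurableSpace Ω) (P : Measure Ω) (_ : IsProbabilityMeasure P)
      (γ γhat : ℕ → Ω → TriPrudent.Site),
      TriPrudent.IsPrudentWalk P γ ∧
      TriPrudent.IsCornersProcess P γhat ∧
      0 < P (TriPrudent.settlesQ₁ γ) ∧
      (∀ᵐ ω ∂P, ω ∈ TriPrudent.settlesQ₁ γ →
        ∃ C : ℝ, ∀ t : ℕ, ‖TriPrudent.pos (γhat t ω) - TriPrudent.pos (γ t ω)‖ ≤ C) ∧
      ∀ ε : ℝ, 0 < ε →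
        Tendsto
          (fun t : ℕ => ProbabilityTheory.cond P (TriPrudent.settlesQ₁ γ)
            {ω | ε ≤ TriPrudent.scaledSupDist γhat γ t ω})
          atTop (𝓝 0) := by
  have hγ := TriPrudent.isPrudentWalk_couplingWalk
  have hγhat := TriPrudent.isCornersProcess_couplingHat
  have hpos := TriPrudent.measure_settles_pos hγ
  exact ⟨TriPrudent.Noise, inferInstance, TriPrudent.noise, inferInstance, TriPrudent.couplingWalk,
    TriPrudent.couplingHat, hγ, hγhat, hpos, TriPrudent.ae_bounded, fun ε hε =>
    TriPrudent.tendsto_cond hγhat.1 hγ.1 hpos.ne' TriPrudent.ae_bounded hε⟩
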